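/- Let $p$ be an odd prime, let $q$ be a power of $p$, and let $d$ be a positive integer not divisible by $p$. Let $K=\mathbb{F}_q(t^{1/d})=\mathbb{F}_q(u)$, where $u^d=t$, and let $E$ be the elliptic curve $y^2=x(x+1)(x+t)$ over $K$. For a place $v$ of $K$ (including the place at infinity) let $\deg v$ be the degree over $\mathbb{F}_q$ of the residue field $\kappa_v$, let $q_v=q^{\deg v}$, and let $L_v(T)=1-a_vT+q_vT^2$ with $a_v=q_v+1-|E(\kappa_v)|$ if $E$ has good reduction at $v$, and $L_v(T)=1-T$, $1+T$, $1$ if the reduction is split multiplicative, nonsplit multiplicative, additive respectively (all for a minimal Weierstrass model at $v$). The Hasse–Weil $L$-function $L(E/K,s)$ is the Euler product $\prod_v L_v(q^{-s\deg v})^{-1}$, which converges for $\operatorname{Re}(s)$ sufficiently large, together with its continuation to an entire function of $s$. For an integer $e>2$ prime to $p$, let $\langle p\rangle_e$ be the subgroup of $(\mathbb{Z}/e\mathbb{Z})^\times$ generated by $p$. We say that $p$ is balanced modulo $e$ if every coset of $\langle p\rangle_e$ in $(\mathbb{Z}/e\mathbb{Z})^\times$ contains as many classes with least positive residue in $(0,e/2)$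 as classes with least positive residue in $(e/2,e)$. Then $L(E/K,s)$ has such an entire continuation, and its order of vanishing at $s=1$ is $$\operatorname{ord}_{s=1}L(E/K,s)=\sum_{\substack{e\mid d\\ e>2}}\begin{cases}\dfrac{\phi(e)}{o_e(q)}&\text{if $p$ is balanced modulo $e$,}\\[1ex]0&\text{otherwise,}\end{cases}$$ where $\phi$ is Euler's function and $o_e(q)$ is the order of $q$ in $(\mathbb{Z}/e\mathbb{Z})^\times$. -/

import Mathlib

/-- A place of `K` over the constant field `k`: a discrete valuation ring of `K` (with fraction
field `K`) which contains `k`. For `K = k(u)` these are the closed points of the projective line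
over `k`, the point at infinity included. -/
structure FunctionFieldPlace (k K : Type*) [Field k] [Field K] [Algebra k K] where
  /-- the valuation ring of the place -/
  ring : ValuationSubring K
  algebraMap_mem : ∀ c : k, algebraMap k K c ∈ ring
  isDVR : IsDiscreteValuationRing ring

namespace FunctionFieldPlace

variable {k K : Type*} [Field k] [Field K] [Algebra k K]

instance (v : FunctionFieldPlace k K) : IsDiscreteValuationRing v.ring := v.isDVR

/-- The embedding of the constant field `k` into the residue field at `v`. -/
noncomputable def residueMap (v : FunctionFieldPlace k K) :
    k →+* IsLocalRing.ResidueField v.ring :=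
  (IsLocalRing.residue v.ring).comp
    ((algebraMap k K).codRestrict v.ring.toSubring v.algebraMap_mem)

/-- The degree of `v`: the degree over `k` of the residue field at `v`. -/
noncomputable def degree (v : FunctionFieldPlace k K) : ℕ :=
  letI : Algebra k (IsLocalRing.ResidueField v.ring) := v.residueMap.toAlgebra
  Module.finrank k (IsLocalRing.ResidueField v.ring)

end FunctionFieldPlace

/-- `f` is the Hasse-Weil `L`-function `s ↦ L(W/K, s)` of the curve `W` over the function field `K`
with finite field of constants `k` of cardinality `q`: the entire function which, for all `s` of
sufficiently large real part, is the value of the Euler product of the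
`1 / L_v(T ^ deg v)` with `T = q ^ (-s)`, over all places `v` of `K`. Here `L_v(T)` is the usual
local polynomial of (a minimal model of) `W` at `v`: `1 - a_v T + q_v T ^ 2` with
`a_v = q_v + 1 - |W(κ_v)|` for good reduction, `1 - T`, `1 + T`, `1` for split multiplicative,
nonsplit multiplicative, additive reduction. -/
def IsHasseWeilLFunction (k : Type*) {K : Type*} [Field k] [Field K] [Algebra k K]
    (W : WeierstrassCurve K) (f : ℂ → ℂ) : Prop :=
  Differentiable ℂ f ∧ ∃ σ : ℝ, ∀ s : ℂ, σ < s.re →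
    HasProd (fun v : FunctionFieldPlace k K ↦
      (Polynomial.aeval (((Nat.card k : ℂ) ^ (-s)) ^ v.degree) (W.localPolynomial v.ring))⁻¹) (f s)

/-- The Legendre curve `y ^ 2 = x (x + 1) (x + t)`. -/
def legendreCurve {R : Type*} [CommRing R] (t : R) : WeierstrassCurve R where
  a₁ := 0
  a₂ := 1 + t
  a₃ := 0
  a₄ := t
  a₆ := 0

/-- Defining equation of the Legendre curve. -/
theorem legendreCurve_equation {R : Type*} [CommRing R] (t x y : R) :
    (legendreCurve t).toAffine.Equation x y ↔ y ^ 2 = x * (x + 1) * (x + t) := by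
  rw [WeierstrassCurve.Affine.equation_iff]
  simp only [legendreCurve]
  ring_nf

/-- The Legendre curve over `K = F(u)`, where `u ^ d = t`; that is, over `K = F(t^{1/d})`. -/
noncomputable def legendreCurveOver (F : Type*) [Field F] (d : ℕ) : WeierstrassCurve (RatFunc F) :=
  legendreCurve ((RatFunc.X : RatFunc F) ^ d)

/-- The units modulo `m` whose least positive residue lies in `(0, m / 2)`. -/
def lowerUnits (m : ℕ) : Set (ZMod m)ˣ :=
  {x | 0 < (x : ZMod m).val ∧ 2 * (x : ZMod m).val < m}

/-- The units modulo `m` whose least positive residue lies in `(m / 2, m)`. -/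
def upperUnits (m : ℕ) : Set (ZMod m)ˣ :=
  {x | m < 2 * (x : ZMod m).val}

/-- `H` is a balanced subgroup of the units modulo `m`: every coset of `H` is evenly divided between
the two halves. -/
def IsBalancedSubgroup {m : ℕ} (H : Subgroup (ZMod m)ˣ) : Prop :=
  ∀ g : (ZMod m)ˣ, (((fun x ↦ g * x) '' (H : Set (ZMod m)ˣ)) ∩ lowerUnits m).ncard =
    (((fun x ↦ g * x) '' (H : Set (ZMod m)ˣ)) ∩ upperUnits m).ncard

/-- `p` is (prime to `m` and) balanced modulo `m`. -/
def IsBalancedMod (p m : ℕ) : Prop :=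
  ∃ u : (ZMod m)ˣ, (u : ZMod m) = (p : ZMod m) ∧ IsBalancedSubgroup (Subgroup.zpowers u)

noncomputable instance (p m : ℕ) : Decidable (IsBalancedMod p m) := Classical.propDecidable _

/-! Write q for the cardinality of `F`, χ for the quadratic character of a finite field, S(t) = Σ_x
χ(x(x+1)(x+t)) (`legendreSum`) and J(ψ, φ) for Jacobi sums.

The L-function is an explicit polynomial in T = q^(-s). At a closed point of the affine line the
local polynomial is 1 + S(τ) T + δ T², where τ is the residue of t and δ is the order of the residue
field, or 0 at bad places. Its reciprocal roots α, β satisfy S = -(α^m + β^m) over the extension of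
degree m (`legendreSum_extension`). Hence, apart from the place at infinity, the degree n
coefficient of the logarithm of the Euler product is -(1/n) Σ S(u^d), with u running over the field
with q^n elements. Counting d-th roots by characters and using Σ_t ψ(t) S(t) = J(ψ, χ)²
(`sum_mul_legendreSum`) turns this into a sum of squares of Jacobi sums. The characters ψ of order
at most 2 account for the fibre t = 0 and for the place at infinity. The Hasse-Davenport relation
(`jacobiSum_normLift`) makes the remaining terms powers of fixed numbers, so that L is the product
of 1 - J_c² T^(o_c) over the orbits of multiplication by q on the c in ℤ/d of order greater than 2
(`hasProd_localPolynomial_legendreCurveOver`). Here o_c is the length of the orbit, and J_c is taken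
over the extension of degree o_c. A factor vanishes at s = 1, and then simply, exactly when J_c² =
q^(o_c). There are φ(e)/o_e(q) orbits with c of order e.

It remains to see that J(ψ, χ)² = Q, for ψ of order e > 2 on a field with Q elements, means that p
is balanced modulo e (`jacobiSum_sq_eq_card_iff`). At a valuation of ℂ above p, Gauss sums have
valuation s^(digit sum) for a fixed s < 1 (`exists_mulChar_gaussSum_valuation`, a form of
Stickelberger's theorem). Thus J² and Q have the same valuation if and only if adding (Q-1)/2 to the
exponent of ψ preserves the digit sum, and this is the balance condition for one coset
(`digits_sum_eq_iff`). Galois conjugation moves through all the cosets. Conversely, agreement at all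
places above p suffices: both J² and Q are 1 modulo 4, so (J² - Q)/(4Q) is an algebraic integer; all
of its conjugates have absolute value at most 1/2, so it is 0 (`jacobiSum_sq_eq_card_of_valuation`).
-/

section Auxiliary

open Polynomial

/-! ### L-series of multiplicative functions on monic polynomials. -/

section PolynomialSums

variable (k : Type*) [Field k] [Finite k]

theorem finite_monic_natDegree (n : ℕ) : {f : k[X] | f.Monic ∧ f.natDegree = n}.Finite := by
  have : Module.Finite k (degreeLT k (n + 1)) :=
    Module.Finite.equiv (degreeLTEquiv k (n + 1)).symm
  have : Finite (degreeLT k (n + 1)) := Module.finite_of_finite k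
  refine Set.Finite.subset (Set.toFinite (degreeLT k (n + 1) : Set k[X])) fun f hf ↦ ?_
  simp only [SetLike.mem_coe, mem_degreeLT]
  exact degree_le_natDegree.trans_lt (by rw [hf.2]; exact_mod_cast Nat.lt_succ_self n)

/-- The monic polynomials of degree `n` over a finite field. -/
noncomputable def monicOfDegree (n : ℕ) : Finset k[X] := (finite_monic_natDegree k n).toFinset

variable {k} in
@[simp] theorem mem_monicOfDegree {n : ℕ} {f : k[X]} :
    f ∈ monicOfDegree k n ↔ f.Monic ∧ f.natDegree = n := by simp [monicOfDegree]

open Classical in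
/-- The monic irreducible polynomials of degree `n` over a finite field. -/
noncomputable def irredOfDegree (n : ℕ) : Finset k[X] := {f ∈ monicOfDegree k n | Irreducible f}

variable {k} in
@[simp] theorem mem_irredOfDegree {n : ℕ} {f : k[X]} :
    f ∈ irredOfDegree k n ↔ (f.Monic ∧ f.natDegree = n) ∧ Irreducible f := by
  simp [irredOfDegree]

variable {k}

/-- The sum of a multiplicative function over the monic polynomials of degree `n`. -/
noncomputable def monicSum (l : k[X] →* ℂ) (n : ℕ) : ℂ := ∑ f ∈ monicOfDegree k n, l f

/-- The von Mangoldt sum of degree `n` of a multiplicative function on polynomials. -/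
noncomputable def primeSum (l : k[X] →* ℂ) (n : ℕ) : ℂ :=
  ∑ d ∈ n.divisors, ∑ P ∈ irredOfDegree k d, d * l P ^ (n / d)

-- The number of j ≥ 1 with P ^ j ∣ f is the multiplicity of P in f, so the sum collects the degrees
-- of the prime factors. This is the polynomial analogue of log = Λ * 1.
open Classical in
theorem natDegree_eq_sum_irred {f : k[X]} {n : ℕ} (hf : f.Monic) (hn : f.natDegree = n) :
    n = ∑ d ∈ Finset.Icc 1 n, ∑ P ∈ irredOfDegree k d,
      d * ({j ∈ Finset.Icc 1 n | P ^ j ∣ f} : Finset ℕ).card := by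
  have hf0 := hf.ne_zero
  have key : ∀ d, ∀ P ∈ irredOfDegree k d,
      ({j ∈ Finset.Icc 1 n | P ^ j ∣ f} : Finset ℕ).card =
        (UniqueFactorizationMonoid.normalizedFactors f).count P := by
    intro d P hP
    rw [mem_irredOfDegree] at hP
    obtain ⟨⟨hPm, hPd⟩, hPi⟩ := hP
    have hc : ∀ j, P ^ j ∣ f ↔ j ≤ (UniqueFactorizationMonoid.normalizedFactors f).count P := by
      intro j
      rw [pow_dvd_iff_le_emultiplicity,
        UniqueFactorizationMonoid.emultiplicity_eq_count_normalizedFactors hPi hf0,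
        hPm.normalize_eq_self]
      norm_cast
    have : ({j ∈ Finset.Icc 1 n | P ^ j ∣ f} : Finset ℕ) =
        Finset.Icc 1 ((UniqueFactorizationMonoid.normalizedFactors f).count P) := by
      ext j
      simp only [Finset.mem_filter, Finset.mem_Icc, hc]
      refine ⟨fun h ↦ ⟨h.1.1, h.2⟩, fun h ↦ ⟨⟨h.1, ?_⟩, h.2⟩⟩
      have h1 := (hc j).2 h.2
      have h2 := natDegree_le_of_dvd h1 hf0
      rw [natDegree_pow, hn] at h2
      exact (Nat.le_mul_of_pos_right j hPi.natDegree_pos).trans h2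
    rw [this, Nat.card_Icc, Nat.add_sub_cancel]
  have hrw : (∑ d ∈ Finset.Icc 1 n, ∑ P ∈ irredOfDegree k d,
      d * ({j ∈ Finset.Icc 1 n | P ^ j ∣ f} : Finset ℕ).card) =
      ∑ d ∈ Finset.Icc 1 n, ∑ P ∈ irredOfDegree k d,
        d * (UniqueFactorizationMonoid.normalizedFactors f).count P :=
    Finset.sum_congr rfl fun d _ ↦ Finset.sum_congr rfl fun P hP ↦ by rw [key d P hP]
  rw [hrw]
  set s := UniqueFactorizationMonoid.normalizedFactors f with hs
  have hprod : s.prod = f := by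
    rw [hs, UniqueFactorizationMonoid.prod_normalizedFactors_eq hf0, hf.normalize_eq_self]
  have hsm : ∀ P ∈ s, P.Monic ∧ Irreducible P := fun P hP ↦ by
    have hi := UniqueFactorizationMonoid.irreducible_of_normalized_factor P hP
    refine ⟨?_, hi⟩
    have := UniqueFactorizationMonoid.normalize_normalized_factor P hP
    rw [← this]
    exact monic_normalize hi.ne_zero
  have h1 : n = ∑ P ∈ s.toFinset, s.count P * P.natDegree := by
    rw [← hn, ← hprod, natDegree_multiset_prod_of_monic _ fun P hP ↦ (hsm P hP).1,
      Finset.sum_multiset_map_count]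
    simp
  conv_lhs => rw [h1]
  rw [Finset.sum_sigma']
  symm
  refine Finset.sum_bij_ne_zero (fun x _ _ ↦ x.2) ?_ ?_ ?_ ?_
  · rintro ⟨d, P⟩ h h0
    simp only [Multiset.mem_toFinset]
    rw [← Multiset.count_pos]
    exact Nat.pos_of_ne_zero fun h ↦ h0 (by simp [h])
  · rintro ⟨d, P⟩ h h0 ⟨d', P'⟩ h' h0' heq
    simp only [Finset.mem_sigma, mem_irredOfDegree] at h h' heq
    subst heq
    obtain rfl : d = d' := h.2.1.2.symm.trans h'.2.1.2
    rfl
  · intro P hP _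
    rw [Multiset.mem_toFinset] at hP
    refine ⟨⟨P.natDegree, P⟩, ?_, ?_, rfl⟩
    · simp only [Finset.mem_sigma, mem_irredOfDegree, Finset.mem_Icc]
      refine ⟨⟨(hsm P hP).2.natDegree_pos, ?_⟩, ⟨(hsm P hP).1, trivial⟩, (hsm P hP).2⟩
      rw [← hn]
      exact natDegree_le_of_dvd (UniqueFactorizationMonoid.dvd_of_mem_normalizedFactors hP) hf0
    · exact (Nat.mul_pos (hsm P hP).2.natDegree_pos (Multiset.count_pos.2 hP)).ne'
  · rintro ⟨d, P⟩ h h0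
    simp only [Finset.mem_sigma, mem_irredOfDegree] at h
    simp [h.2.1.2, mul_comm]

theorem sum_monicOfDegree_dvd (l : k[X] →* ℂ) {Q : k[X]} (hQ : Q.Monic) {n e : ℕ}
    (he : Q.natDegree = e) (hen : e ≤ n) [DecidablePred (Q ∣ ·)] :
    ∑ f ∈ monicOfDegree k n with Q ∣ f, l f = l Q * monicSum l (n - e) := by
  rw [monicSum, Finset.mul_sum]
  symm
  refine Finset.sum_bij (fun g _ ↦ Q * g) ?_ ?_ ?_ ?_
  · intro g hg
    rw [mem_monicOfDegree] at hg
    rw [Finset.mem_filter, mem_monicOfDegree, hQ.natDegree_mul hg.1, he, hg.2]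
    exact ⟨⟨hQ.mul hg.1, by omega⟩, dvd_mul_right _ _⟩
  · intro g _ g' _ h
    exact mul_left_cancel₀ hQ.ne_zero h
  · intro f hf
    rw [Finset.mem_filter, mem_monicOfDegree] at hf
    obtain ⟨⟨hf1, hf2⟩, g, rfl⟩ := hf
    have hg := hQ.of_mul_monic_left hf1
    rw [hQ.natDegree_mul hg, he] at hf2
    exact ⟨g, mem_monicOfDegree.2 ⟨hg, by omega⟩, rfl⟩
  · intro g _
    rw [map_mul]

/-- The logarithmic derivative of the L-series, coefficient by coefficient. Each f is weighted by
its degree, written as a sum over prime powers P ^ j dividing f; factoring f = P ^ j * g splits off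
`monicSum`, and the prime powers of degree e make up `primeSum l e`. -/
theorem mul_monicSum (l : k[X] →* ℂ) (n : ℕ) :
    n * monicSum l n = ∑ e ∈ Finset.Icc 1 n, primeSum l e * monicSum l (n - e) := by
  classical
  have h1 : (n : ℂ) * monicSum l n = ∑ d ∈ Finset.Icc 1 n, ∑ P ∈ irredOfDegree k d,
      ∑ j ∈ Finset.Icc 1 n, d * ∑ f ∈ monicOfDegree k n with P ^ j ∣ f, l f := by
    have h2 : (n : ℂ) * monicSum l n = ∑ f ∈ monicOfDegree k n, ∑ d ∈ Finset.Icc 1 n,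
        ∑ P ∈ irredOfDegree k d, ∑ j ∈ Finset.Icc 1 n, d * if P ^ j ∣ f then l f else 0 := by
      rw [monicSum, Finset.mul_sum]
      refine Finset.sum_congr rfl fun f hf ↦ ?_
      rw [mem_monicOfDegree] at hf
      conv_lhs => rw [natDegree_eq_sum_irred hf.1 hf.2]
      push_cast
      rw [Finset.sum_mul]
      refine Finset.sum_congr rfl fun d _ ↦ ?_
      rw [Finset.sum_mul]
      refine Finset.sum_congr rfl fun P _ ↦ ?_
      rw [← Finset.mul_sum, ← Finset.sum_filter, Finset.sum_const, nsmul_eq_mul, mul_assoc]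
    rw [h2, Finset.sum_comm]
    refine Finset.sum_congr rfl fun d _ ↦ ?_
    rw [Finset.sum_comm]
    refine Finset.sum_congr rfl fun P _ ↦ ?_
    rw [Finset.sum_comm]
    refine Finset.sum_congr rfl fun j _ ↦ ?_
    rw [Finset.sum_filter, Finset.mul_sum]
  have h3 : ∀ d ∈ Finset.Icc 1 n, ∀ P ∈ irredOfDegree k d, ∀ j ∈ Finset.Icc 1 n,
      (d : ℂ) * ∑ f ∈ monicOfDegree k n with P ^ j ∣ f, l f =
      if d * j ≤ n then d * (l P ^ j * monicSum l (n - d * j)) else 0 := by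
    intro d hd P hP j hj
    rw [mem_irredOfDegree] at hP
    split_ifs with h
    · rw [sum_monicOfDegree_dvd l (hP.1.1.pow j) (by rw [natDegree_pow, hP.1.2, mul_comm]) h,
        map_pow]
    · rw [Finset.filter_eq_empty_iff.2, Finset.sum_empty, mul_zero]
      intro f hf hdvd
      rw [mem_monicOfDegree] at hf
      have := natDegree_le_of_dvd hdvd hf.1.ne_zero
      rw [natDegree_pow, hP.1.2, hf.2, mul_comm] at this
      exact h this
  rw [h1, Finset.sum_congr rfl fun d hd ↦ Finset.sum_congr rfl fun P hP ↦
    Finset.sum_congr rfl (h3 d hd P hP)]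
  -- Regroup by the degree e = d * j of the prime power P ^ j.
  have h4 : ∀ d ∈ Finset.Icc 1 n, ∑ P ∈ irredOfDegree k d, ∑ j ∈ Finset.Icc 1 n,
      (if d * j ≤ n then (d : ℂ) * (l P ^ j * monicSum l (n - d * j)) else 0) =
      ∑ e ∈ Finset.Icc 1 n, if d ∣ e then ∑ P ∈ irredOfDegree k d,
        d * l P ^ (e / d) * monicSum l (n - e) else 0 := by
    intro d hd
    rw [Finset.mem_Icc] at hd
    rw [Finset.sum_comm, ← Finset.sum_filter]
    simp only [Finset.sum_ite_irrel, Finset.sum_const_zero]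
    rw [← Finset.sum_filter]
    refine Finset.sum_bij (fun j _ ↦ d * j) ?_ ?_ ?_ ?_
    · intro j hj
      simp only [Finset.mem_filter, Finset.mem_Icc] at hj ⊢
      exact ⟨⟨Nat.mul_pos hd.1 hj.1.1, hj.2⟩, dvd_mul_right _ _⟩
    · intro j _ j' _ h
      exact Nat.eq_of_mul_eq_mul_left hd.1 h
    · rintro e he
      simp only [Finset.mem_filter, Finset.mem_Icc] at he
      obtain ⟨he, j, rfl⟩ := he
      refine ⟨j, ?_, rfl⟩
      simp only [Finset.mem_filter, Finset.mem_Icc]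
      exact ⟨⟨Nat.pos_of_mul_pos_left he.1, (Nat.le_mul_of_pos_left j hd.1).trans he.2⟩, he.2⟩
    · intro j _
      rw [Nat.mul_div_cancel_left _ hd.1]
      exact Finset.sum_congr rfl fun P _ ↦ by ring
  rw [Finset.sum_congr rfl h4, Finset.sum_comm]
  refine Finset.sum_congr rfl fun e he ↦ ?_
  rw [Finset.mem_Icc] at he
  rw [primeSum, Finset.sum_mul, ← Finset.sum_filter]
  have : ({d ∈ Finset.Icc 1 n | d ∣ e} : Finset ℕ) = e.divisors := by
    ext d
    simp only [Finset.mem_filter, Finset.mem_Icc, Nat.mem_divisors]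
    refine ⟨fun h ↦ ⟨h.2, by omega⟩, fun h ↦ ⟨⟨Nat.pos_of_dvd_of_pos h.1 (by omega),
      (Nat.le_of_dvd (by omega) h.1).trans he.2⟩, h.1⟩⟩
  rw [this]
  refine Finset.sum_congr rfl fun d _ ↦ ?_
  rw [Finset.sum_mul]

theorem sum_monicOfDegree_zero {M : Type*} [AddCommMonoid M] (g : k[X] → M) :
    ∑ f ∈ monicOfDegree k 0, g f = g 1 := by
  have : monicOfDegree k 0 = {1} := by
    ext f
    simp only [mem_monicOfDegree, Finset.mem_singleton]
    exact ⟨fun h ↦ h.1.natDegree_eq_zero.1 h.2, by rintro rfl; simp⟩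
  rw [this, Finset.sum_singleton]

theorem sum_monicOfDegree_one {M : Type*} [AddCommMonoid M] [Fintype k] (g : k[X] → M) :
    ∑ f ∈ monicOfDegree k 1, g f = ∑ b : k, g (X + C b) := by
  symm
  refine Finset.sum_bij (fun b _ ↦ X + C b) ?_ ?_ ?_ fun _ _ ↦ rfl
  · intro b _
    simp [monic_X_add_C]
  · intro b _ b' _ h
    exact C_injective (add_left_cancel h)
  · intro f hf
    rw [mem_monicOfDegree] at hf
    exact ⟨f.coeff 0, Finset.mem_univ _, (hf.1.eq_X_add_C hf.2).symm⟩

theorem sum_monicOfDegree_two {M : Type*} [AddCommMonoid M] [Fintype k] (g : k[X] → M) :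
    ∑ f ∈ monicOfDegree k 2, g f = ∑ b : k, ∑ c : k, g (X ^ 2 + C b * X + C c) := by
  rw [← Fintype.sum_prod_type']
  symm
  have hd : ∀ b c : k, (C b * X + C c).degree < ((2 : ℕ) : WithBot ℕ) := fun b c ↦
    degree_linear_le.trans_lt (by norm_num)
  refine Finset.sum_bij (fun b _ ↦ X ^ 2 + C b.1 * X + C b.2) ?_ ?_ ?_ fun _ _ ↦ rfl
  · intro b _
    rw [mem_monicOfDegree, add_assoc]
    exact ⟨monic_X_pow_add (hd _ _), natDegree_eq_of_degree_eq_some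
      (by rw [degree_add_eq_left_of_degree_lt (by rw [degree_X_pow]; exact hd _ _), degree_X_pow])⟩
  · rintro ⟨b, c⟩ _ ⟨b', c'⟩ _ h
    have h0 := congrArg (fun f ↦ coeff f 0) h
    have h1 := congrArg (fun f ↦ coeff f 1) h
    simp at h0 h1
    simp [h0, h1]
  · intro f hf
    rw [mem_monicOfDegree] at hf
    refine ⟨(f.coeff 1, f.coeff 0), Finset.mem_univ _, ?_⟩
    have h2 : f.coeff 2 = 1 := by rw [← hf.2]; exact hf.1
    conv_rhs => rw [f.as_sum_range_C_mul_X_pow, hf.2]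
    simp [Finset.sum_range_succ, h2]
    ring

theorem sum_monicOfDegree_add {M : Type*} [AddCommMonoid M] (g : k[X] → M) {n : ℕ} {h : k[X]}
    (hh : h.degree < n) : ∑ f ∈ monicOfDegree k n, g (f + h) = ∑ f ∈ monicOfDegree k n, g f := by
  have key : ∀ {h : k[X]}, h.degree < n → ∀ f ∈ monicOfDegree k n, f + h ∈ monicOfDegree k n := by
    intro h hh f hf
    rw [mem_monicOfDegree] at hf ⊢
    have : h.degree < f.degree := by rwa [degree_eq_natDegree hf.1.ne_zero, hf.2]
    exact ⟨hf.1.add_of_left this, by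
      rw [natDegree_eq_of_degree_eq (degree_add_eq_left_of_degree_lt this), hf.2]⟩
  refine Finset.sum_bij (fun f _ ↦ f + h) (key hh) (fun _ _ _ _ h ↦ add_right_cancel h) ?_
    fun _ _ ↦ rfl
  intro f hf
  exact ⟨f + -h, key (by rwa [degree_neg]) f hf, by simp⟩

/-- A multiplicative function whose sum over a line of polynomials of small degree vanishes has
vanishing sum. -/
theorem sum_monicOfDegree_eq_zero [Fintype k] (g : k[X] → ℂ) {n : ℕ} {h : k[X]}
    (hh : h.degree < n) (h0 : ∀ f, ∑ a : k, g (f + C a * h) = 0) :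
    ∑ f ∈ monicOfDegree k n, g f = 0 := by
  have h1 : ∑ a : k, ∑ f ∈ monicOfDegree k n, g (f + C a * h) = 0 := by
    rw [Finset.sum_comm]
    exact Finset.sum_eq_zero fun f _ ↦ h0 f
  rw [Finset.sum_congr rfl fun a _ ↦ sum_monicOfDegree_add g
    (((degree_mul_le _ _).trans ((add_le_add_left degree_C_le _).trans_eq (zero_add _))).trans_lt hh), Finset.sum_const, nsmul_eq_mul] at h1
  refine (mul_eq_zero.1 h1).resolve_left ?_
  exact_mod_cast Fintype.card_ne_zero

end PolynomialSums

/-! ### Elements of a finite extension and their minimal polynomials. -/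

section FiniteExtension

variable {k L : Type*} [Field k] [Finite k] [Field L] [Algebra k L]

/-- A monic irreducible P whose degree d divides [L : k] divides X ^ |L| - X, which splits in L, and
it is separable because k is perfect. So P is the minimal polynomial of exactly d elements of L. -/
theorem sum_minpoly [Fintype L] {M : Type*} [AddCommMonoid M] (h : k[X] → M) :
    ∑ x : L, h (minpoly k x) =
      ∑ d ∈ (Module.finrank k L).divisors, ∑ P ∈ irredOfDegree k d, d • h P := by
  classical
  have : Module.Finite k L := .of_finite
  have hpos : 0 < Module.finrank k L := Module.finrank_pos
  rw [Finset.sum_sigma']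
  rw [← Finset.sum_fiberwise_of_maps_to
    (s := Finset.univ) (t := (Module.finrank k L).divisors.sigma fun d ↦ irredOfDegree k d)
    (g := fun x : L ↦ (⟨(minpoly k x).natDegree, minpoly k x⟩ : Σ _ : ℕ, k[X]))]
  · refine Finset.sum_congr rfl ?_
    rintro ⟨d, P⟩ hP
    simp only [Finset.mem_sigma, Nat.mem_divisors, mem_irredOfDegree] at hP
    obtain ⟨⟨hd, -⟩, ⟨hPm, rfl⟩, hPi⟩ := hP
    rw [Finset.sum_congr rfl (g := fun _ ↦ h P), Finset.sum_const]
    swap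
    · intro x hx
      simp only [Finset.mem_filter, Sigma.mk.injEq, heq_eq_eq] at hx
      rw [hx.2.2]
    congr 1
    have hsplit : (P.map (algebraMap k L)).Splits := by
      have h1 := (hPi.natDegree_dvd_iff_dvd_X_pow_card_pow_sub_X).1 hd
      rw [← Module.natCard_eq_pow_finrank] at h1
      refine Splits.of_dvd ?_ ?_ (Polynomial.map_dvd (algebraMap k L) h1)
      · simpa using Polynomial.splits_X_pow_nat_card_sub_X (K := L)
      · refine (Polynomial.map_ne_zero_iff (algebraMap k L).injective).2 ?_
        exact FiniteField.X_pow_card_sub_X_ne_zero _ Finite.one_lt_card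
    have hc : (P.rootSet L).ncard = P.natDegree := by
      rw [← card_rootSet_eq_natDegree (K := L) (PerfectField.separable_of_irreducible hPi) hsplit,
        Fintype.card_eq_nat_card, Nat.card_coe_set_eq]
    refine Eq.trans ?_ hc
    rw [← Set.ncard_coe_finset]
    congr 1
    ext x
    simp only [Finset.coe_filter, Finset.mem_univ, true_and, Sigma.mk.injEq, heq_eq_eq,
      Set.mem_ofPred_eq, mem_rootSet', Polynomial.map_ne_zero_iff (algebraMap k L).injective]
    constructor
    · rintro ⟨-, rfl⟩
      exact ⟨minpoly.ne_zero (Algebra.IsIntegral.isIntegral x), minpoly.aeval k x⟩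
    · rintro ⟨-, hx⟩
      have := minpoly.eq_of_irreducible_of_monic hPi hx hPm
      exact ⟨by rw [← this], this.symm⟩
  · intro x _
    have hx := Algebra.IsIntegral.isIntegral (R := k) x
    simp only [Finset.mem_sigma, Nat.mem_divisors, mem_irredOfDegree, and_true]
    refine ⟨⟨minpoly.degree_dvd hx, hpos.ne'⟩, minpoly.monic hx, minpoly.irreducible hx⟩

theorem sum_map_minpoly_pow [Fintype L] (l : k[X] →* ℂ) :
    ∑ x : L, l (minpoly k x) ^ (Module.finrank k L / (minpoly k x).natDegree) =
      primeSum l (Module.finrank k L) := by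
  rw [sum_minpoly (fun P ↦ l P ^ (Module.finrank k L / P.natDegree)), primeSum]
  refine Finset.sum_congr rfl fun d _ ↦ Finset.sum_congr rfl fun P hP ↦ ?_
  rw [mem_irredOfDegree] at hP
  rw [hP.1.2, nsmul_eq_mul]

-- The minimal polynomial of a - x is, up to the sign (-1) ^ deg, that of x evaluated at a - X. Its
-- constant term gives the norm from k(a - x), and the two signs cancel.
omit [Finite k] in
theorem eval_minpoly_pow [FiniteDimensional k L] (x : L) (a : k) :
    (minpoly k x).eval a ^ (Module.finrank k L / (minpoly k x).natDegree) =
      Algebra.norm k (algebraMap k L a - x) := by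
  have hx := Algebra.IsIntegral.isIntegral (R := k) x
  set y := algebraMap k L a - x with hy
  have hyi := Algebra.IsIntegral.isIntegral (R := k) y
  have h1 : minpoly k y = (-1) ^ (minpoly k x).natDegree * ((minpoly k x).comp (X + C a)).comp (-X) := by
    have : y = -(x - algebraMap k L a) := by ring
    rw [this, minpoly.neg, minpoly.sub_algebraMap, natDegree_comp]
    simp
  have hdeg : (minpoly k y).natDegree = (minpoly k x).natDegree := by
    rw [h1, mul_comm]
    have : ((-1 : k[X]) ^ (minpoly k x).natDegree) = C ((-1) ^ (minpoly k x).natDegree) := by simp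
    rw [this, natDegree_mul_C (by simp), natDegree_comp, natDegree_comp]
    simp
  have h2 := Algebra.PowerBasis.norm_gen_eq_coeff_zero_minpoly (IntermediateField.adjoin.powerBasis hyi)
  rw [IntermediateField.adjoin.powerBasis_gen, IntermediateField.minpoly_gen,
    IntermediateField.adjoin.powerBasis_dim, hdeg, h1] at h2
  rw [Algebra.norm_eq_norm_adjoin k y, h2]
  have h3 : Module.finrank (IntermediateField.adjoin k {y}) L =
      Module.finrank k L / (minpoly k x).natDegree := by
    rw [← hdeg, ← IntermediateField.adjoin.finrank hyi,
      ← Module.finrank_mul_finrank k (IntermediateField.adjoin k {y}) L,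
      Nat.mul_div_cancel_left _ Module.finrank_pos]
  rw [h3]
  congr 1
  rw [coeff_zero_eq_eval_zero, eval_mul, eval_comp, eval_comp]
  simp [← mul_assoc, ← mul_pow]

end FiniteExtension

/-! ### The quadratic character and lifting characters by the norm. -/

section QuadChar

/-- The complex valued quadratic character of a finite field. -/
noncomputable def quadChar (L : Type*) [Field L] [Finite L] : MulChar L ℂ :=
  letI := Fintype.ofFinite L
  letI := Classical.decEq L
  (quadraticChar L).ringHomComp (Int.castRingHom ℂ)

variable {L : Type*} [Field L] [Finite L]

open Classical in
theorem quadChar_apply (x : L) :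
    quadChar L x = if x = 0 then 0 else if IsSquare x then 1 else -1 := by
  simp only [quadChar, MulChar.ringHomComp_apply, quadraticChar_apply, quadraticCharFun]
  split_ifs <;> simp

theorem quadChar_mul_quadChar : quadChar L * quadChar L = 1 := by
  classical
  ext x
  rw [MulChar.mul_apply, MulChar.one_apply_coe, quadChar_apply, if_neg x.ne_zero]
  split_ifs <;> simp

theorem quadChar_inv : (quadChar L)⁻¹ = quadChar L := by
  rw [inv_eq_iff_mul_eq_one, quadChar_mul_quadChar]

theorem quadChar_sq {x : L} (hx : x ≠ 0) : quadChar L x ^ 2 = 1 := by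
  classical
  rw [quadChar_apply, if_neg hx]
  split_ifs <;> simp

theorem quadChar_ne_one (h2 : (2 : L) ≠ 0) : quadChar L ≠ 1 := by
  let := Fintype.ofFinite L
  let := Classical.decEq L
  have h : ringChar L ≠ 2 := fun h ↦ h2 (by exact_mod_cast h ▸ ringChar.Nat.cast_ringChar (R := L))
  exact (MulChar.ringHomComp_ne_one_iff (f := Int.castRingHom ℂ) Int.cast_injective).2
    (quadraticChar_ne_one h)

theorem quadChar_of_isSquare {x : L} (hx : x ≠ 0) (h : IsSquare x) : quadChar L x = 1 := by
  classical
  rw [quadChar_apply, if_neg hx, if_pos h]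

theorem quadChar_of_not_isSquare {x : L} (h : ¬ IsSquare x) : quadChar L x = -1 := by
  classical
  rw [quadChar_apply, if_neg (by rintro rfl; exact h IsSquare.zero), if_neg h]

theorem norm_quadChar_le (x : L) : ‖quadChar L x‖ ≤ 1 := by
  classical
  rw [quadChar_apply]
  split_ifs <;> simp

theorem sum_quadChar [Fintype L] (h2 : (2 : L) ≠ 0) : ∑ x, quadChar L x = 0 :=
  MulChar.sum_eq_zero_of_ne_one (quadChar_ne_one h2)

/-- For r ≠ s an affine substitution turns the sum into χ(-1) J(χ, χ), and J(χ, χ⁻¹) = -χ(-1). -/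
theorem sum_quadChar_mul [Fintype L] [DecidableEq L] (h2 : (2 : L) ≠ 0) (r s : L) :
    ∑ x, quadChar L ((x + r) * (x + s)) = (if r = s then (Fintype.card L : ℂ) else 0) - 1 := by
  have hr : ∑ x, quadChar L ((x + r) * (x + s)) = ∑ x, quadChar L (x * (x + (s - r))) :=
    Fintype.sum_equiv (Equiv.addRight r) _ _ fun x ↦ by simp [add_assoc]
  rw [hr]
  split_ifs with h
  · subst h
    have : ∀ x : L, quadChar L (x * (x + (r - r))) = (1 : MulChar L ℂ) x := fun x ↦ by
      rw [sub_self, add_zero, map_mul, ← MulChar.mul_apply, quadChar_mul_quadChar]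
    rw [Finset.sum_congr rfl fun x _ ↦ this x, MulChar.sum_one_eq_card_units,
      Fintype.card_units, Nat.cast_sub Fintype.card_pos, Nat.cast_one]
  · set u := s - r with hu
    have hu0 : u ≠ 0 := sub_ne_zero.2 (Ne.symm h)
    have h1 : ∑ x, quadChar L (x * (x + u)) = quadChar L (-1) * jacobiSum (quadChar L) (quadChar L) := by
      rw [jacobiSum, Finset.mul_sum]
      symm
      refine Fintype.sum_equiv (Equiv.mulLeft₀ (-u) (neg_ne_zero.2 hu0)) _ _ fun y ↦ ?_
      change _ = quadChar L (-u * y * (-u * y + u))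
      have : -u * y * (-u * y + u) = -1 * y * (1 - y) * (u * u) := by ring
      rw [this]
      simp only [map_mul]
      have h3 := quadChar_sq hu0
      linear_combination (-quadChar L (-1) * quadChar L y * quadChar L (1 - y)) * h3
    rw [h1]
    conv_lhs => rw [← quadChar_inv]
    rw [quadChar_inv]
    have h4 := jacobiSum_nontrivial_inv (quadChar_ne_one h2)
    rw [quadChar_inv] at h4
    rw [h4]
    have h3 := quadChar_sq (L := L) (neg_ne_zero.2 one_ne_zero)
    linear_combination -h3

variable {k : Type*} [Field k] [Algebra k L]

/-- The character of an extension obtained by composing with the norm. -/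
noncomputable def MulChar.normLift (L : Type*) [Field L] [Algebra k L] (ψ : MulChar k ℂ) :
    MulChar L ℂ := MulChar.ofUnitHom (ψ.toUnitHom.comp (Units.map (Algebra.norm k)))

theorem MulChar.normLift_apply [FiniteDimensional k L] (ψ : MulChar k ℂ) (x : L) :
    ψ.normLift L x = ψ (Algebra.norm k x) := by
  by_cases hx : x = 0
  · subst hx
    rw [MulChar.map_zero, Algebra.norm_zero, MulChar.map_zero]
  · have := MulChar.ofUnitHom_coe (ψ.toUnitHom.comp (Units.map (Algebra.norm k))) (Units.mk0 x hx)
    rw [MulChar.normLift]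
    simpa using this

/-- Euler's criterion on both sides: N(x) = x ^ ((Q-1)/(q-1)), hence N(x) ^ ((q-1)/2) = x ^
((Q-1)/2). -/
theorem quadChar_normLift [Finite k] (h2 : (2 : k) ≠ 0) :
    (quadChar k).normLift L = quadChar L := by
  classical
  let := Fintype.ofFinite L
  let := Fintype.ofFinite k
  have h2L : (2 : L) ≠ 0 := by
    rw [← map_ofNat (algebraMap k L)]
    exact (_root_.map_ne_zero _).2 h2
  have hcL : ringChar L ≠ 2 := fun h ↦ h2L (by exact_mod_cast h ▸ ringChar.Nat.cast_ringChar (R := L))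
  have hck : ringChar k ≠ 2 := fun h ↦ h2 (by exact_mod_cast h ▸ ringChar.Nat.cast_ringChar (R := k))
  ext x
  rw [MulChar.normLift_apply]
  have hx : (x : L) ≠ 0 := x.ne_zero
  have hn : Algebra.norm k (x : L) ≠ 0 := Algebra.norm_ne_zero_iff.2 hx
  rw [quadChar_apply, quadChar_apply, if_neg hx, if_neg hn]
  congr 1
  rw [eq_iff_iff, FiniteField.isSquare_iff hck hn, FiniteField.isSquare_iff hcL hx,
    ← (algebraMap k L).injective.eq_iff, map_pow, FiniteField.algebraMap_norm_eq_pow, map_one,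
    ← pow_mul]
  have e : (Nat.card L - 1) / (Nat.card k - 1) * (Fintype.card k / 2) = Fintype.card L / 2 := by
    have hk := FiniteField.odd_card_of_char_ne_two hck
    have hL := FiniteField.odd_card_of_char_ne_two hcL
    have h1k : 1 < Fintype.card k := Fintype.one_lt_card
    have hd : (Fintype.card k - 1) ∣ (Fintype.card L - 1) := by
      rw [Module.card_eq_pow_finrank (K := k) (V := L)]
      exact Nat.sub_one_dvd_pow_sub_one _ _
    rw [Nat.card_eq_fintype_card, Nat.card_eq_fintype_card]
    obtain ⟨a, ha⟩ : ∃ a, Fintype.card k = 2 * a + 1 := ⟨Fintype.card k / 2, by omega⟩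
    obtain ⟨b, hb⟩ : ∃ b, Fintype.card L = 2 * b + 1 := ⟨Fintype.card L / 2, by omega⟩
    rw [ha, hb] at hd ⊢
    have e1 : (2 * a + 1) / 2 = a := by omega
    have e2 : (2 * b + 1) / 2 = b := by omega
    rw [Nat.add_sub_cancel, Nat.add_sub_cancel] at hd ⊢
    obtain ⟨m, hm⟩ := hd
    rw [e1, e2, hm, Nat.mul_div_cancel_left _ (by omega)]
    have : 2 * b = 2 * (m * a) := by rw [hm]; ring
    omega
  rw [e]

end QuadChar

/-! ### L-series that are polynomials of degree at most two; the Hasse-Davenport relation. -/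

section LFunctions

variable {k : Type*} [Field k] [Finite k]

/-- Newton's identities for the L-polynomial (1 - α T)(1 - β T), obtained recursively from
`mul_monicSum`. -/
theorem primeSum_eq_of_monicSum (l : k[X] →* ℂ) {α β : ℂ} (h1 : monicSum l 1 = -(α + β))
    (h2 : monicSum l 2 = α * β) (h3 : ∀ n, 3 ≤ n → monicSum l n = 0) (n : ℕ) (hn : 0 < n) :
    primeSum l n = -(α ^ n + β ^ n) := by
  have h0 : monicSum l 0 = 1 := by rw [monicSum, sum_monicOfDegree_zero, map_one]
  have e1 : primeSum l 1 = -(α ^ 1 + β ^ 1) := by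
    have := mul_monicSum l 1
    simp [h0, h1] at this
    rw [← this]
    ring
  have e2 : primeSum l 2 = -(α ^ 2 + β ^ 2) := by
    have := mul_monicSum l 2
    simp [Finset.sum_Icc_succ_top, h0, h1, h2, e1] at this
    linear_combination -this
  induction n using Nat.strong_induction_on with
  | _ n ih =>
    match n, hn with
    | 1, _ => exact e1
    | 2, _ => exact e2
    | m + 3, _ =>
      have := mul_monicSum l (m + 3)
      rw [Finset.sum_Icc_succ_top (by omega), Finset.sum_Icc_succ_top (by omega),
        Finset.sum_Icc_succ_top (by omega), Finset.sum_eq_zero, h3 _ (by omega),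
        show m + 2 + 1 - (m + 2 + 1) = 0 by omega, show m + 3 - (m + 2) = 1 by omega,
        show m + 3 - (m + 1) = 2 by omega, h0, h1, h2, ih (m + 1) (by omega) (by omega),
        ih (m + 2) (by omega) (by omega)] at this
      · rw [show m + 3 = m + 2 + 1 by omega]
        linear_combination -this
      · intro e he
        rw [Finset.mem_Icc] at he
        rw [h3 _ (by omega), mul_zero]

variable {L : Type*} [Field L] [Algebra k L]

omit [Finite k] in
theorem evalHom_minpoly_pow [Finite L] (ψ : MulChar k ℂ) (a : k) (x : L) :
    ψ ((minpoly k x).eval a) ^ (Module.finrank k L / (minpoly k x).natDegree) =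
      ψ.normLift L (algebraMap k L a - x) := by
  have : Module.Finite k L := .of_finite
  rw [← map_pow, eval_minpoly_pow, MulChar.normLift_apply]

omit [Finite k] in
theorem map_neg_one_mul_jacobiSum [Fintype k] (ψ φ : MulChar k ℂ) :
    ψ (-1) * jacobiSum ψ φ = ∑ x, ψ (-x) * φ (1 - x) := by
  rw [jacobiSum, Finset.mul_sum]
  refine Finset.sum_congr rfl fun x _ ↦ ?_
  rw [← mul_assoc, ← map_mul, neg_one_mul]

omit [Finite k] in
theorem map_neg_one_sq (ψ : MulChar k ℂ) : ψ (-1) ^ 2 = 1 := by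
  rw [← map_pow, neg_one_sq, map_one]

/-- The Hasse-Davenport relation for Jacobi sums. The function f ↦ ψ(f(0)) φ(f(1)) has an L-series
of degree one with linear coefficient ψ(-1) J(ψ, φ); over L, the sum of the same shape is its von
Mangoldt sum, by `evalHom_minpoly_pow`. -/
theorem jacobiSum_normLift [Fintype k] [Fintype L] (ψ φ : MulChar k ℂ) (hφ : φ ≠ 1) :
    ψ.normLift L (-1) * jacobiSum (ψ.normLift L) (φ.normLift L) =
      -(-(ψ (-1) * jacobiSum ψ φ)) ^ Module.finrank k L := by
  have : Module.Finite k L := .of_finite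
  have hpos : 0 < Module.finrank k L := Module.finrank_pos
  let l : k[X] →* ℂ :=
    { toFun := fun f ↦ ψ (f.eval 0) * φ (f.eval 1)
      map_one' := by simp
      map_mul' := fun f g ↦ by simp only [eval_mul, map_mul]; ring }
  have hl : ∀ f, l f = ψ (f.eval 0) * φ (f.eval 1) := fun _ ↦ rfl
  have h1 : monicSum l 1 = -(-(ψ (-1) * jacobiSum ψ φ) + 0) := by
    rw [monicSum, sum_monicOfDegree_one, map_neg_one_mul_jacobiSum, add_zero, neg_neg]
    refine Fintype.sum_equiv (Equiv.neg k) _ _ fun x ↦ ?_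
    simp [hl]
  have h2 : ∀ n, 2 ≤ n → monicSum l n = 0 := by
    intro n hn
    -- Adding multiples of X fixes f(0) and lets f(1) run through all of k.
    refine sum_monicOfDegree_eq_zero l (h := X)
      (degree_X_le.trans_lt (by exact_mod_cast (by omega : 1 < n))) fun f ↦ ?_
    simp only [hl, eval_add, eval_mul, eval_C, eval_X, mul_zero, add_zero, mul_one]
    have := Equiv.sum_comp (Equiv.addLeft (f.eval 1)) φ
    simp only [Equiv.coe_addLeft] at this
    rw [← Finset.mul_sum, this, MulChar.sum_eq_zero_of_ne_one hφ, mul_zero]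
  have h3 := primeSum_eq_of_monicSum l h1 (by rw [h2 2 le_rfl, mul_zero]) (fun n hn ↦ h2 n (by omega))
    (Module.finrank k L) hpos
  rw [zero_pow hpos.ne', add_zero] at h3
  rw [← h3, ← sum_map_minpoly_pow, map_neg_one_mul_jacobiSum]
  refine Finset.sum_congr rfl fun x _ ↦ ?_
  rw [hl, mul_pow, evalHom_minpoly_pow, evalHom_minpoly_pow, map_zero, map_one, zero_sub]

theorem jacobiSum_normLift_sq [Fintype k] [Fintype L] (ψ φ : MulChar k ℂ) (hφ : φ ≠ 1) :
    jacobiSum (ψ.normLift L) (φ.normLift L) ^ 2 = (jacobiSum ψ φ ^ 2) ^ Module.finrank k L := by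
  have h := congrArg (· ^ 2) (jacobiSum_normLift (L := L) ψ φ hφ)
  simp only [mul_pow, neg_pow (_ * _) (Module.finrank k L)] at h
  have e2 : ((-1 : ℂ) ^ Module.finrank k L) ^ 2 = 1 := by rw [← pow_mul, mul_comm, pow_mul]; simp
  have e3 : (ψ (-1) ^ Module.finrank k L) ^ 2 = 1 := by
    rw [← pow_mul, mul_comm, pow_mul, map_neg_one_sq, one_pow]
  rw [map_neg_one_sq, neg_sq, mul_pow, mul_pow, e2, e3] at h
  rw [← pow_mul, mul_comm 2, pow_mul]
  linear_combination h

end LFunctions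

/-! ### Character sums of the Legendre family. -/

section LegendreSums

/-- The character sum attached to the Legendre curve over a finite field. -/
noncomputable def legendreSum (L : Type*) [Field L] [Finite L] (t : L) : ℂ :=
  letI := Fintype.ofFinite L
  ∑ x : L, quadChar L (x * (x + 1) * (x + t))

theorem legendreSum_eq {L : Type*} [Field L] [Fintype L] (t : L) :
    legendreSum L t = ∑ x : L, quadChar L (x * (x + 1) * (x + t)) := by
  rw [legendreSum]
  congr!

variable {k : Type*} [Field k] [Finite k]

theorem legendreSum_zero (h2 : (2 : k) ≠ 0) : legendreSum k 0 = -1 := by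
  classical
  let := Fintype.ofFinite k
  rw [legendreSum_eq]
  have h : ∀ x : k, quadChar k (x * (x + 1) * (x + 0)) =
      quadChar k (x + 1) - if x = 0 then 1 else 0 := by
    intro x
    split_ifs with hx
    · simp [hx, MulChar.map_zero]
    · have := quadChar_sq hx
      simp only [map_mul, add_zero]
      linear_combination quadChar k (x + 1) * this
  rw [Finset.sum_congr rfl fun x _ ↦ h x, Finset.sum_sub_distrib,
    show ∑ x : k, quadChar k (x + 1) = ∑ x, quadChar k x from
      Equiv.sum_comp (Equiv.addRight (1 : k)) (quadChar k), sum_quadChar h2]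
  simp

theorem legendreSum_one (h2 : (2 : k) ≠ 0) : legendreSum k 1 = -quadChar k (-1) := by
  classical
  let := Fintype.ofFinite k
  rw [legendreSum_eq]
  have h : ∀ x : k, quadChar k (x * (x + 1) * (x + 1)) =
      quadChar k x - if x = -1 then quadChar k (-1) else 0 := by
    intro x
    split_ifs with hx
    · simp [hx, MulChar.map_zero]
    · have := quadChar_sq (x := x + 1) (fun h ↦ hx (eq_neg_of_add_eq_zero_left h))
      simp only [map_mul]
      linear_combination quadChar k x * this
  rw [Finset.sum_congr rfl fun x _ ↦ h x, Finset.sum_sub_distrib, sum_quadChar h2]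
  simp

open Classical in
/-- The leading coefficient of the local polynomial of the Legendre curve. -/
noncomputable def legendreDet (k : Type*) [Field k] (t : k) : ℂ :=
  if t = 0 ∨ t = 1 then 0 else Nat.card k

/-- The multiplicative function f ↦ χ(f(0) f(1) f(t)) has an L-series of degree two with linear
coefficient S(t) and, for t ≠ 0, 1, quadratic coefficient |k|. This replaces the usual appeal to the
Frobenius endomorphism of the elliptic curve. -/
theorem legendreSum_extension {L : Type*} [Field L] [Finite L] [Algebra k L] (h2 : (2 : k) ≠ 0)
    (t : k) {α β : ℂ} (hα : α + β = -legendreSum k t) (hβ : α * β = legendreDet k t) :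
    legendreSum L (algebraMap k L t) =
      -(α ^ Module.finrank k L + β ^ Module.finrank k L) := by
  classical
  let := Fintype.ofFinite L
  let := Fintype.ofFinite k
  have : Module.Finite k L := .of_finite
  have hpos : 0 < Module.finrank k L := Module.finrank_pos
  have h2L : (2 : L) ≠ 0 := by
    rw [← map_ofNat (algebraMap k L)]
    exact (_root_.map_ne_zero _).2 h2
  -- When α β = 0 one of the roots is 0 and the other is -S(t), namely 1 at t = 0 and χ(-1) at t =
  -- 1; it suffices that this root is raised to the power [L : k].
  have hbad : ∀ c : ℂ, legendreSum k t = -c → α * β = 0 →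
      legendreSum L (algebraMap k L t) = -c ^ Module.finrank k L →
      legendreSum L (algebraMap k L t) = -(α ^ Module.finrank k L + β ^ Module.finrank k L) := by
    intro c hc h0 hL
    rw [hL]
    rw [hc, neg_neg] at hα
    rcases mul_eq_zero.1 h0 with h | h
    · rw [← hα, h, zero_add, zero_pow hpos.ne', zero_add]
    · rw [← hα, h, add_zero, zero_pow hpos.ne', add_zero]
  rw [legendreDet] at hβ
  split_ifs at hβ with ht
  · rcases ht with rfl | rfl
    · refine hbad 1 (legendreSum_zero h2) hβ ?_
      rw [map_zero, legendreSum_zero h2L, one_pow]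
    · refine hbad (quadChar k (-1)) (legendreSum_one h2) hβ ?_
      rw [map_one, legendreSum_one h2L, ← quadChar_normLift h2, MulChar.normLift_apply,
        ← map_pow]
      congr 2
      have := Algebra.norm_algebraMap (S := L) (-1 : k)
      rwa [map_neg, map_one] at this
  · rw [not_or] at ht
    obtain ⟨ht0, ht1⟩ := ht
    set χ := quadChar k
    let l : k[X] →* ℂ :=
      { toFun := fun f ↦ χ (f.eval 0) * χ (f.eval 1) * χ (f.eval t)
        map_one' := by simp
        map_mul' := fun f g ↦ by simp only [eval_mul, map_mul]; ring }
    have hl : ∀ f, l f = χ (f.eval 0) * χ (f.eval 1) * χ (f.eval t) := fun _ ↦ rfl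
    have h1 : monicSum l 1 = -(α + β) := by
      rw [monicSum, sum_monicOfDegree_one, hα, neg_neg, legendreSum_eq]
      refine Finset.sum_congr rfl fun x _ ↦ ?_
      simp only [hl, eval_add, eval_X, eval_C, map_mul, add_comm, add_zero]
      rfl
    have hm2 : monicSum l 2 = α * β := by
      rw [monicSum, sum_monicOfDegree_two, hβ, Finset.sum_comm]
      -- For f = X² + bX + c both f(1) and f(t) / t are translates of b. The sum over b is -1 unless
      -- the translates coincide, that is unless (t - 1)(c - t) = 0.
      have hc : ∀ c : k, ∑ b : k, l (X ^ 2 + C b * X + C c) =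
          χ t * (χ c * (if c = t then (Fintype.card k : ℂ) else 0) - χ c) := by
        intro c
        have e : ∀ b : k, l (X ^ 2 + C b * X + C c) =
            χ c * χ t * χ ((b + (1 + c)) * (b + (t + c / t))) := by
          intro b
          have : t * t + b * t + c = t * (b + (t + c / t)) := by field_simp; ring
          simp only [hl, eval_add, eval_mul, eval_C, eval_X, sq, mul_zero, mul_one,
            zero_add]
          rw [this, map_mul, map_mul, show 1 + b + c = b + (1 + c) by ring]
          ring
        rw [Finset.sum_congr rfl fun b _ ↦ e b, ← Finset.mul_sum, sum_quadChar_mul h2]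
        have hiff : 1 + c = t + c / t ↔ c = t := by
          constructor
          · intro h
            field_simp at h
            have : (t - 1) * (c - t) = 0 := by linear_combination h
            rcases mul_eq_zero.1 this with h | h
            · exact absurd (sub_eq_zero.1 h) ht1
            · exact sub_eq_zero.1 h
          · rintro rfl
            field_simp
            ring
        simp only [hiff]
        ring
      rw [Finset.sum_congr rfl fun c _ ↦ hc c, ← Finset.mul_sum, Finset.sum_sub_distrib,
        sum_quadChar h2]
      simp only [mul_ite, mul_zero, Finset.sum_ite_eq', Finset.mem_univ, if_true, sub_zero]
      rw [Nat.card_eq_fintype_card]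
      have := quadChar_sq ht0
      linear_combination (Fintype.card k : ℂ) * this
    have hm3 : ∀ n, 3 ≤ n → monicSum l n = 0 := by
      intro n hn
      -- This direction vanishes at 1 and t but has the value t ≠ 0 at 0, so only f(0) moves,
      -- through all of k.
      refine sum_monicOfDegree_eq_zero l (h := (X - C 1) * (X - C t)) ?_ fun f ↦ ?_
      · rw [degree_mul, degree_X_sub_C, degree_X_sub_C]
        exact_mod_cast (by omega : 1 + 1 < n)
      · simp only [hl, eval_add, eval_mul, eval_C, eval_X, eval_sub, sub_self, zero_mul, mul_zero,
          add_zero, mul_assoc]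
        rw [← Finset.sum_mul]
        have : ∑ a : k, χ (f.eval 0 + a * ((0 - 1) * (0 - t))) = ∑ a : k, χ a := by
          refine Fintype.sum_equiv
            ((Equiv.mulRight₀ t ht0).trans (Equiv.addLeft (f.eval 0))) _ _ fun a ↦ ?_
          simp
        rw [this, sum_quadChar h2, zero_mul]
    rw [← primeSum_eq_of_monicSum l h1 hm2 hm3 _ hpos, ← sum_map_minpoly_pow, legendreSum_eq]
    refine Fintype.sum_equiv (Equiv.neg L) _ _ fun x ↦ ?_
    rw [hl, mul_pow, mul_pow, evalHom_minpoly_pow, evalHom_minpoly_pow, evalHom_minpoly_pow,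
      quadChar_normLift h2]
    simp only [map_zero, map_one, Equiv.neg_apply, sub_neg_eq_add, map_mul, add_comm, add_zero]

theorem norm_legendreSum_le (t : k) : ‖legendreSum k t‖ ≤ Nat.card k := by
  let := Fintype.ofFinite k
  rw [legendreSum_eq, Nat.card_eq_fintype_card]
  refine (norm_sum_le _ _).trans ((Finset.sum_le_sum fun x _ ↦ norm_quadChar_le _).trans ?_)
  simp

/-- Exchange the two sums. In the inner sum over t the substitution t = -x s produces ψ(-x) χ(x)
J(ψ, χ); since χ(x)² = 1 the outer sum over x is a second copy of J(ψ, χ). -/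
theorem sum_mul_legendreSum [Fintype k] (ψ : MulChar k ℂ) :
    ∑ t, ψ t * legendreSum k t = jacobiSum ψ (quadChar k) ^ 2 := by
  classical
  set χ := quadChar k
  have h1 : ∑ t, ψ t * legendreSum k t = ∑ x, χ (x * (x + 1)) * ∑ t, ψ t * χ (x + t) := by
    simp only [legendreSum_eq, Finset.mul_sum]
    rw [Finset.sum_comm]
    refine Finset.sum_congr rfl fun x _ ↦ Finset.sum_congr rfl fun t _ ↦ ?_
    rw [map_mul (quadChar k) (x * (x + 1))]
    ring
  have h2 : ∀ x : k, χ (x * (x + 1)) * ∑ t, ψ t * χ (x + t) =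
      ψ (-x) * χ (1 - -x) * jacobiSum ψ χ := by
    intro x
    by_cases hx : x = 0
    · simp [hx, MulChar.map_zero]
    have : ∑ t, ψ t * χ (x + t) = ψ (-x) * χ x * jacobiSum ψ χ := by
      rw [jacobiSum, Finset.mul_sum]
      symm
      refine Fintype.sum_equiv (Equiv.mulLeft₀ (-x) (neg_ne_zero.2 hx)) _ _ fun s ↦ ?_
      change _ = ψ (-x * s) * χ (x + -x * s)
      rw [show x + -x * s = x * (1 - s) by ring, map_mul, map_mul]
      ring
    rw [this, map_mul, show 1 - -x = x + 1 by ring]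
    have := quadChar_sq hx
    linear_combination (χ (x + 1) * ψ (-x) * jacobiSum ψ χ) * this
  rw [h1, Finset.sum_congr rfl fun x _ ↦ h2 x, ← Finset.sum_mul, sq]
  congr 1
  rw [jacobiSum]
  exact Fintype.sum_equiv (Equiv.neg k) _ _ fun x ↦ by simp

/-- Sort the u by t = u ^ d. The fibre over 0 is a single point, contributing S(0) = -1, and
multiplicative characters vanish there, so it enters as a separate term. -/
theorem sum_legendreSum_pow [Fintype k] [DecidableEq k] (h2 : (2 : k) ≠ 0) {d : ℕ} (hd : 0 < d)
    {ι : Type*} (I : Finset ι) (ψ : ι → MulChar k ℂ)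
    (hψ : ∀ t : k, t ≠ 0 →
      (({u | u ^ d = t} : Finset k).card : ℂ) = ∑ i ∈ I, ψ i t) :
    ∑ u : k, legendreSum k (u ^ d) = -1 + ∑ i ∈ I, jacobiSum (ψ i) (quadChar k) ^ 2 := by
  have h1 : ∑ u : k, legendreSum k (u ^ d) =
      ∑ t : k, (({u | u ^ d = t} : Finset k).card : ℂ) * legendreSum k t := by
    rw [← Finset.sum_fiberwise_of_maps_to (s := Finset.univ) (t := Finset.univ)
      (g := fun u : k ↦ u ^ d) fun _ _ ↦ Finset.mem_univ _]
    refine Finset.sum_congr rfl fun t _ ↦ ?_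
    rw [Finset.sum_congr rfl (g := fun _ ↦ legendreSum k t), Finset.sum_const, nsmul_eq_mul]
    intro u hu
    rw [(Finset.mem_filter.1 hu).2]
  have h3 : ∀ t : k, (({u | u ^ d = t} : Finset k).card : ℂ) * legendreSum k t =
      (if t = 0 then -1 else 0) + ∑ i ∈ I, ψ i t * legendreSum k t := by
    intro t
    rw [← Finset.sum_mul]
    split_ifs with ht
    · subst ht
      have : ({u | u ^ d = 0} : Finset k) = {0} := by
        ext u
        simp [hd.ne']
      rw [this, legendreSum_zero h2]
      simp [MulChar.map_zero]
    · rw [hψ t ht, zero_add]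
  rw [h1, Finset.sum_congr rfl fun t _ ↦ h3 t, Finset.sum_add_distrib, Finset.sum_comm,
    Finset.sum_congr rfl fun i _ ↦ sum_mul_legendreSum (ψ i)]
  simp

theorem jacobiSum_one_quadChar_sq [Fintype k] (h2 : (2 : k) ≠ 0) :
    jacobiSum 1 (quadChar k) ^ 2 = 1 := by
  rw [jacobiSum_one_nontrivial (quadChar_ne_one h2)]
  ring

theorem jacobiSum_quadChar_quadChar_sq [Fintype k] (h2 : (2 : k) ≠ 0) :
    jacobiSum (quadChar k) (quadChar k) ^ 2 = 1 := by
  have h4 := jacobiSum_nontrivial_inv (quadChar_ne_one h2)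
  rw [quadChar_inv] at h4
  rw [h4, neg_sq, quadChar_sq (neg_ne_zero.2 one_ne_zero)]

end LegendreSums

/-! ### Valuations of ℂ above p, and algebraic integrality. -/

section ValuationRings

theorem ValuationSubring.mem_of_isIntegral {K : Type*} [Field K] (V : ValuationSubring K) {x : K}
    (hx : IsIntegral ℤ x) : x ∈ V := by
  obtain ⟨y, rfl⟩ := IsIntegrallyClosed.isIntegral_iff.1 (hx.tower_top (A := V))
  exact y.2

/-- The integral closure of a subring of a field is the intersection of the valuation rings
containing it; here the subring is the image of ℤ. -/
theorem isIntegral_of_forall_mem_valuationSubring {K : Type*} [Field K] {x : K}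
    (h : ∀ V : ValuationSubring K, x ∈ V) : IsIntegral ℤ x := by
  have h1 : x ∈ (integralClosure (Subring.closure (∅ : Set K)) K).toSubring := by
    rw [← iInf_valuationSubring_superset]
    simp only [Subring.mem_iInf]
    exact fun V ↦ h V
  have h2 : IsIntegral (Subring.closure (∅ : Set K)) x := h1
  have : Algebra.IsIntegral ℤ (Subring.closure (∅ : Set K)) := ⟨fun y ↦ by
    obtain ⟨y, hy⟩ := y
    rw [Subring.closure_empty] at hy
    obtain ⟨n, rfl⟩ := hy
    exact isIntegral_algebraMap (R := ℤ) (x := n)⟩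
  exact isIntegral_trans x h2

/-- Otherwise 1/p would lie in every valuation ring and be an algebraic integer. -/
theorem exists_valuationSubring_lt_one {p : ℕ} (hp : p.Prime) :
    ∃ V : ValuationSubring ℂ, V.valuation (p : ℂ) < 1 := by
  by_contra! h
  have hp0 : (p : ℂ) ≠ 0 := by exact_mod_cast hp.ne_zero
  have h1 : IsIntegral ℤ ((p : ℂ)⁻¹) := isIntegral_of_forall_mem_valuationSubring fun V ↦ by
    rw [← V.valuation_le_one_iff, map_inv₀]
    exact inv_le_one_of_one_le₀ (h V)
  have h2 : IsIntegral ℤ ((p : ℚ)⁻¹) := by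
    rw [← isIntegral_algebraMap_iff (algebraMap ℚ ℂ).injective]
    simpa using h1
  obtain ⟨n, hn⟩ := IsIntegrallyClosed.isIntegral_iff.1 h2
  have h3 : (n : ℚ) * p = 1 := by
    have : (n : ℚ) = (p : ℚ)⁻¹ := hn
    rw [this]
    exact inv_mul_cancel₀ (by exact_mod_cast hp.ne_zero)
  have h4 : n * (p : ℤ) = 1 := by exact_mod_cast h3
  have h5 := Int.isUnit_iff.1 (IsUnit.of_mul_eq_one_right n h4)
  have := hp.two_le
  omega

variable {V : ValuationSubring ℂ} {p : ℕ}

theorem ValuationSubring.valuation_natCast_le (V : ValuationSubring ℂ) (n : ℕ) :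
    V.valuation (n : ℂ) ≤ 1 := (V.valuation_le_one_iff _).2 (natCast_mem V n)

theorem ValuationSubring.residue_eq_zero_iff_valuation (a : V) :
    IsLocalRing.residue V a = 0 ↔ V.valuation (a : ℂ) < 1 := by
  rw [IsLocalRing.residue_eq_zero_iff, V.valuation_lt_one_iff]

theorem charP_residueField (hp : p.Prime) (hV : V.valuation (p : ℂ) < 1) :
    CharP (IsLocalRing.ResidueField V) p := by
  rw [CharP.charP_iff_prime_eq_zero hp, ← map_natCast (IsLocalRing.residue V),
    ValuationSubring.residue_eq_zero_iff_valuation]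
  simpa using hV

/-- If ζ ^ l reduced to 1 with ζ ^ l ≠ 1, the vanishing sum of the (ζ ^ l) ^ i over i < n would
reduce to n, which is nonzero in characteristic p. -/
theorem isPrimitiveRoot_residue (hp : p.Prime) (hV : V.valuation (p : ℂ) < 1) {n : ℕ} (hn : 0 < n)
    (hpn : ¬ p ∣ n) {ζ : V} (hζ : IsPrimitiveRoot ζ n) :
    IsPrimitiveRoot (IsLocalRing.residue V ζ) n := by
  have := charP_residueField hp hV
  refine IsPrimitiveRoot.mk_of_lt _ hn (by rw [← map_pow, hζ.pow_eq_one, map_one]) ?_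
  intro l hl0 hl h
  rw [← map_pow] at h
  have h1 : ζ ^ l ≠ 1 := hζ.pow_ne_one_of_pos_of_lt hl0.ne' hl
  have h2 : (ζ ^ l - 1) * ∑ i ∈ Finset.range n, (ζ ^ l) ^ i = 0 := by
    rw [mul_geom_sum, ← pow_mul, mul_comm l, pow_mul, hζ.pow_eq_one, one_pow, sub_self]
  have h3 := (mul_eq_zero.1 h2).resolve_left (sub_ne_zero.2 h1)
  have h4 := congrArg (IsLocalRing.residue V) h3
  rw [map_sum, map_zero] at h4
  simp only [map_pow _ (ζ ^ l), h, one_pow, Finset.sum_const, Finset.card_range, nsmul_eq_mul,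
    mul_one] at h4
  exact hpn ((CharP.cast_eq_zero_iff _ p n).1 h4)

/-- The Teichmüller character: a complex character whose reduction modulo V is a field embedding of
L. It transfers congruences for Jacobi sums to identities in L. -/
theorem exists_teichmuller (hp : p.Prime) (hV : V.valuation (p : ℂ) < 1) (L : Type*) [Field L]
    [Fintype L] [CharP L p] :
    ∃ (ω : MulChar L ℂ) (τ : L →+* IsLocalRing.ResidueField V) (hω : ∀ x, ω x ∈ V),
      ∀ x, IsLocalRing.residue V ⟨ω x, hω x⟩ = τ x := by
  classical
  have hk := charP_residueField hp hV
  have : Fact p.Prime := ⟨hp⟩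
  set n := Fintype.card L - 1 with hn
  have hcard : 1 < Fintype.card L := Fintype.one_lt_card
  have hn0 : 0 < n := by omega
  have hpQ : p ∣ Fintype.card L := (CharP.cast_eq_zero_iff L p _).1 (FiniteField.cast_card_eq_zero L)
  have hpn : ¬ p ∣ n := fun h ↦ by
    have := (Nat.dvd_sub hpQ h)
    rw [show Fintype.card L - n = 1 by omega, Nat.dvd_one] at this
    exact hp.one_lt.ne' this
  have : NeZero n := ⟨hn0.ne'⟩
  have hζ0 := Complex.isPrimitiveRoot_exp n hn0.ne'
  set z := Complex.exp (2 * Real.pi * Complex.I / n)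
  let ζ : V := ⟨z, V.mem_of_isIntegral (hζ0.isIntegral hn0)⟩
  have hζ : IsPrimitiveRoot ζ n :=
    IsPrimitiveRoot.of_map_of_injective (f := V.subtype) hζ0 Subtype.val_injective
  have hr := isPrimitiveRoot_residue hp hV hn0 hpn hζ
  let := ZMod.algebra L p
  let := ZMod.algebra (IsLocalRing.ResidueField V) p
  have hsplit : ((X ^ Fintype.card L - X : (ZMod p)[X]).map
      (algebraMap (ZMod p) (IsLocalRing.ResidueField V))).Splits := by
    have : (X ^ Fintype.card L - X : (ZMod p)[X]).map
      (algebraMap (ZMod p) (IsLocalRing.ResidueField V)) = X * (X ^ n - C 1) := by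
      rw [Polynomial.map_sub, Polynomial.map_pow, Polynomial.map_X, mul_sub, ← pow_succ', hn,
        Nat.sub_add_cancel hcard.le, C_1, mul_one]
    rw [this]
    exact Splits.X.mul (X_pow_sub_one_splits hr)
  have := FiniteField.isSplittingField_sub L (ZMod p)
  let τ : L →+* IsLocalRing.ResidueField V := (IsSplittingField.lift L _ hsplit).toRingHom
  obtain ⟨g, hg⟩ := IsCyclic.exists_generator (α := Lˣ)
  have hcu : Fintype.card Lˣ = n := Fintype.card_units L
  have hgn : (g : L) ^ n = 1 := by
    rw [← Units.val_pow_eq_pow_val, ← hcu, pow_card_eq_one, Units.val_one]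
  -- The image of the generator is a power of the reduced root of unity; the same power in ℂ defines
  -- ω.
  obtain ⟨j, -, hj⟩ := hr.eq_pow_of_pow_eq_one (ξ := τ g) (by rw [← map_pow, hgn, map_one])
  have hu : (hζ0.isUnit hn0.ne').unit ^ j ∈ rootsOfUnity (Fintype.card Lˣ) ℂ := by
    rw [mem_rootsOfUnity, hcu]
    ext
    simp only [Units.val_pow_eq_pow_val, IsUnit.unit_spec, Units.val_one]
    rw [← pow_mul, mul_comm, pow_mul, hζ0.pow_eq_one, one_pow]
  let ω := MulChar.ofRootOfUnity hu hg
  have hωg : ω g = z ^ j := by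
    rw [MulChar.ofRootOfUnity_spec]
    simp
  have hx : ∀ x : L, ∃ h : ω x ∈ V, IsLocalRing.residue V ⟨ω x, h⟩ = τ x := by
    intro x
    by_cases hx : x = 0
    · subst hx
      refine ⟨by rw [MulChar.map_zero]; exact V.zero_mem, ?_⟩
      rw [map_zero τ, ValuationSubring.residue_eq_zero_iff_valuation]
      simp [MulChar.map_zero]
    · obtain ⟨i, hi⟩ := (mem_powers_iff_mem_zpowers).2 (hg (Units.mk0 x hx))
      have hxi : x = (g : L) ^ i := by
        have := congrArg Units.val hi
        simpa using this.symm
      have h1 : ω x = ((ζ ^ j) ^ i : V) := by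
        rw [hxi, map_pow, hωg]
        rfl
      refine ⟨h1 ▸ ((ζ ^ j) ^ i).2, ?_⟩
      have h2 : (⟨ω x, h1 ▸ ((ζ ^ j) ^ i).2⟩ : V) = (ζ ^ j) ^ i := Subtype.ext h1
      rw [h2, map_pow, map_pow, hj, hxi, map_pow]
  choose h1 h2 using hx
  exact ⟨ω, τ, h1, h2⟩

theorem isIntegral_mulChar {L : Type*} [Field L] [Finite L] (ψ : MulChar L ℂ) (x : L) :
    IsIntegral ℤ (ψ x) := by
  have := Fintype.ofFinite Lˣ
  by_cases hx : x = 0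
  · rw [hx, MulChar.map_zero]
    exact isIntegral_zero
  · refine IsIntegral.of_pow (n := Fintype.card Lˣ) Fintype.card_pos ?_
    have := MulChar.pow_card_eq_one ψ
    rw [← MulChar.pow_apply' _ Fintype.card_ne_zero, this, MulChar.one_apply (Ne.isUnit hx)]
    exact isIntegral_one

theorem isIntegral_addChar {L : Type*} [Field L] [Finite L] (ψ : AddChar L ℂ) (x : L) :
    IsIntegral ℤ (ψ x) := by
  have := Fintype.ofFinite L
  refine IsIntegral.of_pow (n := Fintype.card L) Fintype.card_pos ?_
  rw [← AddChar.map_nsmul_eq_pow, card_nsmul_eq_zero, AddChar.map_zero_eq_one]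
  exact isIntegral_one

theorem valuation_mulChar {L : Type*} [Field L] [Finite L] (ψ : MulChar L ℂ) {x : L} (hx : x ≠ 0) :
    V.valuation (ψ x) = 1 := by
  refine le_antisymm ((V.valuation_le_one_iff _).2 (V.mem_of_isIntegral (isIntegral_mulChar ψ x))) ?_
  have h1 : ψ x * ψ x⁻¹ = 1 := by rw [← map_mul, mul_inv_cancel₀ hx, map_one]
  have h2 : V.valuation (ψ x⁻¹) ≤ 1 :=
    (V.valuation_le_one_iff _).2 (V.mem_of_isIntegral (isIntegral_mulChar ψ _))
  have h3 := congrArg V.valuation h1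
  rw [map_mul, map_one] at h3
  rw [← h3]
  exact mul_le_of_le_one_right' h2

theorem isIntegral_gaussSum {L : Type*} [Field L] [Fintype L] (χ : MulChar L ℂ) (ψ : AddChar L ℂ) :
    IsIntegral ℤ (gaussSum χ ψ) :=
  IsIntegral.sum _ fun x _ ↦ (isIntegral_mulChar χ x).mul (isIntegral_addChar ψ x)

theorem isIntegral_jacobiSum {L : Type*} [Field L] [Fintype L] (χ ψ : MulChar L ℂ) :
    IsIntegral ℤ (jacobiSum χ ψ) :=
  IsIntegral.sum _ fun _ _ ↦ (isIntegral_mulChar χ _).mul (isIntegral_mulChar ψ _)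

theorem gaussSum_inv_addChar {L : Type*} [Field L] [Fintype L] (χ : MulChar L ℂ)
    (ψ : AddChar L ℂ) : gaussSum χ ψ⁻¹ = χ (-1) * gaussSum χ ψ := by
  rw [gaussSum, gaussSum, Finset.mul_sum]
  refine Fintype.sum_equiv (Equiv.neg L) _ _ fun x ↦ ?_
  rw [Equiv.neg_apply, AddChar.inv_apply, ← mul_assoc, ← map_mul, neg_one_mul, neg_neg]

theorem valuation_gaussSum_mul {L : Type*} [Field L] [Fintype L] {χ : MulChar L ℂ} (hχ : χ ≠ 1)
    {ψ : AddChar L ℂ} (hψ : ψ.IsPrimitive) :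
    V.valuation (gaussSum χ ψ) * V.valuation (gaussSum χ⁻¹ ψ) =
      V.valuation (Fintype.card L : ℂ) := by
  have := gaussSum_mul_gaussSum_eq_card hχ hψ
  rw [gaussSum_inv_addChar] at this
  rw [← this, map_mul, map_mul, valuation_mulChar _ (neg_ne_zero.2 one_ne_zero), one_mul]

/-- Substituting x ↦ x ^ p replaces ψ by its composite with the inverse Frobenius, which is again of
the form ψ(b ·) with b ≠ 0. The Gauss sum changes by a root of unity, which is a V-adic unit. -/
theorem valuation_gaussSum_pow_char {L : Type*} [Field L] [Fintype L] (hp : p.Prime) [CharP L p]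
    (χ : MulChar L ℂ) {ψ : AddChar L ℂ} (hψ : ψ.IsPrimitive) :
    V.valuation (gaussSum (χ ^ p) ψ) = V.valuation (gaussSum χ ψ) := by
  have : Fact p.Prime := ⟨hp⟩
  let e : L ≃+* L := RingEquiv.ofBijective (frobenius L p)
    (Finite.injective_iff_bijective.1 (frobenius L p).injective)
  let φ : AddChar L ℂ := ψ.compAddMonoidHom (e.symm : L →+ L)
  have hbij : Function.Bijective ψ.mulShift := by
    rw [Fintype.bijective_iff_injective_and_card]
    exact ⟨AddChar.to_mulShift_inj_of_isPrimitive hψ, (AddChar.card_eq).symm⟩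
  obtain ⟨b, hb⟩ := hbij.2 φ
  have h1 : gaussSum (χ ^ p) ψ = gaussSum χ φ := by
    rw [gaussSum, gaussSum]
    refine Fintype.sum_equiv e.toEquiv _ _ fun x ↦ ?_
    have : φ (e x) = ψ x := by simp [φ]
    rw [MulChar.pow_apply' _ hp.ne_zero]
    change χ x ^ p * ψ x = χ (e x) * φ (e x)
    rw [this, ← map_pow]
    rfl
  have hb0 : b ≠ 0 := by
    rintro rfl
    refine hψ one_ne_zero ?_
    rw [AddChar.mulShift_one]
    ext x
    have h2 := congrArg (fun f ↦ f (e x)) hb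
    simpa [φ, AddChar.mulShift_apply] using h2.symm
  have h2 := gaussSum_mulShift χ ψ (Units.mk0 b hb0)
  rw [Units.val_mk0, hb] at h2
  rw [h1, ← h2, map_mul, valuation_mulChar _ hb0, one_mul]

end ValuationRings

/-! ### Digit sums in base p. -/

section Digits

theorem Nat.digits_sum_mul {p : ℕ} (hp : 1 < p) (b : ℕ) :
    (p.digits (p * b)).sum = (p.digits b).sum := by
  rcases Nat.eq_zero_or_pos b with rfl | hb
  · simp
  · rw [Nat.digits_base_mul hp hb]
    simp

theorem Nat.digits_sum_succ {p : ℕ} (hp : 1 < p) {a : ℕ} (h : ¬ p ∣ a + 1) :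
    (p.digits (a + 1)).sum = (p.digits a).sum + 1 := by
  have h1 : (a + 1) / p = a / p := Nat.succ_div_of_not_dvd h
  have h2 : (a + 1) % p = a % p + 1 := by
    have e1 := Nat.div_add_mod (a + 1) p
    have e2 := Nat.div_add_mod a p
    rw [h1] at e1
    omega
  rcases Nat.eq_zero_or_pos a with rfl | ha
  · rw [Nat.digits_def' hp (by omega), h1, h2]
    simp
  · rw [Nat.digits_def' hp (by omega), h1, h2, Nat.digits_def' hp ha, List.sum_cons, List.sum_cons]
    omega

/-- The remainders of the `p ^ i * a` modulo `p ^ f - 1` add up to a multiple of the digit sum. -/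
theorem sub_one_mul_sum_pow_mul_mod {p f a : ℕ} (hp : 1 < p) (ha : a < p ^ f - 1) :
    (p - 1) * ∑ i ∈ Finset.range f, (p ^ i * a % (p ^ f - 1)) =
      (p ^ f - 1) * (p.digits a).sum := by
  -- Multiplication by p ^ i modulo p ^ f - 1 rotates the f digits. With a = u p ^ (f-i) + r, the
  -- rotated number is u + p ^ i r.
  have h1 : ∀ i ∈ Finset.range f,
      (p ^ i * a % (p ^ f - 1)) + (p ^ f - 1) * (a / p ^ (f - i)) = p ^ i * a := by
    intro i hi
    rw [Finset.mem_range] at hi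
    set B := p ^ (f - i) with hB
    set A := p ^ i with hA
    have hAB : p ^ f = A * B := by rw [hA, hB, ← pow_add]; congr 1; omega
    have hB0 : 0 < B := by positivity
    have hA0 : 0 < A := by positivity
    rw [hAB] at ha ⊢
    have hdm := Nat.div_add_mod a B
    set u := a / B
    set r := a % B
    have hr : r < B := Nat.mod_lt _ hB0
    have hu : u < A := Nat.div_lt_of_lt_mul (by rw [mul_comm]; omega)
    have hle : r + 1 ≤ B := hr
    have hpos : 0 < A * B := by positivity
    have e : A * a = (u + A * r) + (A * B - 1) * u := by
      zify [Nat.one_le_iff_ne_zero.2 hpos.ne']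
      have : (a : ℤ) = B * u + r := by exact_mod_cast hdm.symm
      rw [this]; ring
    -- Equality would force all digits to be p - 1, that is a = p ^ f - 1.
    have hlt : u + A * r < A * B - 1 := by
      have h3 : A * r ≤ A * (B - 1) := Nat.mul_le_mul_left _ (by omega)
      have h4 : A * (B - 1) + A = A * B := by
        rw [← Nat.mul_succ, Nat.succ_eq_add_one, Nat.sub_add_cancel hB0]
      by_contra hcon
      have hu' : u = A - 1 := by omega
      have h5 : A * r = A * (B - 1) := by omega
      have hr' : r = B - 1 := Nat.eq_of_mul_eq_mul_left hA0 h5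
      have : a = A * B - 1 := by
        rw [← hdm, hu', hr']
        zify [hA0, hB0, Nat.one_le_iff_ne_zero.2 hpos.ne']
        ring
      omega
    rw [e, Nat.add_mul_mod_self_left, Nat.mod_eq_of_lt hlt]
  have h2 := Finset.sum_congr rfl h1
  rw [Finset.sum_add_distrib, ← Finset.mul_sum, ← Finset.sum_mul] at h2
  have h3 : (p - 1) * ∑ i ∈ Finset.range f, p ^ i = p ^ f - 1 := by
    have := Nat.geomSum_eq hp f
    rw [this, Nat.mul_div_cancel' (Nat.sub_one_dvd_pow_sub_one _ _)]
  -- Legendre's formula (p - 1) Σ_j ⌊a / p ^ j⌋ = a - (digit sum). The terms beyond the number of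
  -- digits vanish, which allows different ranges of summation.
  have h4 : (p - 1) * ∑ i ∈ Finset.range f, a / p ^ (f - i) = a - (p.digits a).sum := by
    rw [← Nat.sub_one_mul_sum_log_div_pow_eq_sub_sum_digits a]
    congr 1
    rw [← Finset.sum_range_reflect]
    have e1 : ∑ j ∈ Finset.range f, a / p ^ (f - (f - 1 - j)) =
        ∑ j ∈ Finset.range f, a / p ^ (j + 1) := by
      refine Finset.sum_congr rfl fun j hj ↦ ?_
      rw [Finset.mem_range] at hj
      congr 2
      omega
    rw [e1]
    have hz : ∀ m, a < p ^ m → ∀ N, m ≤ N + 1 → ∑ j ∈ Finset.range N, a / p ^ (j + 1) =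
        ∑ j ∈ Finset.range (m - 1), a / p ^ (j + 1) := by
      intro m hm N hN
      symm
      refine Finset.sum_subset (fun j hj ↦ by rw [Finset.mem_range] at hj ⊢; omega) fun j hj hj' ↦ ?_
      rw [Finset.mem_range] at hj hj'
      exact Nat.div_eq_of_lt (hm.trans_le (Nat.pow_le_pow_right (by omega) (by omega)))
    have hlog := Nat.lt_pow_succ_log_self hp a
    set N := max f (Nat.log p a).succ
    rw [hz _ hlog (Nat.log p a).succ (by omega), ← hz _ hlog N (by omega), hz f (by omega) N (by omega),
      ← hz f (by omega) f (by omega)]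
  have h5 := Nat.digit_sum_le p a
  have h6 := congrArg (fun x ↦ (p - 1) * x) h2
  simp only [mul_add] at h6
  rw [← mul_assoc (p - 1) (∑ i ∈ Finset.range f, p ^ i) a, h3,
    mul_left_comm (p - 1) (p ^ f - 1), h4, Nat.mul_sub] at h6
  have h7 := Nat.mul_le_mul_left (p ^ f - 1) h5
  omega

end Digits

/-! ### Valuations of Gauss and Jacobi sums. -/

section Stickelberger

variable {V : ValuationSubring ℂ} {p : ℕ}

/-- This is the reduction of J(ω^(-(a-1)), ω⁻¹) for the Teichmüller character ω. After y = 1/x the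
term is y ^ a / (y - 1) = 1 + y + ... + y ^ (a-1) + 1/(y - 1) for y ≠ 1. Power sums of exponent
below |L| - 1 vanish, and only the correction -a at y = 1 survives. -/
theorem sum_inv_pow_mul_inv_one_sub {L : Type*} [Field L] [Fintype L] {a : ℕ} (ha : 2 ≤ a)
    (haQ : a < Fintype.card L - 1) :
    ∑ x : L, x⁻¹ ^ (a - 1) * (1 - x)⁻¹ = -(a : L) := by
  classical
  have h1 : ∑ x : L, x⁻¹ ^ (a - 1) * (1 - x)⁻¹ = ∑ y : L, y ^ a * (y - 1)⁻¹ := by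
    refine Fintype.sum_equiv (Equiv.ofBijective _ (inv_bijective (G := L))) _ _ fun x ↦ ?_
    rw [Equiv.ofBijective_apply]
    by_cases hx : x = 0
    · rw [hx, inv_zero, zero_pow (by omega), zero_pow (by omega), zero_mul, zero_mul]
    · obtain ⟨b, rfl⟩ : ∃ b, a = b + 1 := ⟨a - 1, by omega⟩
      rw [Nat.add_sub_cancel, pow_succ, mul_assoc, ← mul_inv]
      congr 2
      rw [mul_sub, mul_inv_cancel₀ hx, mul_one]
  have h2 : ∀ y : L, y ^ a * (y - 1)⁻¹ = (∑ i ∈ Finset.range a, y ^ i) -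
      (if y = 1 then (a : L) else 0) + (y - 1)⁻¹ := by
    intro y
    split_ifs with hy
    · simp [hy]
    · have h3 : y - 1 ≠ 0 := sub_ne_zero.2 hy
      have h4 := mul_geom_sum y a
      field_simp
      linear_combination -h4
  have h5 : ∑ y : L, (y - 1)⁻¹ = 0 := by
    have h6 := FiniteField.sum_pow_lt_card_sub_one L 1 (by omega)
    simp only [pow_one] at h6
    rw [← h6]
    exact Fintype.sum_equiv ((Equiv.subRight (1 : L)).trans
      (Equiv.ofBijective _ (inv_bijective (G := L)))) _ _ fun x ↦ rfl
  rw [h1, Finset.sum_congr rfl fun y _ ↦ h2 y, Finset.sum_add_distrib, Finset.sum_sub_distrib, h5,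
    Finset.sum_comm, Finset.sum_eq_zero]
  · simp
  · intro i hi
    rw [Finset.mem_range] at hi
    exact FiniteField.sum_pow_lt_card_sub_one L i (by omega)

/-- A form of Stickelberger's theorem that leaves s undetermined. With η the inverse Teichmüller
character, the valuation is multiplied by s from a - 1 to a when p ∤ a, and is unchanged from b to p
b. Digit sums obey the same recursion. -/
theorem exists_mulChar_gaussSum_valuation (hp : p.Prime) (hV : V.valuation (p : ℂ) < 1)
    (L : Type*) [Field L] [Fintype L] [CharP L p] (hQ : 2 < Fintype.card L)
    {φ : AddChar L ℂ} (hφ : φ.IsPrimitive) :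
    ∃ (η : MulChar L ℂ) (s : V.ValueGroup), orderOf η = Fintype.card L - 1 ∧
      (∀ ψ : MulChar L ℂ, ∃ a < Fintype.card L - 1, ψ = η ^ a) ∧ 0 < s ∧ s < 1 ∧
      ∀ a < Fintype.card L - 1, V.valuation (gaussSum (η ^ a) φ) = s ^ (p.digits a).sum := by
  classical
  obtain ⟨ω, τ, hω, hτ⟩ := exists_teichmuller hp hV L
  have hk := charP_residueField hp hV
  set n := Fintype.card L - 1 with hn
  have hn0 : 0 < n := by omega
  have : NeZero n := ⟨hn0.ne'⟩
  obtain ⟨g, hg⟩ := IsCyclic.exists_generator (α := Lˣ)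
  have hcu : Fintype.card Lˣ = n := Fintype.card_units L
  have hog : orderOf g = n := by rw [orderOf_eq_card_of_forall_mem_zpowers hg, Nat.card_eq_fintype_card, hcu]
  set η := ω⁻¹ with hη
  have hηV : ∀ x, η x ∈ V := fun x ↦ V.mem_of_isIntegral (isIntegral_mulChar η x)
  have hηr : ∀ x, IsLocalRing.residue V ⟨η x, hηV x⟩ = τ x⁻¹ := by
    intro x
    rw [← hτ]
    congr 2
    exact MulChar.inv_apply' ω x
  have hprim : IsPrimitiveRoot (η g) n := by
    refine IsPrimitiveRoot.mk_of_lt _ hn0 ?_ ?_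
    · rw [← hcu, ← MulChar.pow_apply' _ Fintype.card_ne_zero, MulChar.pow_card_eq_one,
        MulChar.one_apply_coe]
    · intro l hl0 hl h
      have h1 := hηr ((g : L) ^ l)
      have h2 : (⟨η ((g : L) ^ l), hηV _⟩ : V) = 1 := Subtype.ext (show η ((g : L) ^ l) = 1 by rw [map_pow, h])
      rw [h2, map_one, ← map_one τ] at h1
      have h3 := inv_eq_one.1 (τ.injective h1).symm
      have h4 : g ^ l = 1 := Units.ext (by simpa using h3)
      have h5 := orderOf_dvd_of_pow_eq_one h4
      rw [hog] at h5
      exact absurd (Nat.le_of_dvd hl0 h5) (by omega)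
  have hηn : η ^ n = 1 := by rw [← hcu, MulChar.pow_card_eq_one]
  have hord : orderOf η = n := by
    refine Nat.dvd_antisymm (orderOf_dvd_of_pow_eq_one hηn) (hprim.dvd_of_pow_eq_one _ ?_)
    rw [← MulChar.pow_apply_coe, pow_orderOf_eq_one, MulChar.one_apply_coe]
  have hall : ∀ ψ : MulChar L ℂ, ∃ a < n, ψ = η ^ a := by
    intro ψ
    have h1 : ψ g ^ n = 1 := by
      rw [← hcu, ← MulChar.pow_apply' _ Fintype.card_ne_zero, MulChar.pow_card_eq_one,
        MulChar.one_apply_coe]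
    obtain ⟨i, hi, hi'⟩ := hprim.eq_pow_of_pow_eq_one h1
    refine ⟨i, hi, (MulChar.eq_iff hg _ _).2 ?_⟩
    rw [MulChar.pow_apply_coe, hi']
  have hne : ∀ a, 0 < a → a < n → η ^ a ≠ 1 := fun a h0 h1 ↦
    pow_ne_one_of_lt_orderOf h0.ne' (by rwa [hord])
  set σ : ℕ → V.ValueGroup := fun a ↦ V.valuation (gaussSum (η ^ a) φ) with hσ
  have hdig1 : (p.digits 1).sum = 1 := by
    rw [Nat.digits_of_lt p 1 one_ne_zero hp.one_lt]
    simp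
  have hpQ : p ∣ Fintype.card L := (CharP.cast_eq_zero_iff L p _).1 (FiniteField.cast_card_eq_zero L)
  -- The Jacobi sum reduces to -a, which is nonzero when p ∤ a.
  have hJ : ∀ a, 2 ≤ a → a < n → ¬ p ∣ a → V.valuation (jacobiSum (η ^ (a - 1)) η) = 1 := by
    intro a ha han hpa
    let j : V := ∑ x : L, (⟨η x, hηV x⟩ : V) ^ (a - 1) * ⟨η (1 - x), hηV (1 - x)⟩
    have hj : (j : ℂ) = jacobiSum (η ^ (a - 1)) η := by
      rw [jacobiSum, ← V.coe_subtype, map_sum]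
      refine Finset.sum_congr rfl fun x _ ↦ ?_
      rw [MulChar.pow_apply' _ (by omega)]
      rfl
    have hr : IsLocalRing.residue V j = τ (-(a : L)) := by
      rw [← sum_inv_pow_mul_inv_one_sub ha han, map_sum, map_sum]
      refine Finset.sum_congr rfl fun x _ ↦ ?_
      rw [map_mul, map_mul, map_pow, map_pow, hηr, hηr]
    have hr0 : IsLocalRing.residue V j ≠ 0 := by
      rw [hr, Ne, _root_.map_eq_zero, neg_eq_zero, CharP.cast_eq_zero_iff L p]
      exact hpa
    rw [Ne, ValuationSubring.residue_eq_zero_iff_valuation, not_lt, hj] at hr0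
    exact le_antisymm
      ((V.valuation_le_one_iff _).2 (V.mem_of_isIntegral (isIntegral_jacobiSum _ _))) hr0
  have hstep : ∀ a, 2 ≤ a → a < n → ¬ p ∣ a → σ a = σ (a - 1) * σ 1 := by
    intro a ha han hpa
    have h1 : η ^ (a - 1) * η = η ^ a := by rw [← pow_succ, Nat.sub_add_cancel (by omega)]
    have h2 := jacobiSum_mul_nontrivial (χ := η ^ (a - 1)) (φ := η) (by
      rw [h1]; exact hne a (by omega) han) φ
    have h3 := congrArg V.valuation h2
    rw [map_mul, map_mul, hJ a ha han hpa, mul_one, h1] at h3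
    simp only [hσ, h3, pow_one]
  have hfrob : ∀ b, σ (p * b) = σ b := by
    intro b
    simp only [hσ]
    rw [mul_comm, pow_mul, valuation_gaussSum_pow_char hp _ hφ]
  have hpowpos : ∀ a, 0 < a → a < n → σ a = σ 1 ^ (p.digits a).sum := by
    intro a
    induction a using Nat.strong_induction_on with
    | _ a ih =>
      intro ha0 han
      by_cases hpa : p ∣ a
      · obtain ⟨b, rfl⟩ := hpa
        have hb0 : 0 < b := Nat.pos_of_mul_pos_left ha0
        have hba : b < p * b := lt_mul_of_one_lt_left hb0 hp.one_lt
        rw [hfrob, ih b hba hb0 (hba.trans han), Nat.digits_sum_mul hp.one_lt]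
      · by_cases ha1 : a = 1
        · rw [ha1, hdig1, pow_one]
        · obtain ⟨b, rfl⟩ : ∃ b, a = b + 1 := ⟨a - 1, by omega⟩
          rw [hstep (b + 1) (by omega) han hpa, Nat.add_sub_cancel,
            ih b (by omega) (by omega) (by omega), Nat.digits_sum_succ hp.one_lt hpa, pow_succ]
  -- The product of the Gauss sums of η and η⁻¹ has the valuation of |L|, which is below 1. If s
  -- were 1, all the σ a with 0 < a < n would be 1, a contradiction.
  have hcompl : σ 1 * σ (n - 1) = V.valuation (Fintype.card L : ℂ) := by
    rw [← valuation_gaussSum_mul (hne 1 one_pos (by omega)) hφ]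
    simp only [hσ]
    congr 3
    rw [pow_one, eq_comm, inv_eq_iff_mul_eq_one, ← pow_succ', Nat.sub_add_cancel (by omega), hηn]
  have hQ1 : V.valuation (Fintype.card L : ℂ) < 1 := by
    obtain ⟨m, hm⟩ := hpQ
    rw [hm, Nat.cast_mul, map_mul]
    exact (mul_le_of_le_one_right' (V.valuation_natCast_le m)).trans_lt hV
  have hQ0 : V.valuation (Fintype.card L : ℂ) ≠ 0 :=
    (_root_.map_ne_zero _).2 (by exact_mod_cast Fintype.card_ne_zero)
  have hs0 : σ 1 ≠ 0 := fun h ↦ hQ0 (by rw [← hcompl, h, zero_mul])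
  refine ⟨η, σ 1, hord, hall, zero_lt_iff.2 hs0, ?_, ?_⟩
  · by_contra hcon
    have h1 : σ 1 = 1 := le_antisymm ((V.valuation_le_one_iff _).2
      (V.mem_of_isIntegral (isIntegral_gaussSum _ _))) (not_lt.1 hcon)
    rw [hpowpos (n - 1) (by omega) (by omega), h1, one_pow, one_mul] at hcompl
    exact hQ1.ne hcompl.symm
  · intro a han
    rcases Nat.eq_zero_or_pos a with rfl | ha
    · have hφ1 : φ ≠ 1 := fun h ↦ by
        refine hφ one_ne_zero ?_
        rw [AddChar.mulShift_one, h]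
      rw [pow_zero, gaussSum_one_left hφ1]
      simp
    · exact hpowpos a ha han

theorem primitive_addChar_complex (L : Type*) [Field L] [Finite L] :
    ∃ φ : AddChar L ℂ, φ.IsPrimitive :=
  ⟨_, AddChar.FiniteField.primitiveChar_to_Complex_isPrimitive L⟩

/-- The valuation of the Jacobi sum of a character with the quadratic character, in terms of
digit sums. -/
theorem exists_mulChar_jacobiSum_valuation (hp : p.Prime) (hp2 : p ≠ 2)
    (hV : V.valuation (p : ℂ) < 1) (L : Type*) [Field L] [Fintype L] [CharP L p] {n h : ℕ}
    (hn : Fintype.card L = n + 1) (hh : n = 2 * h) :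
    ∃ (η : MulChar L ℂ), orderOf η = n ∧ (∀ ψ : MulChar L ℂ, ∃ a < n, ψ = η ^ a) ∧
      ∀ a < n, (η ^ a) ^ 2 ≠ 1 →
        (V.valuation (jacobiSum (η ^ a) (quadChar L) ^ 2) = V.valuation (Fintype.card L : ℂ) ↔
          (p.digits a).sum = (p.digits ((a + h) % n)).sum) := by
  classical
  have h2 : (2 : L) ≠ 0 := by
    intro h0
    have h1 : ((2 : ℕ) : L) = 0 := by exact_mod_cast h0
    rw [CharP.cast_eq_zero_iff L p, Nat.prime_dvd_prime_iff_eq hp Nat.prime_two] at h1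
    exact hp2 h1
  obtain ⟨φ, hφ⟩ := primitive_addChar_complex L
  have hpQ : p ∣ Fintype.card L := (CharP.cast_eq_zero_iff L p _).1 (FiniteField.cast_card_eq_zero L)
  have hQ : 2 < Fintype.card L := by
    have := Nat.le_of_dvd Fintype.card_pos hpQ
    have := hp.two_le
    omega
  obtain ⟨η, s, hord, hall, hs0, hs1, hval⟩ := exists_mulChar_gaussSum_valuation hp hV L hQ hφ
  rw [hn, Nat.add_sub_cancel] at hord hall hval
  refine ⟨η, hord, hall, fun a han ha2 ↦ ?_⟩
  have hn0 : 0 < n := by omega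
  have hh0 : 0 < h := by omega
  -- The character η generates a cyclic group of order n = 2 h, and χ is its only element of order
  -- 2.
  have hquad : quadChar L = η ^ h := by
    obtain ⟨b, hb, hb'⟩ := hall (quadChar L)
    have h1 : η ^ (2 * b) = 1 := by
      rw [mul_comm, pow_mul, ← hb', sq, quadChar_mul_quadChar]
    have h3 := orderOf_dvd_of_pow_eq_one h1
    rw [hord, hh] at h3
    obtain ⟨c, hc⟩ := h3
    have hbc : b = h * c := by
      have : 2 * b = 2 * (h * c) := by rw [hc]; ring
      omega
    have hc2 : c < 2 := by
      by_contra hcon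
      have : h * 2 ≤ h * c := Nat.mul_le_mul_left _ (by omega)
      omega
    have hc0 : c ≠ 0 := by
      rintro rfl
      rw [mul_zero] at hbc
      rw [hbc, pow_zero] at hb'
      exact quadChar_ne_one h2 hb'
    rw [hb', hbc, show c = 1 by omega, mul_one]
  have hmod : η ^ a * quadChar L = η ^ ((a + h) % n) := by
    rw [hquad, ← pow_add, ← hord, pow_mod_orderOf]
  have hne1 : η ^ a * quadChar L ≠ 1 := by
    intro h1
    refine ha2 ?_
    have : η ^ a = quadChar L := by
      rw [← quadChar_inv]
      exact eq_inv_of_mul_eq_one_left h1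
    rw [this, sq, quadChar_mul_quadChar]
  -- From G(ψχ) J(ψ, χ) = G(ψ) G(χ), together with the fact that G(χ)² has the valuation of |L|, it
  -- follows that J² has this valuation exactly when G(ψ) and G(ψχ) have equal valuations.
  have key := congrArg (fun x ↦ V.valuation x ^ 2) (jacobiSum_mul_nontrivial hne1 φ)
  simp only [map_mul, mul_pow] at key
  have hq2 : V.valuation (gaussSum (quadChar L) φ) ^ 2 = V.valuation (Fintype.card L : ℂ) := by
    have := valuation_gaussSum_mul (V := V) (quadChar_ne_one h2) hφ
    rw [quadChar_inv] at this
    rw [sq, this]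
  rw [hq2, hmod, hval _ (Nat.mod_lt _ hn0), hval a han] at key
  have hQ0 : V.valuation (Fintype.card L : ℂ) ≠ 0 :=
    (_root_.map_ne_zero _).2 (by exact_mod_cast Fintype.card_ne_zero)
  rw [map_pow]
  set w := V.valuation (jacobiSum (η ^ a) (quadChar L))
  set A := (p.digits a).sum
  set B := (p.digits ((a + h) % n)).sum
  have hinj := pow_right_injective₀ hs0 hs1.ne
  constructor
  · intro hw
    rw [hw] at key
    have h3 := mul_right_cancel₀ hQ0 key
    rw [← pow_mul, ← pow_mul] at h3
    have := hinj h3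
    omega
  · intro hAB
    rw [hAB] at key
    exact mul_left_cancel₀ (pow_ne_zero _ (pow_ne_zero _ hs0.ne')) key

end Stickelberger

/-! ### Digit sums and the two halves of the residues modulo e. -/

section Balanced

/-- Adding half of the modulus preserves the digit sum exactly when the residues are evenly divided
between the two halves. -/
theorem digits_sum_eq_iff {p f e c m h : ℕ} (hp : 1 < p) (hodd : Odd p) (hm : p ^ f - 1 = m * e)
    (hh : p ^ f - 1 = 2 * h) (he : 2 < e) (hc : c < e) (hce : c.Coprime e) (hpe : p.Coprime e)
    (hpos : 0 < p ^ f - 1) :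
    (p.digits (m * c)).sum = (p.digits ((m * c + h) % (p ^ f - 1))).sum ↔
      ({i ∈ Finset.range f | 2 * (p ^ i * c % e) < e} : Finset ℕ).card =
        ({i ∈ Finset.range f | e < 2 * (p ^ i * c % e)} : Finset ℕ).card := by
  set n := p ^ f - 1 with hn
  have hm0 : 0 < m := Nat.pos_of_mul_pos_right (hm ▸ hpos)
  have ha : m * c < n := by rw [hm]; exact Nat.mul_lt_mul_of_pos_left hc hm0
  have h1 := sub_one_mul_sum_pow_mul_mod hp ha
  have h2 := sub_one_mul_sum_pow_mul_mod hp (Nat.mod_lt (m * c + h) hpos)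
  rw [← hn] at h1 h2
  set A := (p.digits (m * c)).sum
  set B := (p.digits ((m * c + h) % n)).sum
  have hp1 : 0 < p - 1 := by omega
  have hAB : A = B ↔ ∑ i ∈ Finset.range f, (p ^ i * (m * c) % n) =
      ∑ i ∈ Finset.range f, (p ^ i * ((m * c + h) % n) % n) := by
    constructor
    · intro hAB
      rw [hAB, ← h2] at h1
      exact Nat.eq_of_mul_eq_mul_left hp1 h1
    · intro hs
      rw [hs, h2] at h1
      exact (Nat.eq_of_mul_eq_mul_left hpos h1).symm
  rw [hAB]
  -- A residue prime to e that equals e / 2 is 1, forcing e = 2.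
  have hne : ∀ i, 2 * (p ^ i * c % e) ≠ e := by
    intro i heq
    have hcop : (p ^ i * c).Coprime e := (hpe.pow_left i).mul_left hce
    have h3 : (p ^ i * c % e).Coprime e := (Nat.mod_modEq (p ^ i * c) e).gcd_eq.trans hcop
    have h4 : p ^ i * c % e ∣ e := ⟨2, by omega⟩
    have h5 := Nat.eq_one_of_dvd_coprimes h3 dvd_rfl h4
    omega
  -- The i-th rotation of m c is m r with r = p ^ i c mod e. Adding h = n / 2 to the number adds h
  -- to this rotation if r < e / 2 and subtracts h if r > e / 2.
  have hterm : ∀ i ∈ Finset.range f, (p ^ i * ((m * c + h) % n) % n) +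
      (if e < 2 * (p ^ i * c % e) then h else 0) =
      (p ^ i * (m * c) % n) + if 2 * (p ^ i * c % e) < e then h else 0 := by
    intro i _
    set r := p ^ i * c % e with hr
    have hre : r < e := Nat.mod_lt _ (by omega)
    have e1 : p ^ i * (m * c) % n = m * r := by
      rw [hm, mul_left_comm, Nat.mul_mod_mul_left]
    have e2 : p ^ i * ((m * c + h) % n) % n = (m * r + h) % n := by
      -- Since p ^ i is odd and 2 h = n.
      have h3 : p ^ i * h ≡ h [MOD n] := by
        obtain ⟨t, ht⟩ := hodd.pow (n := i)
        have : p ^ i * h = h + n * t := by rw [ht, hh]; ring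
        rw [this]
        simp [Nat.ModEq]
      have h4 : p ^ i * ((m * c + h) % n) ≡ p ^ i * (m * c) + p ^ i * h [MOD n] := by
        rw [← mul_add]
        exact (Nat.mod_modEq _ _).mul_left _
      have h5 : p ^ i * (m * c) ≡ m * r [MOD n] := by
        rw [← e1]; exact (Nat.mod_modEq _ _).symm
      exact h4.trans (h5.add h3)
    rw [e1, e2]
    have hmr : m * r < n := by rw [hm]; exact Nat.mul_lt_mul_of_pos_left hre hm0
    rcases lt_or_gt_of_ne (hne i) with hlt | hgt
    · rw [if_neg (by omega), if_pos hlt]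
      have : 2 * (m * r) < 2 * h := by
        rw [← hh, hm, mul_left_comm]; exact Nat.mul_lt_mul_of_pos_left hlt hm0
      rw [Nat.mod_eq_of_lt (by omega)]
      omega
    · rw [if_pos hgt, if_neg (by omega)]
      have : 2 * h < 2 * (m * r) := by
        rw [← hh, hm, mul_left_comm]; exact Nat.mul_lt_mul_of_pos_left hgt hm0
      rw [Nat.mod_eq_sub_mod (by omega), Nat.mod_eq_of_lt (by omega)]
      omega
  have hsum := Finset.sum_congr rfl hterm
  rw [Finset.sum_add_distrib, Finset.sum_add_distrib, ← Finset.sum_filter, ← Finset.sum_filter,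
    Finset.sum_const, Finset.sum_const, smul_eq_mul, smul_eq_mul] at hsum
  have hh0 : 0 < h := by omega
  constructor
  · intro hs
    rw [hs] at hsum
    exact (Nat.eq_of_mul_eq_mul_right hh0 (Nat.add_left_cancel hsum)).symm
  · intro hs
    rw [hs] at hsum
    exact (Nat.add_right_cancel hsum).symm

theorem ncard_zpowers_inter {G : Type*} [Group G] [Finite G] (u : G)
    (P : G → Prop) [DecidablePred P] :
    ((Subgroup.zpowers u : Set G) ∩ {x | P x}).ncard =
      ({i ∈ Finset.range (orderOf u) | P (u ^ i)} : Finset ℕ).card := by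
  have h1 : (Subgroup.zpowers u : Set G) ∩ {x | P x} =
      (fun i : ℕ ↦ u ^ i) '' {i | i < orderOf u ∧ P (u ^ i)} := by
    ext x
    constructor
    · rintro ⟨hx, hPx⟩
      obtain ⟨i, hi⟩ := Submonoid.mem_powers_iff _ _ |>.1 (mem_powers_iff_mem_zpowers.2 hx)
      have hi' : u ^ (i % orderOf u) = x := by rw [pow_mod_orderOf, hi]
      exact ⟨i % orderOf u, ⟨Nat.mod_lt _ (orderOf_pos u), by
        rw [hi']; exact hPx⟩, hi'⟩
    · rintro ⟨i, ⟨-, hi⟩, rfl⟩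
      exact ⟨Subgroup.npow_mem_zpowers u i, hi⟩
  rw [h1, Set.InjOn.ncard_image, ← Set.ncard_coe_finset]
  · congr 1
    ext i
    simp
  · intro i hi j hj h
    exact pow_injOn_Iio_orderOf hi.1 hj.1 h

/-- As i runs below f, the powers u ^ i cover the cyclic group f / orderOf u times. -/
theorem card_filter_range_pow {G : Type*} [Group G] [Finite G] (u : G) {f : ℕ} (hf : u ^ f = 1)
    (P : G → Prop) [DecidablePred P] :
    ({i ∈ Finset.range f | P (u ^ i)} : Finset ℕ).card =
      f / orderOf u * ((Subgroup.zpowers u : Set G) ∩ {x | P x}).ncard := by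
  obtain ⟨m, hm⟩ := orderOf_dvd_of_pow_eq_one hf
  rw [ncard_zpowers_inter, hm, Nat.mul_div_cancel_left _ (orderOf_pos u)]
  have hu : u ^ orderOf u = 1 := pow_orderOf_eq_one u
  clear hm hf
  generalize orderOf u = r at *
  simp only [Finset.card_filter]
  induction m with
  | zero => simp
  | succ m ih =>
    rw [Nat.mul_succ, Finset.sum_range_add, ih, Nat.succ_mul]
    congr 1
    refine Finset.sum_congr rfl fun i _ ↦ ?_
    rw [pow_add, pow_mul, hu, one_pow, one_mul]

end Balanced

/-! ### Galois conjugates of Jacobi sums, their absolute values and their residues modulo 4. -/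

section Conjugates

theorem MulChar.orderOf_apply_generator {L R : Type*} [Field L] [CommRing R] {g : Lˣ}
    (hg : ∀ x, x ∈ Subgroup.zpowers g) (ψ : MulChar L R) : orderOf (ψ g) = orderOf ψ := by
  rw [orderOf_eq_orderOf_iff]
  intro n
  rw [MulChar.eq_iff hg, MulChar.pow_apply_coe, MulChar.one_apply_coe]

theorem MulChar.orderOf_ringHomComp {L R R' : Type*} [Field L] [CommRing R] [CommRing R']
    {f : R →+* R'} (hf : Function.Injective f) (ψ : MulChar L R) :
    orderOf (ψ.ringHomComp f) = orderOf ψ := by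
  rw [orderOf_eq_orderOf_iff]
  intro n
  rw [MulChar.ringHomComp_pow, MulChar.ringHomComp_eq_one_iff hf]

theorem exists_cyclotomic_numberField (e : ℕ) [NeZero e] :
    ∃ (K : Type) (_ : Field K) (_ : NumberField K), IsCyclotomicExtension {e} ℚ K := by
  have : NeZero ((e : ℕ) : ℚ) := ⟨by exact_mod_cast NeZero.ne e⟩
  refine ⟨CyclotomicField e ℚ, inferInstance, inferInstance, ?_⟩
  convert CyclotomicField.isCyclotomicExtension e ℚ
  · rfl
  · exact Subsingleton.elim (α := Algebra ℚ (CyclotomicField e ℚ)) _ _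

/-- The complex characters of a given order are the conjugates of a character with values in a
number field; so are the squares of their Jacobi sums with the quadratic character. -/
theorem exists_jacobiSum_conjugates {L : Type*} [Field L] [Fintype L] {e : ℕ} [NeZero e]
    (he : e ∣ Fintype.card L - 1) :
    ∃ (K : Type) (_ : Field K) (_ : NumberField K) (ψ : MulChar L K) (J : K), orderOf ψ = e ∧
      (∀ σ : K →+* ℂ, σ J = jacobiSum (ψ.ringHomComp σ) (quadChar L)) ∧
      ∀ ψ' : MulChar L ℂ, orderOf ψ' = e →
        ∃ σ : K →ₐ[ℚ] ℂ, ψ' = ψ.ringHomComp σ.toRingHom := by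
  classical
  obtain ⟨K, _, _, _⟩ := exists_cyclotomic_numberField e
  obtain ⟨ζ, hζ⟩ : ∃ ζ : K, IsPrimitiveRoot ζ e := ⟨_, IsCyclotomicExtension.zeta_spec e ℚ K⟩
  obtain ⟨ψ, hψ⟩ := MulChar.exists_mulChar_orderOf L he hζ
  refine ⟨K, inferInstance, inferInstance, ψ, jacobiSum ψ ((quadraticChar L).ringHomComp (Int.castRingHom _)), hψ, ?_, ?_⟩
  · intro σ
    rw [← jacobiSum_ringHomComp]
    congr 1
    ext x
    rw [quadChar_apply, MulChar.ringHomComp_apply, MulChar.ringHomComp_apply, quadraticChar_apply,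
      quadraticCharFun]
    split_ifs <;> simp
  · intro ψ' hψ'
    obtain ⟨g, hg⟩ := IsCyclic.exists_generator (α := Lˣ)
    have h1 : IsPrimitiveRoot (ψ g) e :=
      IsPrimitiveRoot.iff_orderOf.2 ((MulChar.orderOf_apply_generator hg ψ).trans hψ)
    have h2 : IsPrimitiveRoot (ψ' g) e :=
      IsPrimitiveRoot.iff_orderOf.2 ((MulChar.orderOf_apply_generator hg ψ').trans hψ')
    have hirr := cyclotomic.irreducible_rat (NeZero.pos e)
    -- Both characters send a generator of Lˣ to primitive e-th roots of unity; irreducibility of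
    -- the cyclotomic polynomial supplies the embedding matching them.
    refine ⟨(h1.embeddingsEquivPrimitiveRoots ℂ hirr).symm
      ⟨ψ' g, (mem_primitiveRoots (NeZero.pos e)).2 h2⟩, (MulChar.eq_iff hg _ _).2 ?_⟩
    have h3 := h1.embeddingsEquivPrimitiveRoots_apply_coe ℂ hirr
      ((h1.embeddingsEquivPrimitiveRoots ℂ hirr).symm
        ⟨ψ' g, (mem_primitiveRoots (NeZero.pos e)).2 h2⟩)
    rw [Equiv.apply_symm_apply] at h3
    exact h3

/-- The norm is a rational integer of absolute value less than 1. -/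
theorem NumberField.eq_zero_of_forall_norm_lt {K : Type*} [Field K] [NumberField K] {x : K}
    (hx : IsIntegral ℤ x) (h : ∀ σ : K →ₐ[ℚ] ℂ, ‖σ x‖ < 1) : x = 0 := by
  have h1 := Algebra.isIntegral_norm (K := ℚ) hx
  obtain ⟨m, hm⟩ := IsIntegrallyClosed.isIntegral_iff.1 h1
  have h2 := Algebra.norm_eq_prod_embeddings ℚ ℂ x
  rw [← Algebra.norm_eq_zero_iff (R := ℚ), ← hm]
  have h3 : ‖(m : ℂ)‖ < 1 := by
    have h4 : (m : ℂ) = ∏ σ : K →ₐ[ℚ] ℂ, σ x := by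
      rw [← h2, ← hm]
      simp
    rw [h4, norm_prod]
    classical
    let σ₀ : K →ₐ[ℚ] ℂ := IsAlgClosed.lift
    rw [← Finset.mul_prod_erase _ _ (Finset.mem_univ σ₀)]
    exact mul_lt_one_of_nonneg_of_lt_one_left (norm_nonneg _) (h σ₀)
      (Finset.prod_le_one (fun _ _ ↦ norm_nonneg _) fun σ _ ↦ (h σ).le)
  rw [Complex.norm_intCast] at h3
  have h5 : m = 0 := by
    rw [← Int.abs_lt_one_iff]
    exact_mod_cast h3
  rw [h5]
  simp

theorem norm_jacobiSum_quadChar_sq {L : Type*} [Field L] [Fintype L] (h2 : (2 : L) ≠ 0)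
    {ψ : MulChar L ℂ} (hψ : ψ ^ 2 ≠ 1) : ‖jacobiSum ψ (quadChar L) ^ 2‖ = Fintype.card L := by
  have hψ1 : ψ ≠ 1 := fun h ↦ hψ (by rw [h, one_pow])
  have hψχ : ψ * quadChar L ≠ 1 := fun h ↦ hψ (by
    rw [eq_inv_of_mul_eq_one_left h, quadChar_inv, sq, quadChar_mul_quadChar])
  have hchar : ringChar ℂ ≠ ringChar L := by
    rw [ringChar.eq_zero]
    exact (CharP.ringChar_ne_zero_of_finite L).symm
  have h1 := jacobiSum_mul_jacobiSum_inv hchar hψ1 (quadChar_ne_one h2) hψχ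
  have h3 : jacobiSum ψ⁻¹ (quadChar L)⁻¹ = star (jacobiSum ψ (quadChar L)) := by
    simp only [jacobiSum, star_sum, star_mul', MulChar.star_apply']
  rw [h3] at h1
  have h4 := congrArg norm h1
  rw [norm_mul, norm_star, Complex.norm_natCast] at h4
  rw [norm_pow, sq, h4]

/-- Modulo `2` the Jacobi sum is `-1`, so that its square is `1` modulo `4`. -/
theorem jacobiSum_quadChar_sq_eq {L : Type*} [Field L] [Fintype L] {ψ : MulChar L ℂ}
    (hψ : ψ ≠ 1) : ∃ m : ℂ, IsIntegral ℤ m ∧ jacobiSum ψ (quadChar L) ^ 2 = 1 + 4 * m := by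
  classical
  -- Chosen so that χ(1 - x) = 1 + 2 c(x) for x ≠ 1; at x = 1 the character vanishes, which
  -- contributes -1 to the Jacobi sum.
  let c : L → ℂ := fun x ↦ if x = 1 then 0 else if IsSquare (1 - x) then 0 else -1
  have hc : ∀ x, IsIntegral ℤ (c x) := by
    intro x
    simp only [c]
    split_ifs
    exacts [isIntegral_zero, isIntegral_zero, isIntegral_one.neg]
  have h1 : ∀ x : L, ψ x * quadChar L (1 - x) =
      ψ x - (if x = 1 then 1 else 0) + 2 * (ψ x * c x) := by
    intro x
    rw [quadChar_apply]
    by_cases hx : x = 1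
    · simp [hx, c]
    · have : 1 - x ≠ 0 := sub_ne_zero.2 (Ne.symm hx)
      simp only [hx, this, c, if_false]
      split_ifs <;> ring
  set m := ∑ x, ψ x * c x with hm
  have hmi : IsIntegral ℤ m := IsIntegral.sum _ fun x _ ↦ (isIntegral_mulChar ψ x).mul (hc x)
  have h3 : jacobiSum ψ (quadChar L) = -1 + 2 * m := by
    rw [jacobiSum, Finset.sum_congr rfl fun x _ ↦ h1 x, Finset.sum_add_distrib,
      Finset.sum_sub_distrib, MulChar.sum_eq_zero_of_ne_one hψ, Finset.mul_sum]
    simp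
  refine ⟨m ^ 2 - m, (hmi.pow 2).sub hmi, ?_⟩
  rw [h3]
  ring

end Conjugates

/-! ### From valuations to the equality of the squared Jacobi sum and the cardinality. -/

section Main

variable {p : ℕ} {L : Type*} [Field L] [Fintype L]

/-- If the square of the Jacobi sum is divisible by the cardinality in the ring of algebraic
integers then they are equal. -/
theorem jacobiSum_sq_eq_card_of_valuation (hp : p.Prime) (hp2 : p ≠ 2) {f : ℕ}
    (hcard : Fintype.card L = p ^ f) (hf : Even f)
    {ψ : MulChar L ℂ} (hψ : 2 < orderOf ψ)
    (hV : ∀ V : ValuationSubring ℂ, V.valuation (p : ℂ) < 1 →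
      V.valuation (jacobiSum ψ (quadChar L) ^ 2) = V.valuation (Fintype.card L : ℂ)) :
    jacobiSum ψ (quadChar L) ^ 2 = Fintype.card L := by
  classical
  have hodd := hp.odd_of_ne_two hp2
  have h2 : (2 : L) ≠ 0 := by
    have h := FiniteField.odd_card_of_char_ne_two (F := L)
    intro h0
    have h3 := FiniteField.even_card_of_char_two (F := L)
      (CharP.ringChar_of_prime_eq_zero Nat.prime_two (by exact_mod_cast h0))
    rw [hcard] at h3
    have := Nat.odd_iff.1 (hodd.pow (n := f))
    omega
  have : NeZero (orderOf ψ) := ⟨by omega⟩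
  have hdvd : orderOf ψ ∣ Fintype.card L - 1 := by
    rw [← Fintype.card_units]
    exact orderOf_dvd_of_pow_eq_one (MulChar.pow_card_eq_one ψ)
  have hsq : ∀ ψ' : MulChar L ℂ, orderOf ψ' = orderOf ψ → ψ' ^ 2 ≠ 1 := fun ψ' h h' ↦ by
    have := Nat.le_of_dvd two_pos (orderOf_dvd_of_pow_eq_one h')
    omega
  obtain ⟨K, _, _, ψ₀, J, hψ₀, hJ, hconj⟩ := exists_jacobiSum_conjugates hdvd
  obtain ⟨σ₀, hσ₀⟩ := hconj ψ rfl
  have hQ0 : (Fintype.card L : ℂ) ≠ 0 := by exact_mod_cast Fintype.card_ne_zero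
  have hσJ : σ₀ J = jacobiSum ψ (quadChar L) :=
    (hJ σ₀.toRingHom).trans (congrArg (jacobiSum · (quadChar L)) hσ₀.symm)
  -- The cardinality is the square of an odd number because f is even.
  have hQ4 : ∃ k : ℕ, Fintype.card L = 1 + 4 * k := by
    obtain ⟨r, hr⟩ := hf
    obtain ⟨s, hs⟩ := hodd.pow (n := r)
    refine ⟨s ^ 2 + s, ?_⟩
    rw [hcard, hr, pow_add, hs]
    ring
  obtain ⟨k, hk⟩ := hQ4
  obtain ⟨m, hm, hmJ⟩ := jacobiSum_quadChar_sq_eq (L := L) (ψ := ψ) (by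
    rintro rfl
    simp at hψ)
  -- Dividing by the extra factor 4 makes every conjugate at most 2Q / (4Q) = 1/2 in absolute value.
  -- Without it one would only learn that J² / Q is a root of unity.
  set y : K :=
    (J ^ 2 - (Fintype.card L : ℕ)) / (4 * (Fintype.card L : ℕ)) with hy
  have hσy : ∀ σ : K →ₐ[ℚ] ℂ,
      σ y = (σ J ^ 2 - Fintype.card L) / (4 * Fintype.card L) := by
    intro σ
    rw [hy, map_div₀, map_sub, map_mul, map_pow, map_natCast, map_ofNat]
  -- Integrality is checked at each valuation ring. Above p, the quotient J² / Q is a unit by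
  -- hypothesis and so is 2; elsewhere Q is a unit and J² ≡ 1 ≡ Q modulo 4.
  have hyi : IsIntegral ℤ (σ₀ y) := by
    refine isIntegral_of_forall_mem_valuationSubring fun V ↦ ?_
    rw [hσy, hσJ]
    rcases (V.valuation_natCast_le p).lt_or_eq with hlt | heq
    · have hV1 := hV V hlt
      have hv2 : V.valuation (2 : ℂ) = 1 := by
        refine le_antisymm (by exact_mod_cast V.valuation_natCast_le 2) ?_
        by_contra! hcon
        obtain ⟨r, hr⟩ := hodd
        have h3 : (1 : ℂ) = p - 2 * r := by rw [hr]; push_cast; ring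
        have h4 : V.valuation (1 : ℂ) < 1 := by
          rw [h3]
          refine (V.valuation.map_sub _ _).trans_lt (max_lt hlt ?_)
          rw [map_mul]
          exact (mul_le_of_le_one_right' (V.valuation_natCast_le r)).trans_lt hcon
        rw [map_one] at h4
        exact lt_irrefl _ h4
      rw [← V.valuation_le_one_iff]
      have h5 : (jacobiSum ψ (quadChar L) ^ 2 - (Fintype.card L : ℂ)) / (4 * Fintype.card L) =
          (jacobiSum ψ (quadChar L) ^ 2 / Fintype.card L - 1) / 2 ^ 2 := by
        field_simp
        norm_num
      rw [h5, map_div₀, map_pow, hv2, one_pow, div_one]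
      refine (V.valuation.map_sub _ _).trans (max_le ?_ (by rw [map_one]))
      rw [map_div₀, hV1, div_self ((_root_.map_ne_zero _).2 hQ0)]
    · have h5 : (jacobiSum ψ (quadChar L) ^ 2 - (Fintype.card L : ℂ)) / (4 * Fintype.card L) =
          (m - k) / p ^ f := by
        rw [hmJ]
        have : (Fintype.card L : ℂ) = p ^ f := by exact_mod_cast hcard
        rw [← this]
        field_simp
        rw [hk]
        push_cast
        ring
      rw [h5, ← V.valuation_le_one_iff, map_div₀, map_pow, heq, one_pow, div_one,
        V.valuation_le_one_iff]
      exact V.mem_of_isIntegral (hm.sub (isIntegral_natCast k))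
  have hyi' : IsIntegral ℤ y := (isIntegral_algHom_iff (σ₀.restrictScalars ℤ) σ₀.injective).1 hyi
  have hy0 : y = 0 := by
    refine NumberField.eq_zero_of_forall_norm_lt hyi' fun σ ↦ ?_
    have h6 := norm_jacobiSum_quadChar_sq h2 (hsq (ψ₀.ringHomComp σ.toRingHom) (by
      rw [MulChar.orderOf_ringHomComp σ.injective, hψ₀]))
    have h7 : σ J = jacobiSum (ψ₀.ringHomComp σ.toRingHom) (quadChar L) := hJ σ.toRingHom
    rw [hσy, norm_div, h7]
    have hQpos : (0 : ℝ) < Fintype.card L := by exact_mod_cast Fintype.card_pos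
    have h8 := norm_sub_le (jacobiSum (ψ₀.ringHomComp σ.toRingHom) (quadChar L) ^ 2)
      (Fintype.card L : ℂ)
    rw [h6, Complex.norm_natCast] at h8
    rw [norm_mul, Complex.norm_natCast, Complex.norm_ofNat, div_lt_one (by positivity)]
    linarith
  have h9 := hσy σ₀
  rw [hy0, map_zero, hσJ, eq_comm, div_eq_zero_iff] at h9
  rcases h9 with h9 | h9
  · exact sub_eq_zero.1 h9
  · exact absurd h9 (mul_ne_zero (by norm_num) hQ0)

/-- Characters of the same order are Galois conjugate and |L| is rational, so the equation is
transported by an embedding. -/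
theorem jacobiSum_sq_eq_card_conjugate {ψ ψ' : MulChar L ℂ} (h : orderOf ψ = orderOf ψ')
    (hJ : jacobiSum ψ (quadChar L) ^ 2 = Fintype.card L) :
    jacobiSum ψ' (quadChar L) ^ 2 = Fintype.card L := by
  classical
  have hdvd : orderOf ψ ∣ Fintype.card L - 1 := by
    rw [← Fintype.card_units]
    exact orderOf_dvd_of_pow_eq_one (MulChar.pow_card_eq_one ψ)
  have : NeZero (orderOf ψ) := ⟨by
    have : 0 < Fintype.card L - 1 := Nat.sub_pos_of_lt Fintype.one_lt_card
    rintro h0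
    rw [h0, zero_dvd_iff] at hdvd
    omega⟩
  obtain ⟨K, _, _, ψ₀, J, hψ₀, hσJ, hconj⟩ := exists_jacobiSum_conjugates hdvd
  obtain ⟨σ, hσ⟩ := hconj ψ rfl
  obtain ⟨σ', hσ'⟩ := hconj ψ' h.symm
  have h1 : J ^ 2 = (Fintype.card L : ℕ) := by
    apply σ.toRingHom.injective
    rw [map_pow, hσJ, ← hσ, hJ, map_natCast]
  have h2 := congrArg σ'.toRingHom h1
  rwa [map_pow, hσJ, ← hσ', map_natCast] at h2

end Main

/-! ### The criterion in terms of balanced subgroups. -/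

section BalancedJacobi

theorem ZMod.val_pow_mul_unit {p e c : ℕ} (u g : (ZMod e)ˣ) (hu : (u : ZMod e) = p)
    (hg : (g : ZMod e) = c) (i : ℕ) : ((g * u ^ i : (ZMod e)ˣ) : ZMod e).val = p ^ i * c % e := by
  rw [Units.val_mul, Units.val_pow_eq_pow_val, hu, hg, mul_comm, ← ZMod.val_natCast]
  push_cast
  rfl

theorem Set.ncard_image_mul_inter {G : Type*} [Group G] (g : G) (H S : Set G) :
    (((fun x ↦ g * x) '' H) ∩ S).ncard = (H ∩ {x | g * x ∈ S}).ncard := by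
  rw [show H ∩ {x | g * x ∈ S} = H ∩ (fun x ↦ g * x) ⁻¹' S from rfl, ← Set.image_inter_preimage,
    Set.InjOn.ncard_image ((mul_right_injective g).injOn)]

theorem card_filter_lower {p e c f : ℕ} (he : 1 < e) (u g : (ZMod e)ˣ) (hu : (u : ZMod e) = p)
    (hg : (g : ZMod e) = c) (hf : u ^ f = 1) :
    ({i ∈ Finset.range f | 2 * (p ^ i * c % e) < e} : Finset ℕ).card = f / orderOf u *
      (((fun x ↦ g * x) '' (Subgroup.zpowers u : Set (ZMod e)ˣ)) ∩ lowerUnits e).ncard := by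
  classical
  have : NeZero e := ⟨by omega⟩
  have : Fact (1 < e) := ⟨he⟩
  have h1 : ((fun x ↦ g * x) '' (Subgroup.zpowers u : Set (ZMod e)ˣ) ∩ lowerUnits e).ncard =
      ((Subgroup.zpowers u : Set (ZMod e)ˣ) ∩
        {x | 2 * ((g * x : (ZMod e)ˣ) : ZMod e).val < e}).ncard := by
    rw [Set.ncard_image_mul_inter]
    congr 2
    ext x
    simp only [lowerUnits, Set.mem_ofPred_eq, and_iff_right_iff_imp]
    intro _
    rw [ZMod.val_pos]
    exact (g * x).ne_zero
  rw [h1, ← card_filter_range_pow u hf (fun x ↦ 2 * ((g * x : (ZMod e)ˣ) : ZMod e).val < e)]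
  simp only [ZMod.val_pow_mul_unit u g hu hg]

theorem card_filter_upper {p e c f : ℕ} (he : 1 < e) (u g : (ZMod e)ˣ) (hu : (u : ZMod e) = p)
    (hg : (g : ZMod e) = c) (hf : u ^ f = 1) :
    ({i ∈ Finset.range f | e < 2 * (p ^ i * c % e)} : Finset ℕ).card = f / orderOf u *
      (((fun x ↦ g * x) '' (Subgroup.zpowers u : Set (ZMod e)ˣ)) ∩ upperUnits e).ncard := by
  classical
  have : NeZero e := ⟨by omega⟩
  rw [Set.ncard_image_mul_inter]
  change _ = _ * ((Subgroup.zpowers u : Set (ZMod e)ˣ) ∩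
        {x | e < 2 * ((g * x : (ZMod e)ˣ) : ZMod e).val}).ncard
  rw [← card_filter_range_pow u hf (fun x ↦ e < 2 * ((g * x : (ZMod e)ˣ) : ZMod e).val)]
  simp only [ZMod.val_pow_mul_unit u g hu hg]

/-- Characters of order e are the η ^ (m c) with c prime to e, and at V the character of index c
tests precisely the coset of c modulo ⟨p⟩. -/
theorem exists_generator_jacobiSum_valuation {p : ℕ} (hp : p.Prime) (hp2 : p ≠ 2)
    {V : ValuationSubring ℂ} (hV : V.valuation (p : ℂ) < 1) (L : Type*) [Field L] [Fintype L]
    [CharP L p] {f e m : ℕ} (hf : Fintype.card L = p ^ f) (hm : p ^ f - 1 = m * e) (he : 2 < e)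
    (u : (ZMod e)ˣ) (hu : (u : ZMod e) = p) :
    ∃ η : MulChar L ℂ, (∀ ψ, orderOf ψ = e → ∃ c < e, c.Coprime e ∧ ψ = η ^ (m * c)) ∧
      ∀ c < e, c.Coprime e → orderOf (η ^ (m * c)) = e ∧ ∀ g : (ZMod e)ˣ, (g : ZMod e) = c →
        (V.valuation (jacobiSum (η ^ (m * c)) (quadChar L) ^ 2) =
          V.valuation (Fintype.card L : ℂ) ↔
        (((fun x ↦ g * x) '' (Subgroup.zpowers u : Set (ZMod e)ˣ)) ∩ lowerUnits e).ncard =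
        (((fun x ↦ g * x) '' (Subgroup.zpowers u : Set (ZMod e)ˣ)) ∩ upperUnits e).ncard) := by
  have hpos : 0 < p ^ f - 1 := by
    rw [← hf]
    exact Nat.sub_pos_of_lt Fintype.one_lt_card
  have hodd := hp.odd_of_ne_two hp2
  obtain ⟨h, hh⟩ : ∃ h, p ^ f - 1 = 2 * h := by
    obtain ⟨h, hh⟩ := hodd.pow (n := f)
    exact ⟨h, by omega⟩
  have hn : Fintype.card L = (p ^ f - 1) + 1 := by omega
  have hm0 : 0 < m := Nat.pos_of_mul_pos_right (hm ▸ hpos)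
  have hpe : p.Coprime e := by
    rw [← ZMod.isUnit_iff_coprime, ← hu]
    exact u.isUnit
  have : NeZero e := ⟨by omega⟩
  have huf : u ^ f = 1 := by
    refine Units.ext ?_
    rw [Units.val_pow_eq_pow_val, hu, Units.val_one]
    have h1 : p ^ f = m * e + 1 := by omega
    have h2 := congrArg (Nat.cast : ℕ → ZMod e) h1
    push_cast at h2
    simpa using h2
  obtain ⟨η, hord, hall, hval⟩ := exists_mulChar_jacobiSum_valuation hp hp2 hV L hn hh
  have hordc : ∀ c, c.Coprime e → orderOf (η ^ (m * c)) = e := by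
    intro c hc
    rw [orderOf_pow, hord, hm, Nat.gcd_mul_left, Nat.gcd_comm, hc.gcd_eq_one, mul_one,
      Nat.mul_div_cancel_left _ hm0]
  refine ⟨η, ?_, ?_⟩
  · intro ψ hψ
    obtain ⟨a, ha, rfl⟩ := hall ψ
    rw [orderOf_pow, hord] at hψ
    have h1 : (p ^ f - 1).gcd a = m := by
      have h2 := Nat.div_mul_cancel (Nat.gcd_dvd_left (p ^ f - 1) a)
      rw [hψ] at h2
      refine Nat.eq_of_mul_eq_mul_left (by omega : 0 < e) ?_
      rw [h2, hm, mul_comm]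
    obtain ⟨c, rfl⟩ : m ∣ a := h1 ▸ Nat.gcd_dvd_right _ _
    rw [hm, Nat.gcd_mul_left] at h1
    refine ⟨c, ?_, ?_, rfl⟩
    · rw [hm] at ha
      exact lt_of_mul_lt_mul_left ha hm0.le
    · rw [Nat.coprime_comm]
      exact Nat.eq_of_mul_eq_mul_left hm0 (by rw [h1, mul_one])
  · intro c hce hc
    refine ⟨hordc c hc, fun g hg ↦ ?_⟩
    have hlt : m * c < p ^ f - 1 := by rw [hm]; exact Nat.mul_lt_mul_of_pos_left hce hm0
    rw [hval _ hlt, digits_sum_eq_iff hp.one_lt hodd hm hh he hce hc hpe hpos,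
      card_filter_lower (by omega) u g hu hg huf, card_filter_upper (by omega) u g hu hg huf]
    · have hf0 : 0 < f := Nat.pos_of_ne_zero fun h0 ↦ by simp [h0] at hpos
      have : 0 < f / orderOf u := Nat.div_pos
        (Nat.le_of_dvd hf0 (orderOf_dvd_of_pow_eq_one huf)) (orderOf_pos u)
      exact Nat.mul_right_inj this.ne'
    · intro h1
      have := Nat.le_of_dvd two_pos (orderOf_dvd_of_pow_eq_one h1)
      rw [hordc c hc] at this
      omega

/-- The subgroup itself is one of the cosets, and it is split into two halves of equal size. The
evenness makes |L| a square, as needed for the congruence modulo 4. -/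
theorem even_of_isBalancedSubgroup {e : ℕ} (he : 2 < e) (u : (ZMod e)ˣ)
    (hb : IsBalancedSubgroup (Subgroup.zpowers u)) : Even (orderOf u) := by
  have : NeZero e := ⟨by omega⟩
  have : Fact (1 < e) := ⟨by omega⟩
  have h1 := hb 1
  simp only [one_mul, Set.image_id'] at h1
  have h2 : (Subgroup.zpowers u : Set (ZMod e)ˣ) =
      ((Subgroup.zpowers u : Set (ZMod e)ˣ) ∩ lowerUnits e) ∪
        ((Subgroup.zpowers u : Set (ZMod e)ˣ) ∩ upperUnits e) := by
    rw [← Set.inter_union_distrib_left, eq_comm, Set.inter_eq_left]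
    intro x _
    have hx0 : 0 < (x : ZMod e).val := by
      rw [ZMod.val_pos]
      exact x.ne_zero
    rcases lt_trichotomy (2 * (x : ZMod e).val) e with h | h | h
    · exact Or.inl ⟨hx0, h⟩
    · have h3 := ZMod.val_coe_unit_coprime x
      have h4 : (x : ZMod e).val ∣ e := ⟨2, by omega⟩
      have h5 := Nat.eq_one_of_dvd_coprimes h3 dvd_rfl h4
      omega
    · exact Or.inr h
  have h3 := congrArg Set.ncard h2
  rw [Set.ncard_union_eq, h1, ← Nat.card_coe_set_eq, SetLike.coe_sort_coe, Nat.card_zpowers] at h3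
  · exact ⟨_, h3⟩
  · rw [Set.disjoint_left]
    rintro x ⟨-, h⟩ ⟨-, h'⟩
    exact absurd (h.2.trans h') (lt_irrefl _)

/-- The square of the Jacobi sum of a character of order `e > 2` with the quadratic character is
the cardinality of the field if and only if the characteristic is balanced modulo `e`. -/
theorem jacobiSum_sq_eq_card_iff {p : ℕ} (hp : p.Prime) (hp2 : p ≠ 2) {L : Type*} [Field L]
    [Fintype L] [CharP L p] {ψ : MulChar L ℂ} (hψ : 2 < orderOf ψ) :
    jacobiSum ψ (quadChar L) ^ 2 = Fintype.card L ↔ IsBalancedMod p (orderOf ψ) := by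
  classical
  obtain ⟨f, -, hf⟩ := FiniteField.card L p
  set e := orderOf ψ with he
  have hdvd : e ∣ p ^ (f : ℕ) - 1 := by
    rw [← hf, ← Fintype.card_units]
    exact orderOf_dvd_of_pow_eq_one (MulChar.pow_card_eq_one ψ)
  obtain ⟨m, hm⟩ := hdvd
  rw [mul_comm] at hm
  have : NeZero e := ⟨by omega⟩
  have hf1 : 0 < p ^ (f : ℕ) := pow_pos hp.pos _
  have hpe : p.Coprime e := by
    refine Nat.Coprime.coprime_dvd_right ⟨m, rfl⟩ (?_ : p.Coprime (e * m))
    rw [mul_comm, ← hm]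
    have h1 : (p ^ (f : ℕ)).Coprime (p ^ (f : ℕ) - 1) :=
      ((Nat.coprime_self_sub_right (by omega)).2 (Nat.coprime_one_right _))
    exact h1.coprime_dvd_left (dvd_pow_self p f.ne_zero)
  let u := ZMod.unitOfCoprime p hpe
  have hu : (u : ZMod e) = p := ZMod.coe_unitOfCoprime p hpe
  constructor
  · intro hJ
    refine ⟨u, hu, fun g ↦ ?_⟩
    -- One valuation suffices here: the equality holds for all characters of order e, and these
    -- reach every coset.
    obtain ⟨V, hV⟩ := exists_valuationSubring_lt_one hp
    obtain ⟨η, -, h2⟩ := exists_generator_jacobiSum_valuation hp hp2 hV L hf hm hψ u hu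
    obtain ⟨h3, h4⟩ := h2 (g : ZMod e).val (ZMod.val_lt _) (ZMod.val_coe_unit_coprime g)
    refine (h4 g (ZMod.natCast_zmod_val _).symm).1 ?_
    rw [jacobiSum_sq_eq_card_conjugate (he.symm.trans h3.symm) hJ]
  · rintro ⟨u', hu', hb⟩
    obtain rfl : u' = u := Units.ext (hu'.trans hu.symm)
    refine jacobiSum_sq_eq_card_of_valuation hp hp2 hf ?_ hψ fun V hV ↦ ?_
    · refine (even_of_isBalancedSubgroup hψ u hb).trans_dvd (orderOf_dvd_of_pow_eq_one ?_)
      refine Units.ext ?_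
      rw [Units.val_pow_eq_pow_val, hu, Units.val_one]
      have h1 : p ^ (f : ℕ) = m * e + 1 := by omega
      have h2 := congrArg (Nat.cast : ℕ → ZMod e) h1
      push_cast at h2
      simpa using h2
    -- The index c of ψ relative to η depends on V, so balance on every coset is used.
    · obtain ⟨η, h1, h2⟩ := exists_generator_jacobiSum_valuation hp hp2 hV L hf hm hψ u hu
      obtain ⟨c, hce, hc, hc'⟩ := h1 ψ rfl
      have h3 := (h2 c hce hc).2 (ZMod.unitOfCoprime c hc) (ZMod.coe_unitOfCoprime c hc)
      rw [← hc'] at h3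
      exact h3.2 (hb _)

end BalancedJacobi

/-! ### Finite subfields as fixed points of Frobenius. -/

section FixedByFrobenius

/-- The elements of a finite subfield are the solutions of `z ^ q = z`. -/
theorem exists_algebraMap_eq_of_pow_card {L A : Type*} [Field L] [Finite L] [Field A] [Algebra L A]
    {z : A} (hz : z ^ Nat.card L = z) : ∃ x : L, algebraMap L A x = z := by
  classical
  let := Fintype.ofFinite L
  rw [Nat.card_eq_fintype_card] at hz
  have h1 : (X ^ Fintype.card L - X : A[X]) ≠ 0 :=
    FiniteField.X_pow_card_sub_X_ne_zero A Fintype.one_lt_card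
  have h2 : (Finset.univ.image (algebraMap L A)) ⊆ (X ^ Fintype.card L - X : A[X]).roots.toFinset := by
    intro y hy
    obtain ⟨x, -, rfl⟩ := Finset.mem_image.1 hy
    rw [Multiset.mem_toFinset, mem_roots h1, IsRoot, eval_sub, eval_pow, eval_X, ← map_pow,
      FiniteField.pow_card, sub_self]
  have h3 : (X ^ Fintype.card L - X : A[X]).roots.toFinset.card ≤
      (Finset.univ.image (algebraMap L A)).card := by
    rw [Finset.card_image_of_injective _ (algebraMap L A).injective, Finset.card_univ]
    refine (Multiset.toFinset_card_le _).trans ((card_roots' _).trans ?_)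
    rw [FiniteField.X_pow_card_sub_X_natDegree_eq A Fintype.one_lt_card]
  have h4 := Finset.eq_of_subset_of_card_le h2 h3
  have h5 : z ∈ (X ^ Fintype.card L - X : A[X]).roots.toFinset := by
    rw [Multiset.mem_toFinset, mem_roots h1, IsRoot, eval_sub, eval_pow, eval_X, hz, sub_self]
  rw [← h4] at h5
  obtain ⟨x, -, hx⟩ := Finset.mem_image.1 h5
  exact ⟨x, hx⟩

end FixedByFrobenius

/-! ### Power residue characters indexed by ℤ/d, uniformly over all finite extensions. -/

section KummerCharacter

variable {A : Type*} [Field A] {d : ℕ} (ℓ : rootsOfUnity d A ≃* Multiplicative (ZMod d))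
  {L : Type*} [Field L] [Algebra L A]

/-- Two d-th roots of the same element differ by a d-th root of unity ω, which changes the s-th
power by ω ^ s; an index c with s c = 0 does not see this. -/
theorem kummer_mul_eq {c : ZMod d} {s : ℕ} (hc : (s : ZMod d) * c = 0) {y₁ y₂ : Aˣ}
    (h : y₁ ^ d = y₂ ^ d) {ζ₁ ζ₂ : rootsOfUnity d A} (h₁ : (ζ₁ : Aˣ) = y₁ ^ s)
    (h₂ : (ζ₂ : Aˣ) = y₂ ^ s) : c * (ℓ ζ₁).toAdd = c * (ℓ ζ₂).toAdd := by
  let ω : rootsOfUnity d A := ⟨y₁ * y₂⁻¹, by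
    rw [mem_rootsOfUnity, mul_pow, inv_pow, h, mul_inv_cancel]⟩
  have h3 : ζ₁ = ζ₂ * ω ^ s := by
    refine Subtype.ext ?_
    change (ζ₁ : Aˣ) = ζ₂ * (y₁ * y₂⁻¹) ^ s
    rw [h₁, h₂, mul_pow, inv_pow, mul_comm, inv_mul_cancel_right]
  rw [h3, map_mul, map_pow, toAdd_mul, toAdd_pow, mul_add, nsmul_eq_mul, ← mul_assoc c,
    mul_comm c (s : ZMod d), hc, zero_mul, add_zero]

theorem natCast_card_sub_one_mul [Finite L] {c : ZMod d} (hc : ((Nat.card L : ℕ) : ZMod d) * c = c) :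
    ((Nat.card L - 1 : ℕ) : ZMod d) * c = 0 := by
  rw [Nat.cast_sub Nat.card_pos, sub_mul, hc, Nat.cast_one, one_mul, sub_self]

theorem pow_card_sub_one_mul_mem {x : Lˣ} {y : Aˣ}
    (hy : y ^ d = Units.map (algebraMap L A).toMonoidHom x) :
    y ^ (Nat.card L - 1) ∈ rootsOfUnity d A := by
  rw [mem_rootsOfUnity, ← pow_mul, mul_comm, pow_mul, hy, ← map_pow, ← Nat.card_units,
    pow_card_eq_one', map_one]

variable [IsAlgClosed A] [Finite L] [NeZero d]

theorem exists_unit_pow_eq {A : Type*} [Field A] [IsAlgClosed A] {n : ℕ} (hn : n ≠ 0) (z : Aˣ) : ∃ y : Aˣ, y ^ n = z := by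
  obtain ⟨y, hy⟩ := IsAlgClosed.exists_pow_nat_eq (z : A) (Nat.pos_of_ne_zero hn)
  have hy0 : y ≠ 0 := by
    rintro rfl
    rw [zero_pow hn] at hy
    exact z.ne_zero hy.symm
  exact ⟨Units.mk0 y hy0, Units.ext (by simpa using hy)⟩

/-- The Kummer symbol: take y with y ^ d = x and apply c to the root of unity y ^ (Q-1) = Frob(y) /
y. The condition Q c = c makes the result independent of the choice of y. -/
theorem exists_kummerChar {c : ZMod d} (hc : ((Nat.card L : ℕ) : ZMod d) * c = c) :
    ∃ ψ : MulChar L ℂ, ∀ (x : Lˣ) (y : Aˣ) (ζ : rootsOfUnity d A),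
      y ^ d = Units.map (algebraMap L A).toMonoidHom x → (ζ : Aˣ) = y ^ (Nat.card L - 1) →
      ψ x = ZMod.stdAddChar (c * (ℓ ζ).toAdd) := by
  have hc' := natCast_card_sub_one_mul hc
  choose y hy using fun x : Lˣ ↦ exists_unit_pow_eq (NeZero.ne d)
    (Units.map (algebraMap L A).toMonoidHom x)
  let ζ : Lˣ → rootsOfUnity d A := fun x ↦ ⟨y x ^ (Nat.card L - 1), pow_card_sub_one_mul_mem (hy x)⟩
  let g : Lˣ →* ℂ :=
    { toFun := fun x ↦ ZMod.stdAddChar (c * (ℓ (ζ x)).toAdd)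
      map_one' := by
        rw [kummer_mul_eq ℓ hc' (y₁ := y 1) (y₂ := 1) (ζ₂ := 1), map_one, toAdd_one, mul_zero,
          AddChar.map_zero_eq_one]
        · rw [hy, map_one, one_pow]
        · rfl
        · simp
      map_mul' := fun x x' ↦ by
        rw [kummer_mul_eq ℓ hc' (y₁ := y (x * x')) (y₂ := y x * y x') (ζ₂ := ζ x * ζ x'),
          map_mul ℓ, toAdd_mul, mul_add, AddChar.map_add_eq_mul]
        · rw [hy, mul_pow, hy, hy, map_mul]
        · rfl
        · rw [mul_pow]
          rfl }
  refine ⟨MulChar.ofUnitHom g.toHomUnits, fun x y' ζ' hy' hζ' ↦ ?_⟩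
  rw [MulChar.ofUnitHom_coe, MonoidHom.coe_toHomUnits]
  change ZMod.stdAddChar (c * (ℓ (ζ x)).toAdd) = _
  rw [kummer_mul_eq ℓ hc' ((hy x).trans hy'.symm) rfl hζ']

variable (L) in
open Classical in
/-- The character of a finite field `L` with values in the `d`-th roots of unity, obtained by
composing the `d`-th power residue symbol with the `c`-th power map. -/
noncomputable def kummerChar (c : ZMod d) : MulChar L ℂ :=
  if hc : ((Nat.card L : ℕ) : ZMod d) * c = c then (exists_kummerChar ℓ hc).choose else 1

theorem kummerChar_apply {c : ZMod d} (hc : ((Nat.card L : ℕ) : ZMod d) * c = c) {x : Lˣ} {y : Aˣ}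
    {ζ : rootsOfUnity d A} (hy : y ^ d = Units.map (algebraMap L A).toMonoidHom x)
    (hζ : (ζ : Aˣ) = y ^ (Nat.card L - 1)) :
    kummerChar ℓ L c x = ZMod.stdAddChar (c * (ℓ ζ).toAdd) := by
  rw [kummerChar, dif_pos hc]
  exact (exists_kummerChar ℓ hc).choose_spec x y ζ hy hζ

theorem kummerChar_pow {c : ZMod d} (hc : ((Nat.card L : ℕ) : ZMod d) * c = c) (k : ℕ) :
    kummerChar ℓ L c ^ k = kummerChar ℓ L (k * c) := by
  ext x
  obtain ⟨y, hy⟩ := exists_unit_pow_eq (NeZero.ne d) (Units.map (algebraMap L A).toMonoidHom x)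
  rw [MulChar.pow_apply_coe,
    kummerChar_apply ℓ hc hy (ζ := ⟨_, pow_card_sub_one_mul_mem hy⟩) rfl,
    kummerChar_apply ℓ (by rw [mul_left_comm, hc]) hy (ζ := ⟨_, pow_card_sub_one_mul_mem hy⟩) rfl,
    ← AddChar.map_nsmul_eq_pow, nsmul_eq_mul, mul_assoc]

/-- To detect c, choose y whose power y ^ (Q-1) is the root of unity corresponding to 1 under `ℓ`.
Then y ^ d is fixed by Frobenius and so comes from L, and the character takes the value
`ZMod.stdAddChar c` there. -/
theorem kummerChar_eq_one_iff {c : ZMod d} (hc : ((Nat.card L : ℕ) : ZMod d) * c = c) :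
    kummerChar ℓ L c = 1 ↔ c = 0 := by
  have hs : Nat.card L - 1 ≠ 0 := by
    have := Finite.one_lt_card (α := L)
    omega
  constructor
  · intro h
    obtain ⟨y, hy⟩ := exists_unit_pow_eq hs (ℓ.symm (Multiplicative.ofAdd 1) : Aˣ)
    obtain ⟨x, hx⟩ := exists_algebraMap_eq_of_pow_card (L := L) (z := ((y ^ d : Aˣ) : A)) (by
      have h1 : (y ^ d) ^ Nat.card L = y ^ d := by
        obtain ⟨m, hm⟩ : ∃ m, Nat.card L = m + 1 := ⟨_, (Nat.succ_pred_eq_of_pos Nat.card_pos).symm⟩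
        have h2 : (y ^ m) ^ d = 1 := by
          have h3 := (mem_rootsOfUnity d _).1 (ℓ.symm (Multiplicative.ofAdd 1)).2
          rwa [← hy, hm, Nat.add_sub_cancel] at h3
        rw [hm, pow_succ, ← pow_mul, mul_comm d, pow_mul, h2, one_mul]
      exact_mod_cast congrArg Units.val h1)
    have hx0 : x ≠ 0 := by
      rintro rfl
      rw [map_zero] at hx
      exact (y ^ d).ne_zero hx.symm
    have h4 := kummerChar_apply ℓ hc (x := Units.mk0 x hx0) (y := y)
      (ζ := ℓ.symm (Multiplicative.ofAdd 1)) (Units.ext (by simpa using hx.symm)) hy.symm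
    rw [h, MulChar.one_apply_coe, MulEquiv.apply_symm_apply, toAdd_ofAdd, mul_one,
      ← AddChar.map_zero_eq_one (ZMod.stdAddChar (N := d))] at h4
    exact (ZMod.injective_stdAddChar h4).symm
  · rintro rfl
    ext x
    obtain ⟨y, hy⟩ := exists_unit_pow_eq (NeZero.ne d) (Units.map (algebraMap L A).toMonoidHom x)
    rw [kummerChar_apply ℓ hc hy (ζ := ⟨_, pow_card_sub_one_mul_mem hy⟩) rfl, zero_mul,
      AddChar.map_zero_eq_one, MulChar.one_apply_coe]

theorem orderOf_kummerChar {c : ZMod d} (hc : ((Nat.card L : ℕ) : ZMod d) * c = c) :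
    orderOf (kummerChar ℓ L c) = addOrderOf c := by
  rw [← orderOf_ofAdd_eq_addOrderOf, orderOf_eq_orderOf_iff]
  intro k
  rw [kummerChar_pow ℓ hc, kummerChar_eq_one_iff ℓ (by rw [mul_left_comm, hc]), ← ofAdd_nsmul,
    ofAdd_eq_one, nsmul_eq_mul]

/-- The number of `d`-th roots of `t` as a sum of characters. -/
theorem card_pow_eq_sum_kummerChar [Fintype L] [DecidableEq L] {t : L} (ht : t ≠ 0) :
    (({u | u ^ d = t} : Finset L).card : ℂ) =
      ∑ c : ZMod d with ((Nat.card L : ℕ) : ZMod d) * c = c, kummerChar ℓ L c t := by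
  classical
  have hs : Nat.card L - 1 ≠ 0 := by
    have := Finite.one_lt_card (α := L)
    omega
  set s := Nat.card L - 1 with hsdef
  have hcard : Nat.card L = s + 1 := by omega
  have hd0 : (d : ℂ) ≠ 0 := by exact_mod_cast NeZero.ne d
  obtain ⟨y, hy⟩ := exists_unit_pow_eq (NeZero.ne d)
    (Units.map (algebraMap L A).toMonoidHom (Units.mk0 t ht))
  let ω : rootsOfUnity d A := ⟨y ^ s, pow_card_sub_one_mul_mem hy⟩
  have hfin : Fintype (rootsOfUnity d A) := Fintype.ofEquiv _ ℓ.symm.toEquiv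
  have hytA : (y : A) ^ d = algebraMap L A t := by
    have := congrArg Units.val hy
    simpa using this
  -- All d-th roots of t in A are ζ y; such a root lies in L exactly when (ζ y) ^ (|L| - 1) = 1.
  have e1 : ({u | u ^ d = t} : Finset L).card =
      ({ζ | ζ ^ s * ω = 1} : Finset (rootsOfUnity d A)).card := by
    have hu0 : ∀ u : L, u ^ d = t → u ≠ 0 := by
      rintro u hu rfl
      rw [zero_pow (NeZero.ne d)] at hu
      exact ht hu.symm
    have hu' : ∀ u : L, u ^ d = t → algebraMap L A u / y ≠ 0 := fun u hu ↦
      div_ne_zero ((_root_.map_ne_zero _).2 (hu0 u hu)) y.ne_zero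
    have hmem : ∀ (u : L) (hu : u ^ d = t), Units.mk0 _ (hu' u hu) ∈ rootsOfUnity d A := by
      intro u hu
      rw [mem_rootsOfUnity]
      refine Units.ext ?_
      rw [Units.val_pow_eq_pow_val, Units.val_mk0, div_pow, ← map_pow, hu, hytA, Units.val_one,
        div_self ((_root_.map_ne_zero _).2 ht)]
    refine Finset.card_bij (fun u hu ↦ ⟨Units.mk0 _ (hu' u (Finset.mem_filter.1 hu).2),
      hmem u (Finset.mem_filter.1 hu).2⟩) ?_ ?_ ?_
    · intro u hu
      have hu1 := (Finset.mem_filter.1 hu).2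
      rw [Finset.mem_filter]
      refine ⟨Finset.mem_univ _, Subtype.ext (Units.ext ?_)⟩
      change (algebraMap L A u / y) ^ s * (y : A) ^ s = 1
      have hu2 : u ^ s = 1 := by
        let := Fintype.ofFinite L
        rw [hsdef, Nat.card_eq_fintype_card]
        exact FiniteField.pow_card_sub_one_eq_one u (hu0 u hu1)
      rw [← mul_pow, div_mul_cancel₀ _ y.ne_zero, ← map_pow, hu2, map_one]
    · intro u hu u' hu' h
      have h1 : algebraMap L A u / y = algebraMap L A u' / y :=
        congrArg (fun z : rootsOfUnity d A ↦ ((z : Aˣ) : A)) h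
      exact (algebraMap L A).injective ((div_left_inj' y.ne_zero).1 h1)
    · intro ζ hζ
      have hζ1 := (Finset.mem_filter.1 hζ).2
      have hζ2 : ((ζ : Aˣ) : A) ^ s * (y : A) ^ s = 1 :=
        congrArg (fun z : rootsOfUnity d A ↦ ((z : Aˣ) : A)) hζ1
      obtain ⟨u, hu⟩ := exists_algebraMap_eq_of_pow_card (L := L) (z := ((ζ : Aˣ) : A) * y) (by
        rw [hcard, pow_succ, mul_pow, hζ2, one_mul])
      have hζd : ((ζ : Aˣ) : A) ^ d = 1 := by
        have := (mem_rootsOfUnity d _).1 ζ.2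
        exact congrArg Units.val this
      have hut : u ^ d = t := by
        apply (algebraMap L A).injective
        rw [map_pow, hu, mul_pow, hytA, hζd, one_mul]
      refine ⟨u, by simpa using hut, Subtype.ext (Units.ext ?_)⟩
      change algebraMap L A u / y = (ζ : Aˣ)
      rw [hu, mul_div_cancel_right₀ _ y.ne_zero]
  have e2 : (({ζ | ζ ^ s * ω = 1} : Finset (rootsOfUnity d A)).card : ℂ) =
      ∑ j : ZMod d, if (s : ZMod d) * j + (ℓ ω).toAdd = 0 then (1 : ℂ) else 0 := by
    rw [Finset.card_filter]
    push_cast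
    refine Fintype.sum_equiv (ℓ.toEquiv.trans Multiplicative.toAdd) _ _ fun ζ ↦ ?_
    congr 1
    rw [eq_iff_iff, ← ℓ.injective.eq_iff, map_mul, map_pow, map_one, ← toAdd_eq_zero, toAdd_mul,
      toAdd_pow, nsmul_eq_mul]
    rfl
  have e3 : ∀ b : ZMod d, (if b = 0 then (1 : ℂ) else 0) =
      (d : ℂ)⁻¹ * ∑ c : ZMod d, ZMod.stdAddChar (c * b) := by
    intro b
    rw [AddChar.sum_mulShift b (ZMod.isPrimitive_stdAddChar d), ZMod.card]
    split_ifs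
    · rw [inv_mul_cancel₀ hd0]
    · simp
  rw [e1, e2, Finset.sum_congr rfl fun j _ ↦ e3 _, ← Finset.mul_sum, Finset.sum_comm]
  -- Orthogonality in j leaves only the c with (|L| - 1) c = 0, which are the indices of characters
  -- defined over L.
  have e4 : ∀ c : ZMod d, ∑ j : ZMod d, (ZMod.stdAddChar (c * ((s : ZMod d) * j + (ℓ ω).toAdd)) : ℂ) =
      if ((Nat.card L : ℕ) : ZMod d) * c = c then (d : ℂ) * kummerChar ℓ L c t else 0 := by
    intro c
    have h1 : ∀ j : ZMod d, (ZMod.stdAddChar (c * ((s : ZMod d) * j + (ℓ ω).toAdd)) : ℂ) =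
        ZMod.stdAddChar (j * ((s : ZMod d) * c)) * ZMod.stdAddChar (c * (ℓ ω).toAdd) := by
      intro j
      rw [← AddChar.map_add_eq_mul]
      congr 1
      ring
    rw [Finset.sum_congr rfl fun j _ ↦ h1 j, ← Finset.sum_mul,
      AddChar.sum_mulShift _ (ZMod.isPrimitive_stdAddChar d), ZMod.card]
    have h2 : (s : ZMod d) * c = 0 ↔ ((Nat.card L : ℕ) : ZMod d) * c = c := by
      rw [hcard, Nat.cast_succ, add_mul, one_mul, add_eq_right]
    simp only [h2]
    split_ifs with h
    · have h3 := kummerChar_apply ℓ h hy (ζ := ω) rfl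
      rw [Units.val_mk0] at h3
      rw [h3]
    · rw [Nat.cast_zero, zero_mul]
  rw [Finset.sum_congr rfl fun c _ ↦ e4 c, ← Finset.sum_filter, ← Finset.mul_sum, ← mul_assoc,
    inv_mul_cancel₀ hd0, one_mul]

/-- If y ^ d = x and r = (|L| - 1) / (|k| - 1), then y ^ r is a d-th root of N(x) = x ^ r, and its
(|k| - 1)-th power is y ^ (|L| - 1). So lifting by the norm preserves the index. -/
theorem normLift_kummerChar {k : Type*} [Field k] [Finite k] [Algebra k L] [Algebra k A]
    [IsScalarTower k L A] {c : ZMod d} (hc : ((Nat.card k : ℕ) : ZMod d) * c = c) :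
    (kummerChar ℓ k c).normLift L = kummerChar ℓ L c := by
  have hcard : Nat.card L = Nat.card k ^ Module.finrank k L := Module.natCard_eq_pow_finrank
  have hcL : ((Nat.card L : ℕ) : ZMod d) * c = c := by
    rw [hcard, Nat.cast_pow]
    generalize Module.finrank k L = n
    induction n with
    | zero => rw [pow_zero, one_mul]
    | succ n ih => rw [pow_succ, mul_assoc, hc, ih]
  ext x
  obtain ⟨y, hy⟩ := exists_unit_pow_eq (NeZero.ne d) (Units.map (algebraMap L A).toMonoidHom x)
  set r := (Nat.card L - 1) / (Nat.card k - 1) with hr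
  have hdvd : (Nat.card k - 1) * r = Nat.card L - 1 := by
    refine Nat.mul_div_cancel' ?_
    rw [hcard]
    exact Nat.sub_one_dvd_pow_sub_one _ _
  have hN : (y ^ r) ^ d = Units.map (algebraMap k A).toMonoidHom (Units.map (Algebra.norm k) x) := by
    refine Units.ext ?_
    change ((y : A) ^ r) ^ d = algebraMap k A (Algebra.norm k (x : L))
    rw [IsScalarTower.algebraMap_apply k L A, FiniteField.algebraMap_norm_eq_pow, map_pow, ← hr,
      ← pow_mul, mul_comm, pow_mul]
    congr 1
    exact congrArg Units.val hy
  rw [MulChar.normLift_apply, kummerChar_apply ℓ hcL hy (ζ := ⟨_, pow_card_sub_one_mul_mem hy⟩) rfl]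
  refine kummerChar_apply ℓ hc hN ?_
  change y ^ (Nat.card L - 1) = _
  rw [← pow_mul, mul_comm, hdvd]

end KummerCharacter

/-! ### Invariance of Jacobi sums under the p-th power map on characters. -/

section Frobenius

/-- Reindex by Frobenius, using 1 - x ^ p = (1 - x) ^ p. -/
theorem jacobiSum_pow_char {L : Type*} [Field L] [Fintype L] (p : ℕ) [Fact p.Prime] [CharP L p]
    (ψ φ : MulChar L ℂ) : jacobiSum (ψ ^ p) (φ ^ p) = jacobiSum ψ φ := by
  have hp := (Fact.out : p.Prime)
  let e : L ≃+* L := RingEquiv.ofBijective (frobenius L p)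
    (Finite.injective_iff_bijective.1 (frobenius L p).injective)
  refine Fintype.sum_equiv e.toEquiv _ _ fun x ↦ ?_
  change _ = ψ (x ^ p) * φ (1 - x ^ p)
  rw [MulChar.pow_apply' _ hp.ne_zero, MulChar.pow_apply' _ hp.ne_zero, map_pow]
  congr 1
  rw [← map_pow, sub_pow_char, one_pow]

theorem jacobiSum_pow_char_pow {L : Type*} [Field L] [Fintype L] (p : ℕ) [Fact p.Prime] [CharP L p]
    (ψ φ : MulChar L ℂ) (n : ℕ) : jacobiSum (ψ ^ p ^ n) (φ ^ p ^ n) = jacobiSum ψ φ := by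
  induction n with
  | zero => simp
  | succ n ih => rw [pow_succ, pow_mul, pow_mul, jacobiSum_pow_char, ih]

end Frobenius

/-! ### The finite extensions of F inside an algebraic closure. -/

section FiniteSubfields

variable (F : Type*) [Field F] [Finite F]

theorem exists_intermediateField_mem_iff {n : ℕ} (hn : n ≠ 0) :
    ∃ K : IntermediateField F (AlgebraicClosure F), Finite K ∧ Nat.card K = Nat.card F ^ n ∧
      ∀ z, z ∈ K ↔ z ^ Nat.card F ^ n = z := by
  obtain ⟨p, _⟩ := CharP.exists F
  have : Fact p.Prime := ⟨CharP.char_is_prime F p⟩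
  have : NeZero n := ⟨hn⟩
  let f : FiniteField.Extension F p n →ₐ[F] AlgebraicClosure F := IsAlgClosed.lift
  let := f.toRingHom.toAlgebra
  have hcard : Nat.card (FiniteField.Extension F p n) = Nat.card F ^ n :=
    FiniteField.natCard_extension F p n
  have hfin : Finite f.fieldRange := Finite.of_surjective _ f.rangeRestrict_surjective
  have hcard' : Nat.card f.fieldRange = Nat.card F ^ n := by
    rw [← hcard]
    exact (Nat.card_congr (Equiv.ofInjective f f.injective)).symm
  refine ⟨f.fieldRange, hfin, hcard', fun z ↦ ⟨?_, ?_⟩⟩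
  · intro hz
    have := Fintype.ofFinite f.fieldRange
    have h1 := FiniteField.pow_card (⟨z, hz⟩ : f.fieldRange)
    rw [← Nat.card_eq_fintype_card, hcard'] at h1
    exact congrArg Subtype.val h1
  · intro hz
    obtain ⟨x, hx⟩ := exists_algebraMap_eq_of_pow_card (L := FiniteField.Extension F p n) (z := z)
      (by rw [hcard, hz])
    exact ⟨x, hx⟩

open Classical in
/-- The extension of degree `n` of a finite field inside the algebraic closure, for `n ≠ 0`. -/
noncomputable def finiteSubfield (n : ℕ) : IntermediateField F (AlgebraicClosure F) :=
  if hn : n ≠ 0 then (exists_intermediateField_mem_iff F hn).choose else ⊥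

variable {F} {n : ℕ}

instance finite_finiteSubfield : Finite (finiteSubfield F n) := by
  rw [finiteSubfield]
  split_ifs with h
  · exact (exists_intermediateField_mem_iff F h).choose_spec.1
  · exact Finite.of_surjective _ (IntermediateField.botEquiv F (AlgebraicClosure F)).symm.surjective

noncomputable instance : Fintype (finiteSubfield F n) := Fintype.ofFinite _

theorem natCard_finiteSubfield (hn : n ≠ 0) : Nat.card (finiteSubfield F n) = Nat.card F ^ n := by
  rw [finiteSubfield, dif_pos hn]
  exact (exists_intermediateField_mem_iff F hn).choose_spec.2.1

theorem mem_finiteSubfield (hn : n ≠ 0) {z : AlgebraicClosure F} :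
    z ∈ finiteSubfield F n ↔ z ^ Nat.card F ^ n = z := by
  rw [finiteSubfield, dif_pos hn]
  exact (exists_intermediateField_mem_iff F hn).choose_spec.2.2 z

theorem finrank_finiteSubfield (hn : n ≠ 0) : Module.finrank F (finiteSubfield F n) = n := by
  refine Nat.pow_right_injective (Finite.one_lt_card : 2 ≤ Nat.card F) ?_
  change Nat.card F ^ _ = Nat.card F ^ _
  rw [← Module.natCard_eq_pow_finrank, natCard_finiteSubfield hn]

theorem finiteSubfield_le {m : ℕ} (hm : m ≠ 0) (hn : n ≠ 0) (h : m ∣ n) :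
    finiteSubfield F m ≤ finiteSubfield F n := by
  intro z hz
  rw [mem_finiteSubfield hm] at hz
  rw [mem_finiteSubfield hn]
  obtain ⟨r, rfl⟩ := h
  clear hn
  induction r with
  | zero => simp
  | succ r ih => rw [Nat.mul_succ, pow_add, pow_mul, ih, hz]

end FiniteSubfields

/-! ### Multiplication by q on ℤ/d. -/

section FrobeniusAction

theorem ZMod.natCast_mul_eq_self_iff {d : ℕ} (a : ℕ) (ha : 0 < a) (c : ZMod d) :
    (a : ZMod d) * c = c ↔ (a : ZMod (addOrderOf c)) = 1 := by
  have h1 : (a : ZMod d) * c = c ↔ (a - 1) • c = 0 := by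
    rw [nsmul_eq_mul, Nat.cast_sub ha, sub_mul, Nat.cast_one, one_mul, sub_eq_zero]
  rw [h1, ← addOrderOf_dvd_iff_nsmul_eq_zero, ← ZMod.natCast_eq_zero_iff, Nat.cast_sub ha,
    Nat.cast_one, sub_eq_zero]

theorem ZMod.natCast_pow_mul_eq_self_iff {d : ℕ} {q : ℕ} (hq : 0 < q) (n : ℕ) (c : ZMod d) :
    ((q ^ n : ℕ) : ZMod d) * c = c ↔ orderOf (q : ZMod (addOrderOf c)) ∣ n := by
  rw [ZMod.natCast_mul_eq_self_iff _ (pow_pos hq n), Nat.cast_pow, orderOf_dvd_iff_pow_eq_one]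

theorem ZMod.addOrderOf_natCast_mul {d : ℕ} [NeZero d] {q : ℕ} (hq : q.Coprime d) (c : ZMod d) :
    addOrderOf ((q : ZMod d) * c) = addOrderOf c := by
  rw [← nsmul_eq_mul]
  refine Nat.Coprime.addOrderOf_nsmul (hq.symm.coprime_dvd_left ?_)
  have := addOrderOf_dvd_card (x := c)
  rwa [ZMod.card] at this

theorem ZMod.addOrderOf_dvd {d : ℕ} [NeZero d] (c : ZMod d) : addOrderOf c ∣ d := by
  have := addOrderOf_dvd_card (x := c)
  rwa [ZMod.card] at this

theorem ZMod.orderOf_natCast_pos {e q : ℕ} [NeZero e] (hq : q.Coprime e) :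
    0 < orderOf (q : ZMod e) := by
  rw [← ZMod.coe_unitOfCoprime q hq, orderOf_units]
  exact orderOf_pos _

theorem ZMod.card_addOrderOf_eq {d e : ℕ} [NeZero d] (h : e ∣ d) :
    ({c | addOrderOf c = e} : Finset (ZMod d)).card = e.totient := by
  refine IsAddCyclic.card_addOrderOf_eq_totient ?_
  rwa [ZMod.card]

end FrobeniusAction

/-- Raising both characters to the power p ^ n does not change the Jacobi sum, and χ ^ (p ^ n) = χ
because p ^ n is odd. -/
theorem jacobiSum_kummerChar_pow_mul {A L : Type*} [Field A] [IsAlgClosed A] {d : ℕ} [NeZero d]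
    (ℓ : rootsOfUnity d A ≃* Multiplicative (ZMod d)) [Field L] [Fintype L] [Algebra L A] {p : ℕ}
    [Fact p.Prime] (hp2 : p ≠ 2) [CharP L p] {c : ZMod d}
    (hc : ((Nat.card L : ℕ) : ZMod d) * c = c) (n : ℕ) :
    jacobiSum (kummerChar ℓ L ((p ^ n : ℕ) * c)) (quadChar L) =
      jacobiSum (kummerChar ℓ L c) (quadChar L) := by
  rw [← kummerChar_pow ℓ hc, ← jacobiSum_pow_char_pow p (kummerChar ℓ L c) (quadChar L) n]
  congr 1
  obtain ⟨r, hr⟩ := ((Fact.out : p.Prime).odd_of_ne_two hp2).pow (n := n)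
  rw [hr, pow_succ, pow_mul, sq, quadChar_mul_quadChar, one_pow, one_mul]

/-! ### The reciprocal roots of the L-function. -/

section JacobiRoot

variable {F : Type*} [Field F] [Finite F] {d : ℕ} [NeZero d]
  (ℓ : rootsOfUnity d (AlgebraicClosure F) ≃* Multiplicative (ZMod d))

theorem nonempty_rootsOfUnity_equiv (F : Type*) [Field F] (d : ℕ) [NeZero d] (hd : (d : F) ≠ 0) :
    Nonempty (rootsOfUnity d (AlgebraicClosure F) ≃* Multiplicative (ZMod d)) := by
  have : NeZero (d : F) := ⟨hd⟩
  have h : HasEnoughRootsOfUnity (AlgebraicClosure F) d := inferInstance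
  obtain ⟨g, hg⟩ := IsCyclic.exists_generator (α := rootsOfUnity d (AlgebraicClosure F))
  exact ⟨(zmodMulEquivOfGenerator hg
    (HasEnoughRootsOfUnity.natCard_rootsOfUnity (AlgebraicClosure F) d)).symm⟩

variable (F) in
/-- The degree of the field of definition of the `c`-th power of the `d`-th power residue symbol. -/
noncomputable def frobeniusPeriod (c : ZMod d) : ℕ :=
  orderOf ((Nat.card F : ℕ) : ZMod (addOrderOf c))

/-- The square of the Jacobi sum of a power residue symbol and the quadratic character. -/
noncomputable def jacobiSquare (n : ℕ) (c : ZMod d) : ℂ :=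
  jacobiSum (kummerChar ℓ (finiteSubfield F n) c) (quadChar (finiteSubfield F n)) ^ 2

/-- The square of the Jacobi sum over the smallest possible extension of `F`. -/
noncomputable def jacobiRoot (c : ZMod d) : ℂ := jacobiSquare ℓ (frobeniusPeriod F c) c

theorem card_coprime {d : ℕ} (hd : (d : F) ≠ 0) : (Nat.card F).Coprime d := by
  obtain ⟨p, _⟩ := CharP.exists F
  have := Fintype.ofFinite F
  obtain ⟨n, hp, hn⟩ := FiniteField.card F p
  rw [Nat.card_eq_fintype_card, hn]
  refine Nat.Coprime.pow_left _ ((Nat.Prime.coprime_iff_not_dvd hp).2 fun h ↦ hd ?_)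
  rwa [CharP.cast_eq_zero_iff F p]

theorem frobeniusPeriod_pos (hd : (d : F) ≠ 0) (c : ZMod d) : 0 < frobeniusPeriod F c := by
  have h1 := ZMod.addOrderOf_dvd c
  have : NeZero (addOrderOf c) := ⟨fun h ↦ by
    rw [h, zero_dvd_iff] at h1; exact NeZero.ne d h1⟩
  exact ZMod.orderOf_natCast_pos ((card_coprime hd).coprime_dvd_right h1)

/-- The character of index c is defined over the extension of degree n exactly when its period
divides n. -/
theorem natCard_finiteSubfield_mul_eq_iff {d n : ℕ} (hn : n ≠ 0) (c : ZMod d) :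
    ((Nat.card (finiteSubfield F n) : ℕ) : ZMod d) * c = c ↔ frobeniusPeriod F c ∣ n := by
  rw [natCard_finiteSubfield hn, ZMod.natCast_pow_mul_eq_self_iff Nat.card_pos, frobeniusPeriod]

/-- The squared Hasse-Davenport relation in the tower of degrees m ∣ n; lifting by the norm keeps
the index c and the quadratic character. -/
theorem jacobiSum_kummerChar_sq (h2 : (2 : F) ≠ 0) {n m : ℕ} (hn : n ≠ 0) (hm : m ≠ 0)
    (hmn : m ∣ n) {c : ZMod d} (hc : frobeniusPeriod F c ∣ m) :
    jacobiSquare ℓ n c = jacobiSquare ℓ m c ^ (n / m) := by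
  let := (IntermediateField.inclusion (finiteSubfield_le (F := F) hm hn hmn)).toRingHom.toAlgebra
  have : IsScalarTower F (finiteSubfield F m) (finiteSubfield F n) :=
    IsScalarTower.of_algebraMap_eq fun x ↦ rfl
  have : IsScalarTower (finiteSubfield F m) (finiteSubfield F n) (AlgebraicClosure F) :=
    IsScalarTower.of_algebraMap_eq fun x ↦ rfl
  have h2m : (2 : finiteSubfield F m) ≠ 0 := by
    rw [← map_ofNat (algebraMap F (finiteSubfield F m))]
    exact (_root_.map_ne_zero _).2 h2
  have h1 := jacobiSum_normLift_sq (L := finiteSubfield F n)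
    (kummerChar ℓ (finiteSubfield F m) c) (quadChar (finiteSubfield F m)) (quadChar_ne_one h2m)
  have : Module.Free (finiteSubfield F m) (finiteSubfield F n) := Module.Free.of_divisionRing _ _
  have h3 : Module.finrank (finiteSubfield F m) (finiteSubfield F n) = n / m := by
    have h4 := Module.finrank_mul_finrank F (finiteSubfield F m) (finiteSubfield F n)
    rw [finrank_finiteSubfield hm, finrank_finiteSubfield hn] at h4
    exact (Nat.div_eq_of_eq_mul_right (Nat.pos_of_ne_zero hm) h4.symm).symm
  rw [normLift_kummerChar ℓ ((natCard_finiteSubfield_mul_eq_iff hm c).2 hc), quadChar_normLift h2m,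
    h3] at h1
  exact h1

theorem jacobiRoot_frobenius (h2 : (2 : F) ≠ 0) (hd : (d : F) ≠ 0) (c : ZMod d) :
    jacobiRoot ℓ (((Nat.card F : ℕ) : ZMod d) * c) = jacobiRoot ℓ c := by
  have h1 : frobeniusPeriod F (((Nat.card F : ℕ) : ZMod d) * c) = frobeniusPeriod F c := by
    rw [frobeniusPeriod, frobeniusPeriod, ZMod.addOrderOf_natCast_mul (card_coprime hd)]
  rw [jacobiRoot, jacobiRoot, h1, jacobiSquare, jacobiSquare]
  obtain ⟨p, _⟩ := CharP.exists F
  have := Fintype.ofFinite F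
  obtain ⟨n, hp, hn⟩ := FiniteField.card F p
  have : Fact p.Prime := ⟨hp⟩
  have hp2 : p ≠ 2 := by
    rintro rfl
    exact h2 (by exact_mod_cast CharP.cast_eq_zero F 2)
  have hp0 := frobeniusPeriod_pos hd c
  have : CharP (finiteSubfield F (frobeniusPeriod F c)) p :=
    charP_of_injective_algebraMap (algebraMap F _).injective p
  rw [Nat.card_eq_fintype_card, hn, jacobiSum_kummerChar_pow_mul ℓ hp2
    ((natCard_finiteSubfield_mul_eq_iff hp0.ne' c).2 dvd_rfl)]

/-- The character is trivial or quadratic, and J(1, χ) = -1, J(χ, χ) = -χ(-1). -/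
theorem jacobiRoot_eq_one (h2 : (2 : F) ≠ 0) (hd : (d : F) ≠ 0) {c : ZMod d}
    (hc : addOrderOf c ≤ 2) : jacobiRoot ℓ c = 1 := by
  have hp0 := frobeniusPeriod_pos hd c
  rw [jacobiRoot, jacobiSquare]
  have h1 := orderOf_kummerChar ℓ ((natCard_finiteSubfield_mul_eq_iff hp0.ne' c).2 dvd_rfl)
  set K := finiteSubfield F (frobeniusPeriod F c)
  have h2K : (2 : K) ≠ 0 := by
    rw [← map_ofNat (algebraMap F K)]
    exact (_root_.map_ne_zero _).2 h2
  by_cases hψ : kummerChar ℓ K c = 1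
  · rw [hψ, jacobiSum_one_quadChar_sq h2K]
  · obtain ⟨g, hg⟩ := IsCyclic.exists_generator (α := Kˣ)
    have h3 : kummerChar ℓ K c ^ 2 = 1 := by
      have h5 : 0 < addOrderOf c := addOrderOf_pos c
      refine orderOf_dvd_iff_pow_eq_one.1 ?_
      rw [h1]
      interval_cases addOrderOf c
      exacts [one_dvd _, dvd_rfl]
    have h4 : ∀ χ : MulChar K ℂ, χ ≠ 1 → χ ^ 2 = 1 → χ g = -1 := by
      intro χ hχ hχ2
      have h5 : χ g ^ 2 = 1 := by
        rw [← MulChar.pow_apply_coe, hχ2, MulChar.one_apply_coe]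
      refine (sq_eq_sq_iff_eq_or_eq_neg.1 (h5.trans (one_pow 2).symm)).resolve_left fun h6 ↦ hχ ?_
      exact ((MulChar.eq_iff hg _ _).2 (by rw [h6, MulChar.one_apply_coe]))
    have h5 : kummerChar ℓ K c = quadChar K := (MulChar.eq_iff hg _ _).2 (by
      rw [h4 _ hψ h3, h4 _ (quadChar_ne_one h2K) (by rw [sq, quadChar_mul_quadChar])])
    rw [h5, jacobiSum_quadChar_quadChar_sq h2K]

theorem jacobiRoot_eq_card_iff {p : ℕ} (hp : p.Prime) (hp2 : p ≠ 2) [CharP F p] (hd : (d : F) ≠ 0)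
    {c : ZMod d} (hc : 2 < addOrderOf c) :
    jacobiRoot ℓ c = (Nat.card F : ℂ) ^ frobeniusPeriod F c ↔ IsBalancedMod p (addOrderOf c) := by
  have hp0 := frobeniusPeriod_pos hd c
  rw [jacobiRoot, jacobiSquare]
  have h1 := orderOf_kummerChar ℓ ((natCard_finiteSubfield_mul_eq_iff hp0.ne' c).2 dvd_rfl)
  have h3 := natCard_finiteSubfield (F := F) hp0.ne'
  set K := finiteSubfield F (frobeniusPeriod F c)
  have : CharP K p := charP_of_injective_algebraMap (algebraMap F K).injective p
  rw [← h1] at hc ⊢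
  rw [← jacobiSum_sq_eq_card_iff hp hp2 hc, ← Nat.cast_pow, ← h3, Nat.card_eq_fintype_card]

theorem card_addOrderOf_le_two : ({c | addOrderOf c ≤ 2} : Finset (ZMod d)).card =
    1 + if Even d then 1 else 0 := by
  have h1 : ({c | addOrderOf c ≤ 2} : Finset (ZMod d)) =
      ({c | addOrderOf c = 1} : Finset (ZMod d)) ∪ ({c | addOrderOf c = 2} : Finset (ZMod d)) := by
    ext c
    have h5 : 0 < addOrderOf c := addOrderOf_pos c
    simp only [Finset.mem_union, Finset.mem_filter_univ]
    omega
  rw [h1, Finset.card_union_of_disjoint, ZMod.card_addOrderOf_eq (one_dvd d), Nat.totient_one]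
  · congr 1
    split_ifs with h
    · rw [ZMod.card_addOrderOf_eq h.two_dvd, Nat.totient_two]
    · rw [Finset.card_eq_zero, Finset.filter_eq_empty_iff]
      intro c _ hc
      exact h (even_iff_two_dvd.2 (hc ▸ ZMod.addOrderOf_dvd c))
  · rw [Finset.disjoint_filter]
    intro c _ h h'
    omega

/-- The trace formula for the twists by all of the finite extensions of `F`. -/
theorem sum_legendreSum_pow_finiteSubfield (h2 : (2 : F) ≠ 0) (hd : (d : F) ≠ 0) {n : ℕ}
    (hn : n ≠ 0) :
    ∑ u : finiteSubfield F n, legendreSum (finiteSubfield F n) (u ^ d) =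
      (if Even d then 1 else 0) + ∑ c : ZMod d with 2 < addOrderOf c ∧ frobeniusPeriod F c ∣ n,
        jacobiRoot ℓ c ^ (n / frobeniusPeriod F c) := by
  classical
  have h2n : (2 : finiteSubfield F n) ≠ 0 := by
    rw [← map_ofNat (algebraMap F (finiteSubfield F n))]
    exact (_root_.map_ne_zero _).2 h2
  rw [sum_legendreSum_pow h2n (NeZero.pos d) _ (kummerChar ℓ (finiteSubfield F n))
    fun t ht ↦ card_pow_eq_sum_kummerChar ℓ ht]
  simp only [natCard_finiteSubfield_mul_eq_iff hn]
  have h1 : ∀ c ∈ ({c | frobeniusPeriod F c ∣ n} : Finset (ZMod d)),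
      jacobiSum (kummerChar ℓ (finiteSubfield F n) c) (quadChar (finiteSubfield F n)) ^ 2 =
        jacobiRoot ℓ c ^ (n / frobeniusPeriod F c) := fun c hc ↦
    jacobiSum_kummerChar_sq ℓ h2 hn (frobeniusPeriod_pos hd c).ne' (by simpa using hc) dvd_rfl
  rw [Finset.sum_congr rfl h1, ← Finset.sum_filter_add_sum_filter_not _ fun c ↦ 2 < addOrderOf c,
    Finset.filter_filter, Finset.filter_filter]
  -- Elements of order at most 2 are fixed by q, as q is odd when the order is 2. They have period 1
  -- and occur for every n.
  have h3 : ({c | frobeniusPeriod F c ∣ n ∧ ¬ 2 < addOrderOf c} : Finset (ZMod d)) =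
      ({c | addOrderOf c ≤ 2} : Finset (ZMod d)) := by
    ext c
    simp only [Finset.mem_filter_univ, not_lt, and_iff_right_iff_imp]
    intro hc
    have h4 : frobeniusPeriod F c = 1 := by
      have h5 : 0 < addOrderOf c := addOrderOf_pos c
      have h6 := (card_coprime hd).coprime_dvd_right (ZMod.addOrderOf_dvd c)
      rw [frobeniusPeriod, orderOf_eq_one_iff]
      generalize addOrderOf c = e at *
      interval_cases e
      · exact Subsingleton.elim _ _
      · exact ZMod.natCast_eq_one_iff_odd.2 (Nat.coprime_two_right.1 h6)
    rw [h4]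
    exact one_dvd n
  have h4 : ∑ c : ZMod d with addOrderOf c ≤ 2, jacobiRoot ℓ c ^ (n / frobeniusPeriod F c) =
      1 + if Even d then 1 else 0 := by
    rw [Finset.sum_congr rfl (g := fun _ ↦ (1 : ℂ)) fun c hc ↦ by
      rw [jacobiRoot_eq_one ℓ h2 hd (by simpa using hc), one_pow], Finset.sum_const,
      card_addOrderOf_le_two, nsmul_one]
    push_cast
    rfl
  -- The index c = 0 cancels the -1 from the fibre t = 0; the index of order 2, present for even d,
  -- is left over and will match the place at infinity.
  rw [h3, h4]
  simp only [and_comm (b := frobeniusPeriod F _ ∣ n)]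
  ring

end JacobiRoot

/-! ### Euler products compared through their logarithms. -/

section EulerProduct

variable {ι : Type*} {deg : ι → ℕ} {D : ℕ → Finset ι}

theorem summable_pow_degree (hD : ∀ e v, v ∈ D e ↔ deg v = e) {C ρ : ℝ} (hC : 0 ≤ C) (hρ : 0 ≤ ρ)
    (hcard : ∀ e, ((D e).card : ℝ) ≤ C ^ e) (hCρ : C * ρ < 1) :
    Summable fun v ↦ ρ ^ deg v := by
  classical
  refine summable_of_sum_le (c := (1 - C * ρ)⁻¹) (fun v ↦ pow_nonneg hρ _) fun u ↦ ?_
  have h1 : ∑ v ∈ u, ρ ^ deg v = ∑ e ∈ u.image deg, ∑ v ∈ u with deg v = e, ρ ^ deg v :=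
    (Finset.sum_fiberwise_of_maps_to (fun v hv ↦ Finset.mem_image_of_mem _ hv) _).symm
  rw [h1]
  have h2 : ∀ e ∈ u.image deg, ∑ v ∈ u with deg v = e, ρ ^ deg v ≤ (C * ρ) ^ e := by
    intro e _
    calc ∑ v ∈ u with deg v = e, ρ ^ deg v ≤ ∑ v ∈ D e, ρ ^ deg v :=
          Finset.sum_le_sum_of_subset_of_nonneg
            (fun v hv ↦ (hD e v).2 (Finset.mem_filter.1 hv).2) fun _ _ _ ↦ pow_nonneg hρ _
      _ = (D e).card * ρ ^ e := by
          rw [Finset.sum_congr rfl fun v hv ↦ by rw [(hD e v).1 hv], Finset.sum_const, nsmul_eq_mul]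
      _ ≤ C ^ e * ρ ^ e := by gcongr; exact hcard e
      _ = (C * ρ) ^ e := (mul_pow _ _ _).symm
  refine (Finset.sum_le_sum h2).trans ?_
  have h0 : 0 ≤ C * ρ := mul_nonneg hC hρ
  exact (hasSum_geometric_of_lt_one h0 hCρ).summable.sum_le_tsum _ (fun e _ ↦ pow_nonneg h0 e)
    |>.trans (tsum_geometric_of_lt_one h0 hCρ).le

/-- The logarithm of an Euler product, summed over the primes and over the powers of `T`. -/
theorem exists_hasSum_neg_log (hD : ∀ e v, v ∈ D e ↔ deg v = e) (hdeg : ∀ v, deg v ≠ 0)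
    {C R : ℝ} (hC : 1 ≤ C) (hR : 0 ≤ R) (hcard : ∀ e, ((D e).card : ℝ) ≤ C ^ e)
    {α : ι → ℂ} (hα : ∀ v, ‖α v‖ ≤ R ^ deg v) {T : ℂ} (hT : C * (R * ‖T‖) < 1) :
    ∃ S, HasSum (fun v ↦ -Complex.log (1 - α v * T ^ deg v)) S ∧
      HasSum (fun n : ℕ ↦ (∑ e ∈ n.divisors, ∑ v ∈ D e, e * α v ^ (n / e)) * T ^ n / n) S := by
  classical
  set ρ := R * ‖T‖ with hρdef
  have hρ : 0 ≤ ρ := mul_nonneg hR (norm_nonneg _)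
  have hρ1 : ρ < 1 := (le_mul_of_one_le_left hρ hC).trans_lt hT
  let G : ι × ℕ → ℂ := fun x ↦ (α x.1 * T ^ deg x.1) ^ x.2 / x.2
  have hnorm : ∀ v, ‖α v * T ^ deg v‖ ≤ ρ ^ deg v := by
    intro v
    rw [norm_mul, norm_pow, hρdef, mul_pow]
    gcongr
    exact hα v
  -- Because deg v ≥ 1, one has deg v * k ≥ deg v + (k - 1), so the double family is dominated by a
  -- product of two summable families. The terms with k = 0 are zero, being divided by zero.
  have hsum : Summable G := by
    refine Summable.of_norm_bounded (g := fun x : ι × ℕ ↦ ρ ^ deg x.1 * ρ ^ (x.2 - 1))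
      ?_ ?_
    · refine Summable.mul_of_nonneg (f := fun v ↦ ρ ^ deg v) (g := fun k : ℕ ↦ ρ ^ (k - 1))
        (summable_pow_degree hD (zero_le_one.trans hC) hρ hcard hT) ?_
        (fun v ↦ pow_nonneg hρ _) (fun k ↦ pow_nonneg hρ _)
      rw [← summable_nat_add_iff 1]
      simpa using summable_geometric_of_lt_one hρ hρ1
    · rintro ⟨v, k⟩
      simp only [G]
      rcases Nat.eq_zero_or_pos k with rfl | hk
      · simp only [Nat.cast_zero, div_zero, norm_zero]
        positivity
      · rw [norm_div, norm_pow, Complex.norm_natCast]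
        have hk1 : (1 : ℝ) ≤ k := by exact_mod_cast hk
        calc ‖α v * T ^ deg v‖ ^ k / k ≤ ‖α v * T ^ deg v‖ ^ k := div_le_self (by positivity) hk1
          _ ≤ (ρ ^ deg v) ^ k := pow_le_pow_left₀ (norm_nonneg _) (hnorm v) k
          _ = ρ ^ (deg v * k) := (pow_mul _ _ _).symm
          _ ≤ ρ ^ (deg v + (k - 1)) := by
              refine pow_le_pow_of_le_one hρ hρ1.le ?_
              obtain ⟨j, rfl⟩ : ∃ j, k = j + 1 := ⟨k - 1, by omega⟩
              have := Nat.mul_le_mul_right j (Nat.one_le_iff_ne_zero.2 (hdeg v))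
              rw [Nat.add_sub_cancel, mul_add, mul_one]
              omega
          _ = ρ ^ deg v * ρ ^ (k - 1) := pow_add _ _ _
  obtain ⟨S, hS⟩ := hsum
  refine ⟨S, ?_, ?_⟩
  -- Summing over k first gives the logarithms; grouping by n = k * deg v instead gives the power
  -- series in T.
  · have h1 : ∀ v, HasSum (fun k : ℕ ↦ G (v, k)) (-Complex.log (1 - α v * T ^ deg v)) := by
      intro v
      have h2 : ‖α v * T ^ deg v‖ < 1 := (hnorm v).trans_lt (pow_lt_one₀ hρ hρ1 (hdeg v))
      simp only [G]
      exact Complex.hasSum_taylorSeries_neg_log h2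
    exact HasSum.prod_fiberwise hS h1
  · have h1 := hS.tsum_fiberwise fun x : ι × ℕ ↦ x.2 * deg x.1
    refine HasSum.congr_fun h1 fun n : ℕ ↦ ?_
    rcases Nat.eq_zero_or_pos n with rfl | hn
    · rw [Nat.cast_zero, div_zero, eq_comm]
      refine (tsum_congr fun b ↦ ?_).trans tsum_zero
      have h2 : b.1.2 = 0 := by
        have := b.2
        simp only [Set.mem_preimage, Set.mem_singleton_iff, mul_eq_zero, hdeg, or_false] at this
        exact this
      simp only [G, h2, Nat.cast_zero, div_zero]
    · let E : Finset (ι × ℕ) := n.divisors.biUnion fun e ↦ (D e).image fun v ↦ (v, n / e)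
      have h3 : (fun x : ι × ℕ ↦ x.2 * deg x.1) ⁻¹' {n} = ↑E := by
        ext ⟨v, k⟩
        simp only [Set.mem_preimage, Set.mem_singleton_iff, E, Finset.coe_biUnion, Set.mem_iUnion,
          Finset.coe_image, Set.mem_image, Finset.mem_coe, Prod.mk.injEq, Nat.mem_divisors, hD]
        constructor
        · intro h
          refine ⟨deg v, ⟨⟨k, by rw [← h, mul_comm]⟩, hn.ne'⟩, v, rfl, rfl, ?_⟩
          rw [← h, Nat.mul_div_cancel _ (Nat.pos_of_ne_zero (hdeg v))]
        · rintro ⟨e, ⟨he, -⟩, w, hw, rfl, rfl⟩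
          rw [hw, Nat.div_mul_cancel he]
      rw [h3, Finset.tsum_subtype' E G, Finset.sum_biUnion, Finset.sum_mul, Finset.sum_div]
      · refine Finset.sum_congr rfl fun e he ↦ ?_
        rw [Finset.sum_image fun v _ w _ h ↦ congrArg Prod.fst h, Finset.sum_mul, Finset.sum_div]
        refine Finset.sum_congr rfl fun v hv ↦ ?_
        obtain ⟨k, hk⟩ := (Nat.mem_divisors.1 he).1
        have he0 : e ≠ 0 := by rintro rfl; omega
        have hk0 : k ≠ 0 := by rintro rfl; omega
        simp only [G]
        rw [(hD e v).1 hv, hk, Nat.mul_div_cancel_left _ (Nat.pos_of_ne_zero he0), mul_pow,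
          ← pow_mul, Nat.cast_mul]
        have he0' : (e : ℂ) ≠ 0 := by exact_mod_cast he0
        have hk0' : (k : ℂ) ≠ 0 := by exact_mod_cast hk0
        field_simp
      · intro e _ e' _ hne
        rw [Function.onFun, Finset.disjoint_left]
        rintro x hx hx'
        obtain ⟨v, hv, rfl⟩ := Finset.mem_image.1 hx
        obtain ⟨w, hw, h⟩ := Finset.mem_image.1 hx'
        have h5 : w = v := congrArg Prod.fst h
        subst h5
        exact hne (((hD e w).1 hv).symm.trans ((hD e' w).1 hw))

/-- An Euler product is a polynomial in `T` if its logarithmic derivative has the corresponding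
coefficients. -/
theorem hasProd_inv_of_coefficients (hD : ∀ e v, v ∈ D e ↔ deg v = e) (hdeg : ∀ v, deg v ≠ 0)
    {C R : ℝ} (hC : 1 ≤ C) (hR : 0 ≤ R) (hcard : ∀ e, ((D e).card : ℝ) ≤ C ^ e)
    {α β : ι → ℂ} (hα : ∀ v, ‖α v‖ ≤ R ^ deg v) (hβ : ∀ v, ‖β v‖ ≤ R ^ deg v)
    {κ : Type*} (I : Finset κ) {o : κ → ℕ} (ho : ∀ c, o c ≠ 0) (z : κ → ℂ)
    (h : ∀ n : ℕ, n ≠ 0 → ∑ e ∈ n.divisors, ∑ v ∈ D e, e * (α v ^ (n / e) + β v ^ (n / e)) =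
      -∑ c ∈ I with o c ∣ n, o c * z c ^ (n / o c)) :
    ∃ ε > 0, ∀ T : ℂ, ‖T‖ < ε → HasProd
      (fun v ↦ ((1 - α v * T ^ deg v) * (1 - β v * T ^ deg v))⁻¹) (∏ c ∈ I, (1 - z c * T ^ o c)) := by
  classical
  set R' : ℝ := 1 + ∑ c ∈ I, ‖z c‖ with hR'
  have hR'1 : 1 ≤ R' := le_add_of_nonneg_right (Finset.sum_nonneg fun _ _ ↦ norm_nonneg _)
  set C' : ℝ := 1 + I.card with hC'
  have hC'1 : 1 ≤ C' := le_add_of_nonneg_right (Nat.cast_nonneg _)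
  have hz : ∀ c : I, ‖z c‖ ≤ R' ^ o c := fun c ↦ by
    have h1 : ‖z c‖ ≤ R' :=
      (Finset.single_le_sum (f := fun c ↦ ‖z c‖) (fun _ _ ↦ norm_nonneg _) c.2).trans
        (le_add_of_nonneg_left zero_le_one)
    exact h1.trans (le_self_pow₀ hR'1 (ho c))
  have hcard' : ∀ e, ((({c | o c.1 = e} : Finset I).card : ℝ)) ≤ C' ^ e := by
    intro e
    rcases Nat.eq_zero_or_pos e with rfl | he
    · simp [ho]
    · have h1 : ((({c | o c.1 = e} : Finset I).card : ℝ)) ≤ C' := by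
        refine le_trans (Nat.cast_le.2 (Finset.card_le_univ _)) ?_
        rw [Fintype.card_coe]
        exact le_add_of_nonneg_left zero_le_one
      exact h1.trans (le_self_pow₀ hC'1 he.ne')
  have hpos : ∀ a b : ℝ, 0 ≤ b → 1 ≤ a → ∀ T : ℂ, ‖T‖ < (a * (b + 1))⁻¹ → a * (b * ‖T‖) < 1 := by
    intro a b hb ha T hT
    have h0 : 0 < a * (b + 1) := by positivity
    have h1 := mul_lt_mul_of_pos_right hT h0
    rw [inv_mul_cancel₀ h0.ne'] at h1
    nlinarith [norm_nonneg T]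
  refine ⟨min (C * (R + 1))⁻¹ (C' * (R' + 1))⁻¹, by positivity, fun T hT ↦ ?_⟩
  have hT1 := hpos C R hR hC T (hT.trans_le (min_le_left _ _))
  have hT2 := hpos C' R' (zero_le_one.trans hR'1) hC'1 T (hT.trans_le (min_le_right _ _))
  obtain ⟨Sα, hα1, hα2⟩ := exists_hasSum_neg_log hD hdeg hC hR hcard hα hT1
  obtain ⟨Sβ, hβ1, hβ2⟩ := exists_hasSum_neg_log hD hdeg hC hR hcard hβ hT1
  -- The finite product is treated as another Euler product, with index set I and degrees o, so that
  -- equality of coefficients gives Sα + Sβ = -Sz.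
  obtain ⟨Sz, hz1, hz2⟩ := exists_hasSum_neg_log (deg := fun c : I ↦ o c)
    (D := fun e ↦ {c | o c.1 = e}) (by simp) (fun c ↦ ho c) hC'1 (zero_le_one.trans hR'1) hcard' hz
    hT2
  have hlt : ∀ {a b : ℝ}, 1 ≤ a → 0 ≤ b → a * (b * ‖T‖) < 1 → ∀ {m : ℕ} {x : ℂ}, m ≠ 0 →
      ‖x‖ ≤ b ^ m → 1 - x * T ^ m ≠ 0 := by
    intro a b ha hb hab m x hm hx h0
    have h1 : ‖x * T ^ m‖ < 1 := by
      rw [norm_mul, norm_pow]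
      calc ‖x‖ * ‖T‖ ^ m ≤ b ^ m * ‖T‖ ^ m := by gcongr
        _ = (b * ‖T‖) ^ m := (mul_pow _ _ _).symm
        _ < 1 := pow_lt_one₀ (by positivity)
          ((le_mul_of_one_le_left (by positivity) ha).trans_lt hab) hm
    rw [← sub_eq_zero.1 h0, norm_one] at h1
    exact lt_irrefl _ h1
  have hS : Sα + Sβ = -Sz := by
    refine (hα2.add hβ2).unique (hz2.neg.congr_fun fun n ↦ ?_)
    rcases eq_or_ne n 0 with rfl | hn
    · simp
    have h1 : ∑ e ∈ n.divisors, ∑ c : I with o c.1 = e, (e : ℂ) * z c ^ (n / e) =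
        ∑ c ∈ I with o c ∣ n, o c * z c ^ (n / o c) := by
      rw [Finset.sum_filter, ← Finset.sum_coe_sort I]
      simp only [Finset.sum_filter]
      rw [Finset.sum_comm]
      refine Finset.sum_congr rfl fun c _ ↦ ?_
      rw [Finset.sum_ite_eq]
      simp [hn]
    rw [h1, ← add_div, ← add_mul, ← Finset.sum_add_distrib, ← neg_div, ← neg_mul, ← h n hn]
    congr 2
    refine Finset.sum_congr rfl fun e _ ↦ ?_
    rw [← Finset.sum_add_distrib]
    exact Finset.sum_congr rfl fun v _ ↦ (mul_add _ _ _).symm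
  have h2 := (hα1.add hβ1).cexp
  rw [hS] at h2
  have h3 : Complex.exp (-Sz) = ∏ c ∈ I, (1 - z c * T ^ o c) := by
    have h4 := hz1.unique (hasSum_fintype _)
    rw [h4, ← Finset.sum_neg_distrib, Complex.exp_sum, ← Finset.prod_coe_sort I]
    refine Finset.prod_congr rfl fun c _ ↦ ?_
    rw [neg_neg, Complex.exp_log (hlt hC'1 (zero_le_one.trans hR'1) hT2 (ho c) (hz c))]
  rw [← h3]
  refine h2.congr_fun fun v ↦ ?_
  rw [Function.comp_apply, Complex.exp_add, Complex.exp_neg, Complex.exp_neg,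
    Complex.exp_log (hlt hC hR hT1 (hdeg v) (hα v)), Complex.exp_log (hlt hC hR hT1 (hdeg v) (hβ v)),
    mul_inv]

end EulerProduct

/-! ### Orbits of a permutation of a finite set. -/

section Orbits

/-- Representatives for the orbits of a permutation. -/
theorem exists_orbit_representatives {X : Type*} [Fintype X] [DecidableEq X] (σ : Equiv.Perm X)
    (S : Finset X) (hS : ∀ x, σ x ∈ S ↔ x ∈ S) :
    ∃ R ⊆ S, ∀ {M : Type} [AddCommMonoid M] (g : X → M), (∀ x, g (σ x) = g x) →
      ∑ x ∈ S, g x = ∑ x ∈ R, Function.minimalPeriod σ x • g x := by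
  induction S using Finset.strongInduction with
  | _ S ih =>
    rcases S.eq_empty_or_nonempty with rfl | ⟨x, hx⟩
    · exact ⟨∅, Finset.Subset.refl _, fun g _ ↦ by simp⟩
    · set m := Function.minimalPeriod σ x with hm
      have hper : x ∈ Function.periodicPts σ := Function.Injective.mem_periodicPts σ.injective x
      have hm0 : 0 < m := Function.minimalPeriod_pos_of_mem_periodicPts hper
      -- The orbit of x is removed from S and the induction hypothesis is applied to the rest.
      set O : Finset X := (Finset.range m).image fun i ↦ σ^[i] x with hO
      have hσO : ∀ y, σ y ∈ O ↔ y ∈ O := by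
        have h1 : ∀ y ∈ O, σ y ∈ O := by
          intro y hy
          obtain ⟨i, -, rfl⟩ := Finset.mem_image.1 hy
          rw [← Function.iterate_succ_apply' σ, ← Function.iterate_mod_minimalPeriod_eq]
          exact Finset.mem_image_of_mem _ (Finset.mem_range.2 (Nat.mod_lt _ hm0))
        intro y
        refine ⟨fun hy ↦ ?_, h1 y⟩
        obtain ⟨w, hw, hw'⟩ := Finset.surj_on_of_inj_on_of_card_le (s := O) (t := O)
          (fun a _ ↦ σ a) (fun a ha ↦ h1 a ha) (fun a b _ _ h ↦ σ.injective h) le_rfl _ hy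
        rwa [σ.injective hw']
      have hOS : O ⊆ S := by
        intro y hy
        obtain ⟨i, -, rfl⟩ := Finset.mem_image.1 hy
        clear hy
        induction i with
        | zero => exact hx
        | succ i ih => rw [Function.iterate_succ_apply']; exact (hS _).2 ih
      have hxO : x ∈ O := Finset.mem_image.2 ⟨0, Finset.mem_range.2 hm0, rfl⟩
      obtain ⟨R, hRS, hR⟩ := ih (S \ O) (Finset.sdiff_ssubset hOS ⟨x, hxO⟩) fun y ↦ by
        rw [Finset.mem_sdiff, Finset.mem_sdiff, hS, hσO]
      refine ⟨insert x R, ?_, fun g hg ↦ ?_⟩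
      · exact Finset.insert_subset hx (hRS.trans Finset.sdiff_subset)
      · rw [Finset.sum_insert fun h ↦ (Finset.mem_sdiff.1 (hRS h)).2 hxO, ← hR g hg,
          ← Finset.sum_sdiff hOS, add_comm]
        congr 1
        have h1 : ∀ i, g (σ^[i] x) = g x := by
          intro i
          induction i with
          | zero => rfl
          | succ i ih => rw [Function.iterate_succ_apply', hg, ih]
        rw [hO, Finset.sum_image]
        · rw [Finset.sum_congr rfl fun i _ ↦ h1 i, Finset.sum_const, Finset.card_range]
        · intro i hi j hj h
          exact Function.iterate_injOn_Iio_minimalPeriod (Finset.mem_range.1 hi)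
            (Finset.mem_range.1 hj) h

end Orbits

/-! ### Zeros at s = 1 and uniqueness of the continuation. -/

section OrderOfVanishing

variable {q : ℕ}

theorem differentiable_one_sub_mul_cpow (hq : 1 < q) (o : ℕ) (z : ℂ) :
    Differentiable ℂ fun s : ℂ ↦ 1 - z * ((q : ℂ) ^ (-s)) ^ o := by
  have hq0 : (q : ℂ) ≠ 0 := by exact_mod_cast (by omega : q ≠ 0)
  intro s
  exact (((differentiableAt_id.neg).const_cpow (Or.inl hq0)).pow o).const_mul z |>.const_sub 1

/-- At s = 1 the value is 1 - z / q ^ o. When it vanishes, z ≠ 0 and log q ≠ 0 make the derivative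
nonzero, so the zero is simple. -/
theorem analyticOrderAt_one_sub_mul_cpow (hq : 1 < q) {o : ℕ} (ho : o ≠ 0) (z : ℂ) :
    analyticOrderAt (fun s : ℂ ↦ 1 - z * ((q : ℂ) ^ (-s)) ^ o) 1 =
      ((if z = q ^ o then 1 else 0 : ℕ) : ℕ∞) := by
  have hq0 : (q : ℂ) ≠ 0 := by exact_mod_cast (by omega : q ≠ 0)
  have hana := (differentiable_one_sub_mul_cpow hq o z).analyticAt 1
  have h1 : (1 : ℂ) - z * ((q : ℂ) ^ (-(1 : ℂ))) ^ o = 0 ↔ z = q ^ o := by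
    rw [Complex.cpow_neg_one, inv_pow, sub_eq_zero, eq_comm, ← div_eq_mul_inv,
      div_eq_one_iff_eq (pow_ne_zero _ hq0)]
  split_ifs with hz
  · rw [Nat.cast_one]
    refine hana.analyticOrderAt_eq_one_of_zero_deriv_ne_zero (h1.2 hz) ?_
    have hlog : Complex.log q ≠ 0 := by
      rw [Ne, ← Complex.ofReal_natCast, ← Complex.ofReal_log (Nat.cast_nonneg q),
        Complex.ofReal_eq_zero]
      exact (Real.log_pos (by exact_mod_cast hq)).ne'
    have h2 : HasDerivAt (fun s : ℂ ↦ (q : ℂ) ^ (-s)) ((q : ℂ) ^ (-(1 : ℂ)) * Complex.log q * -1)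
        1 := (hasDerivAt_id (1 : ℂ)).neg.const_cpow (Or.inl hq0)
    have h3 := ((h2.pow o).const_mul z).const_sub 1
    refine ne_of_eq_of_ne h3.deriv ?_
    have h4 : (q : ℂ) ^ (-(1 : ℂ)) ≠ 0 := by
      rw [Complex.cpow_neg_one]
      exact inv_ne_zero hq0
    have hz0 : z ≠ 0 := hz ▸ pow_ne_zero _ hq0
    have ho' : (o : ℂ) ≠ 0 := by exact_mod_cast ho
    simp only [Ne, neg_eq_zero, mul_eq_zero, not_or]
    exact ⟨hz0, ⟨ho', pow_ne_zero _ h4⟩, ⟨h4, hlog⟩, one_ne_zero⟩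
  · rw [Nat.cast_zero, hana.analyticOrderAt_eq_zero, Ne, h1]
    exact hz

theorem analyticOrderAt_prod_one_sub_mul_cpow (hq : 1 < q) {κ : Type*} (I : Finset κ) {o : κ → ℕ}
    (ho : ∀ c, o c ≠ 0) (z : κ → ℂ) :
    analyticOrderAt (fun s : ℂ ↦ ∏ c ∈ I, (1 - z c * ((q : ℂ) ^ (-s)) ^ o c)) 1 =
      ((∑ c ∈ I, if z c = q ^ o c then 1 else 0 : ℕ) : ℕ∞) := by
  classical
  induction I using Finset.induction_on with
  | empty =>
    simp only [Finset.prod_empty, Finset.sum_empty, Nat.cast_zero]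
    rw [analyticAt_const.analyticOrderAt_eq_zero]
    exact one_ne_zero
  | insert c I hc ih =>
    simp only [Finset.prod_insert hc, Finset.sum_insert hc]
    have h1 := (differentiable_one_sub_mul_cpow hq (o c) (z c)).analyticAt 1
    have h2 : AnalyticAt ℂ (fun s : ℂ ↦ ∏ c ∈ I, (1 - z c * ((q : ℂ) ^ (-s)) ^ o c)) 1 :=
      Differentiable.analyticAt (Differentiable.fun_finsetProd fun c _ ↦
        differentiable_one_sub_mul_cpow hq (o c) (z c)) 1
    rw [show (fun s : ℂ ↦ (1 - z c * ((q : ℂ) ^ (-s)) ^ o c) *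
      ∏ c ∈ I, (1 - z c * ((q : ℂ) ^ (-s)) ^ o c)) =
        (fun s : ℂ ↦ 1 - z c * ((q : ℂ) ^ (-s)) ^ o c) *
          fun s : ℂ ↦ ∏ c ∈ I, (1 - z c * ((q : ℂ) ^ (-s)) ^ o c) from rfl,
      analyticOrderAt_mul h1 h2, ih, analyticOrderAt_one_sub_mul_cpow hq (ho c), Nat.cast_add]

/-- An entire function is determined by its values on a right half-plane. -/
theorem Differentiable.eq_of_eqOn_re {f g : ℂ → ℂ} (hf : Differentiable ℂ f)
    (hg : Differentiable ℂ g) {σ : ℝ} (h : ∀ s : ℂ, σ < s.re → f s = g s) : f = g := by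
  refine AnalyticOnNhd.eq_of_eventuallyEq (z₀ := ((σ + 1 : ℝ) : ℂ)) (fun s _ ↦ hf.analyticAt s)
    (fun s _ ↦ hg.analyticAt s) ?_
  have hopen : IsOpen {s : ℂ | σ < s.re} := isOpen_lt continuous_const Complex.continuous_re
  filter_upwards [hopen.mem_nhds (show σ < ((σ + 1 : ℝ) : ℂ).re by simp)] with s hs using h s hs

theorem exists_forall_norm_cpow_lt (hq : 1 < q) {ε : ℝ} (hε : 0 < ε) :
    ∃ σ : ℝ, ∀ s : ℂ, σ < s.re → ‖(q : ℂ) ^ (-s)‖ < ε := by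
  have hq1 : (1 : ℝ) < q := by exact_mod_cast hq
  refine ⟨-(Real.logb q ε), fun s hs ↦ ?_⟩
  rw [Complex.norm_natCast_cpow_of_pos (by omega), Complex.neg_re,
    ← Real.lt_logb_iff_rpow_lt hq1 hε]
  linarith

end OrderOfVanishing

/-! ### Orbits of multiplication by q on ℤ/d. -/

section FrobeniusOrbits

variable {F : Type*} [Field F] [Finite F] {d : ℕ} [NeZero d]

/-- Multiplication by the cardinality of `F`. -/
noncomputable def frobeniusPerm {d : ℕ} (hd : (d : F) ≠ 0) : Equiv.Perm (ZMod d) :=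
  (ZMod.unitOfCoprime (Nat.card F) (card_coprime hd)).mulLeft

theorem frobeniusPerm_apply {d : ℕ} (hd : (d : F) ≠ 0) (c : ZMod d) :
    frobeniusPerm hd c = ((Nat.card F : ℕ) : ZMod d) * c := by
  rw [frobeniusPerm, Units.mulLeft_apply, ZMod.coe_unitOfCoprime]

theorem minimalPeriod_frobeniusPerm {d : ℕ} (hd : (d : F) ≠ 0) (c : ZMod d) :
    Function.minimalPeriod (frobeniusPerm hd) c = frobeniusPeriod F c := by
  have h1 : ∀ n, Function.IsPeriodicPt (frobeniusPerm hd) n c ↔ frobeniusPeriod F c ∣ n := by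
    intro n
    rw [frobeniusPeriod, ← ZMod.natCast_pow_mul_eq_self_iff Nat.card_pos, Function.IsPeriodicPt,
      Function.IsFixedPt]
    have h2 : (frobeniusPerm hd)^[n] c = ((Nat.card F ^ n : ℕ) : ZMod d) * c := by
      induction n with
      | zero => simp
      | succ n ih =>
        rw [Function.iterate_succ_apply', ih, frobeniusPerm_apply, pow_succ']
        push_cast
        ring
    rw [h2]
  refine Nat.dvd_antisymm ?_ ?_
  · rw [← Function.isPeriodicPt_iff_minimalPeriod_dvd, h1]
  · rw [← h1]
    exact Function.isPeriodicPt_minimalPeriod _ _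

/-- Representatives for the orbits of Frobenius on the characters of order greater than two. -/
theorem exists_frobenius_representatives (hd : (d : F) ≠ 0) :
    ∃ R : Finset (ZMod d), (∀ c ∈ R, 2 < addOrderOf c) ∧
      (∀ g : ZMod d → ℂ, (∀ c, g (((Nat.card F : ℕ) : ZMod d) * c) = g c) →
        ∑ c with 2 < addOrderOf c, g c = ∑ c ∈ R, frobeniusPeriod F c * g c) ∧
      ∀ P : ℕ → Prop, ∀ _ : DecidablePred P, (∑ c ∈ R, if P (addOrderOf c) then 1 else 0) =
        ∑ e ∈ d.divisors with 2 < e,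
          if P e then e.totient / orderOf ((Nat.card F : ℕ) : ZMod e) else 0 := by
  classical
  obtain ⟨R, hRS, hR⟩ := exists_orbit_representatives (frobeniusPerm hd)
    ({c | 2 < addOrderOf c} : Finset (ZMod d)) fun c ↦ by
      rw [Finset.mem_filter_univ, Finset.mem_filter_univ, frobeniusPerm_apply,
        ZMod.addOrderOf_natCast_mul (card_coprime hd)]
  have hR2 : ∀ c ∈ R, 2 < addOrderOf c := fun c hc ↦ by simpa using hRS hc
  simp only [frobeniusPerm_apply, minimalPeriod_frobeniusPerm] at hR
  refine ⟨R, hR2, fun g hg ↦ ?_, fun P _ ↦ ?_⟩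
  · rw [hR g hg]
    exact Finset.sum_congr rfl fun c _ ↦ nsmul_eq_mul _ _
  · have h1 : ∀ e, e ∣ d → 2 < e → ({c ∈ R | addOrderOf c = e} : Finset (ZMod d)).card =
        e.totient / orderOf ((Nat.card F : ℕ) : ZMod e) := by
      intro e he he2
      have h2 := hR (fun c ↦ if addOrderOf c = e then 1 else 0) fun c ↦ by
        rw [ZMod.addOrderOf_natCast_mul (card_coprime hd)]
      have : NeZero e := ⟨by omega⟩
      have hpos := ZMod.orderOf_natCast_pos ((card_coprime hd).coprime_dvd_right he)
      rw [← Finset.sum_filter, Finset.filter_filter, Finset.sum_const, smul_eq_mul, mul_one,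
        ← Finset.sum_subset (Finset.filter_subset (fun c ↦ addOrderOf c = e) R)] at h2
      · have h3 : ({c | 2 < addOrderOf c ∧ addOrderOf c = e} : Finset (ZMod d)) =
            ({c | addOrderOf c = e} : Finset (ZMod d)) := by
          ext c
          simp only [Finset.mem_filter_univ]
          omega
        rw [h3, ZMod.card_addOrderOf_eq he] at h2
        rw [h2, Finset.sum_congr rfl (g := fun _ ↦ orderOf ((Nat.card F : ℕ) : ZMod e))
          fun c hc ↦ ?_, Finset.sum_const, smul_eq_mul, Nat.mul_div_cancel _ hpos]
        have h4 := (Finset.mem_filter.1 hc).2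
        rw [if_pos h4, frobeniusPeriod, h4, smul_eq_mul, mul_one]
      · intro c hc hc'
        rw [if_neg fun h ↦ hc' (Finset.mem_filter.2 ⟨hc, h⟩), smul_zero]
    rw [← Finset.sum_fiberwise_of_maps_to (s := R) (t := {e ∈ d.divisors | 2 < e})
      (g := fun c ↦ addOrderOf c)]
    · refine Finset.sum_congr rfl fun e he ↦ ?_
      rw [Finset.mem_filter, Nat.mem_divisors] at he
      rw [← h1 e he.1.1 he.2, Finset.sum_congr rfl (g := fun _ ↦ if P e then 1 else 0) fun c hc ↦ by
        rw [(Finset.mem_filter.1 hc).2], Finset.sum_const]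
      split_ifs <;> simp
    · intro c hc
      rw [Finset.mem_filter, Nat.mem_divisors]
      exact ⟨⟨ZMod.addOrderOf_dvd c, NeZero.ne d⟩, hR2 c hc⟩

end FrobeniusOrbits

namespace WeierstrassCurve

/-! ### Counting points on Weierstrass curves over finite fields. -/

section PointCount

variable {k : Type*} [Field k]

theorem equation_variableChange (C : VariableChange k) (W : WeierstrassCurve k) (x y : k) :
    (C • W).toAffine.Equation x y ↔
      W.toAffine.Equation (C.u ^ 2 * x + C.r) (C.u ^ 3 * y + C.u ^ 2 * C.s * x + C.t) := by
  have hu : (C.u : k) ≠ 0 := C.u.ne_zero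
  rw [Affine.equation_iff', Affine.equation_iff', variableChange_def]
  simp only [Units.val_inv_eq_inv_val]
  rw [← mul_right_inj' (pow_ne_zero 6 hu), mul_zero]
  congr! 1
  field_simp
  ring

theorem natCard_equation_variableChange (C : VariableChange k) (W : WeierstrassCurve k) :
    Nat.card {P : k × k // (C • W).toAffine.Equation P.1 P.2} =
      Nat.card {P : k × k // W.toAffine.Equation P.1 P.2} := by
  have hu : (C.u : k) ≠ 0 := C.u.ne_zero
  refine Nat.card_congr (Equiv.subtypeEquiv
    { toFun := fun P ↦ (C.u ^ 2 * P.1 + C.r, C.u ^ 3 * P.2 + C.u ^ 2 * C.s * P.1 + C.t)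
      invFun := fun P ↦ ((P.1 - C.r) / C.u ^ 2, (P.2 - C.s * (P.1 - C.r) - C.t) / C.u ^ 3)
      left_inv := fun P ↦ by
        ext
        · field_simp; ring
        · field_simp; ring
      right_inv := fun P ↦ by
        ext
        · field_simp; ring
        · field_simp; ring } fun P ↦ equation_variableChange C W P.1 P.2)

theorem natCard_point {W : WeierstrassCurve k} [Finite k] (hΔ : W.Δ ≠ 0) :
    Nat.card W.toAffine.Point = Nat.card {P : k × k // W.toAffine.Equation P.1 P.2} + 1 := by
  rw [Nat.card_congr (Affine.nonsingularPointEquiv W.toAffine), ← Finite.card_option]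
  refine Nat.card_congr (Equiv.optionCongr (Equiv.subtypeEquivRight fun P ↦ ?_))
  exact (Affine.equation_iff_nonsingular_of_Δ_ne_zero hΔ).symm

/-- Each x carries 1 + χ(x(x+1)(x+t)) values of y. With the point at infinity this gives a_v = -S(t)
at good places. -/
theorem natCard_equation_legendreCurve [Finite k] (h2 : (2 : k) ≠ 0) (t : k) :
    (Nat.card {P : k × k // (legendreCurve t).toAffine.Equation P.1 P.2} : ℂ) =
      Nat.card k + legendreSum k t := by
  classical
  have := Fintype.ofFinite k
  have hk : ringChar k ≠ 2 := fun h ↦ h2 (by exact_mod_cast h ▸ ringChar.Nat.cast_ringChar (R := k))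
  have h1 : {P : k × k // (legendreCurve t).toAffine.Equation P.1 P.2} ≃
      Σ x : k, {y : k // y ^ 2 = x * (x + 1) * (x + t)} :=
    (Equiv.subtypeEquivRight fun P : k × k ↦ legendreCurve_equation t P.1 P.2).trans
      (Equiv.subtypeProdEquivSigmaSubtype fun x y : k ↦ y ^ 2 = x * (x + 1) * (x + t))
  rw [Nat.card_congr h1, Nat.card_sigma, legendreSum_eq, Nat.card_eq_fintype_card, ← Finset.card_univ,
    Finset.card_eq_sum_ones]
  push_cast
  rw [← Finset.sum_add_distrib]
  refine Finset.sum_congr rfl fun x _ ↦ ?_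
  have h2 := quadraticChar_card_sqrts hk (x * (x + 1) * (x + t))
  have h3 : quadChar k (x * (x + 1) * (x + t)) = (quadraticChar k (x * (x + 1) * (x + t)) : ℤ) := by
    rw [quadChar, MulChar.ringHomComp_apply]
    simp only [eq_intCast]
    congr!
  have h4 : (Nat.card {y // y ^ 2 = x * (x + 1) * (x + t)} : ℤ) =
      quadraticChar k (x * (x + 1) * (x + t)) + 1 := by
    rw [← h2, Set.toFinset_card, ← Nat.card_eq_fintype_card]
    rfl
  rw [h3, ← Int.cast_natCast, h4]
  push_cast
  ring

end PointCount

/-! ### Splitting of the tangent directions at a node. -/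

section Splitting

variable {k : Type*} [Field k]

/-- The quadratic polynomial cutting out the tangent directions at a node. -/
theorem splits_tangent_iff (h2 : (2 : k) ≠ 0) (W : WeierstrassCurve k) (hc : W.c₄ ≠ 0) :
    Splits (C W.c₄ * X ^ 2 + C (W.a₁ * W.c₄) * X -
      C (54 * W.b₆ - 3 * W.b₂ * W.b₄ + W.a₂ * W.c₄)) ↔ IsSquare (-(W.c₄ * W.c₆)) := by
  set e := 54 * W.b₆ - 3 * W.b₂ * W.b₄ + W.a₂ * W.c₄ with he
  have hdisc : discrim W.c₄ (W.a₁ * W.c₄) (-e) = -(W.c₄ * W.c₆) := by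
    simp only [discrim, he, c₄, c₆, b₂, b₄, b₆]
    ring
  have hp : C W.c₄ * X ^ 2 + C (W.a₁ * W.c₄) * X - C e =
      C W.c₄ * X ^ 2 + C (W.a₁ * W.c₄) * X + C (-e) := by
    rw [C_neg, sub_eq_add_neg]
  have : NeZero (2 : k) := ⟨h2⟩
  rw [hp, ← hdisc]
  constructor
  · intro hs
    obtain ⟨x, hx⟩ := hs.exists_eval_eq_zero (by
      rw [degree_quadratic hc]
      decide)
    refine ⟨2 * W.c₄ * x + W.a₁ * W.c₄, ?_⟩
    rw [discrim_eq_sq_of_quadratic_eq_zero (x := x), sq]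
    simpa [sq] using hx
  · intro hs
    obtain ⟨x, hx⟩ := exists_quadratic_eq_zero hc hs
    have hx' : C W.c₄ * X ^ 2 + C (W.a₁ * W.c₄) * X + C (-e) =
        (X - C x) * (C W.c₄ * X + C (W.c₄ * x + W.a₁ * W.c₄)) := by
      have h3 : -e = -(W.c₄ * (x * x) + W.a₁ * W.c₄ * x) := by linear_combination hx
      rw [h3]
      simp only [C_neg, C_add, C_mul]
      ring
    rw [hx']
    exact (Splits.X_sub_C x).mul (Splits.of_natDegree_le_one natDegree_linear_le)

end Splitting

/-- When t (t - 1) = 0 this is 16. Outside residue characteristic two, c₄ and Δ therefore never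
vanish together, so an integral parameter gives a minimal model with good or multiplicative
reduction. -/
theorem legendreCurve_c₄ {R : Type*} [CommRing R] (t : R) :
    (legendreCurve t).c₄ = 16 * (t ^ 2 - t + 1) := by
  simp only [legendreCurve, c₄, b₂, b₄]
  ring

theorem legendreCurve_c₆ {R : Type*} [CommRing R] (t : R) :
    (legendreCurve t).c₆ = -32 * ((1 + t) * (2 * t - 1) * (t - 2)) := by
  simp only [legendreCurve, c₆, b₂, b₄, b₆]
  ring

theorem legendreCurve_Δ {R : Type*} [CommRing R] (t : R) :
    (legendreCurve t).Δ = 16 * (t ^ 2 * (t - 1) ^ 2) := by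
  simp only [legendreCurve, Δ, b₂, b₄, b₆, b₈]
  ring

theorem map_legendreCurve {R S : Type*} [CommRing R] [CommRing S] (f : R →+* S) (t : R) :
    (legendreCurve t).map f = legendreCurve (f t) := by
  ext <;> simp [legendreCurve]

/-! ### Local polynomials read off from the reduction. -/

section LocalPolynomial

open IsLocalRing IsDedekindDomain.HeightOneSpectrum

variable {R : Type*} [CommRing R] [IsDomain R] [IsDiscreteValuationRing R] {K : Type*}
  [Field K] [Algebra R K] [IsFractionRing R K]

theorem valuation_algebraMap_eq_one_iff (x : R) :
    (IsDiscreteValuationRing.maximalIdeal R).valuation K (algebraMap R K x) = 1 ↔ residue R x ≠ 0 := by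
  have h := valuation_lt_one_iff_mem (K := K) (IsDiscreteValuationRing.maximalIdeal R) x
  have h1 := valuation_le_one (K := K) (IsDiscreteValuationRing.maximalIdeal R) x
  rw [Ne, residue_eq_zero_iff]
  change _ ↔ ¬ x ∈ (IsDiscreteValuationRing.maximalIdeal R).asIdeal
  rw [← h, not_lt]
  exact ⟨fun h ↦ h.ge, fun h ↦ le_antisymm h1 h⟩

theorem hasGoodReduction_iff_reduction_Δ_ne_zero (W : WeierstrassCurve K) [hW : IsMinimal R W] :
    W.HasGoodReduction R ↔ (W.reduction R).Δ ≠ 0 := by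
  rw [hasGoodReduction_iff, ← integralModel_Δ_eq R W, valuation_algebraMap_eq_one_iff,
    reduction, map_Δ]
  exact and_iff_right hW

theorem hasMultiplicativeReduction_iff_reduction (W : WeierstrassCurve K) [hW : IsMinimal R W] :
    W.HasMultiplicativeReduction R ↔ (W.reduction R).Δ = 0 ∧ (W.reduction R).c₄ ≠ 0 := by
  have h3 := valuation_algebraMap_eq_one_iff (K := K) (integralModel R W).Δ
  have h4 := valuation_le_one (K := K) (IsDiscreteValuationRing.maximalIdeal R)
    (integralModel R W).Δ
  rw [hasMultiplicativeReduction_iff, ← integralModel_Δ_eq R W, ← integralModel_c₄_eq R W,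
    valuation_algebraMap_eq_one_iff, reduction, map_Δ, map_c₄, lt_iff_le_and_ne, Ne, h3]
  simp only [h4, true_and, not_not]
  exact and_iff_right hW

theorem hasSplitMultiplicativeReduction_iff_reduction (h2 : (2 : ResidueField R) ≠ 0)
    (W : WeierstrassCurve K) [IsMinimal R W] :
    W.HasSplitMultiplicativeReduction R ↔ W.HasMultiplicativeReduction R ∧
      IsSquare (-((W.reduction R).c₄ * (W.reduction R).c₆)) := by
  have key (h : W.HasMultiplicativeReduction R) :
      (Polynomial.map (algebraMap R (ResidueField R))
        (C (W.integralModel R).c₄ * X ^ 2 + C ((W.integralModel R).a₁ * (W.integralModel R).c₄) * X -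
          C (54 * (W.integralModel R).b₆ - 3 * (W.integralModel R).b₂ * (W.integralModel R).b₄ +
            (W.integralModel R).a₂ * (W.integralModel R).c₄))).Splits ↔
      IsSquare (-((W.reduction R).c₄ * (W.reduction R).c₆)) := by
    rw [← splits_tangent_iff h2 _ ((hasMultiplicativeReduction_iff_reduction W).mp h).2]
    have h54 : residue R 54 = 54 := map_ofNat _ _
    have h3 : residue R 3 = 3 := map_ofNat _ _
    simp [reduction, ResidueField.algebraMap_eq, h54, h3]
  rw [hasSplitMultiplicativeReduction_iff]
  exact ⟨fun ⟨h, hs⟩ ↦ ⟨h, (key h).mp hs⟩, fun ⟨h, hs⟩ ↦ ⟨h, (key h).mpr hs⟩⟩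

open scoped Classical in
/-- The local polynomial in terms of the reduction, in residue characteristic other than two. -/
theorem localPolynomial_eq (h2 : (2 : ResidueField R) ≠ 0) (W : WeierstrassCurve K)
    {V : WeierstrassCurve (ResidueField R)} (hV : (W.minimal R).reduction R = V) :
    W.localPolynomial R =
      if V.Δ ≠ 0 then 1 - C ((Nat.card (ResidueField R) : ℤ) + 1 - Nat.card V.toAffine.Point) * X +
        C (Nat.card (ResidueField R) : ℤ) * X ^ 2
      else if V.c₄ ≠ 0 then if IsSquare (-(V.c₄ * V.c₆)) then 1 - X else 1 + X else 1 := by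
  have hgood := hasGoodReduction_iff_reduction_Δ_ne_zero (R := R) (W.minimal R)
  have hmult := hasMultiplicativeReduction_iff_reduction (R := R) (W.minimal R)
  have hsplit := hasSplitMultiplicativeReduction_iff_reduction h2 (W.minimal R)
  rw [hmult] at hsplit
  unfold localPolynomial
  rw [hV] at hgood hmult hsplit ⊢
  by_cases h3 : V.Δ = 0
  · have hg : ¬ HasGoodReduction R (W.minimal R) := fun h ↦ hgood.mp h h3
    have h3' : ¬ V.Δ ≠ 0 := not_not.mpr h3
    rw [if_neg hg, if_neg h3']
    by_cases h4 : V.c₄ = 0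
    · have hm : ¬ HasMultiplicativeReduction R (W.minimal R) := fun h ↦ (hmult.mp h).2 h4
      have hs : ¬ HasSplitMultiplicativeReduction R (W.minimal R) := fun h ↦ (hsplit.mp h).1.2 h4
      have h4' : ¬ V.c₄ ≠ 0 := not_not.mpr h4
      rw [if_neg hs, if_neg hm, if_neg h4']
    · rw [if_pos h4]
      by_cases h5 : IsSquare (-(V.c₄ * V.c₆))
      · rw [if_pos (hsplit.mpr ⟨⟨h3, h4⟩, h5⟩), if_pos h5]
      · have hs : ¬ HasSplitMultiplicativeReduction R (W.minimal R) := fun h ↦ h5 (hsplit.mp h).2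
        rw [if_neg hs, if_pos (hmult.mpr ⟨h3, h4⟩), if_neg h5]
  · rw [if_pos (hgood.mpr h3), if_pos h3]

variable (K) in
theorem residue_two_ne_zero (h2 : (2 : ResidueField R) ≠ 0) : (2 : K) ≠ 0 := by
  intro h
  have h3 : algebraMap R K 2 = 0 := by rw [map_ofNat, h]
  rw [map_eq_zero_iff _ (IsFractionRing.injective R K)] at h3
  exact h2 (by rw [← map_ofNat (residue R), h3, map_zero])

/-- The minimal models of a Legendre curve with integral parameter have, up to integral changes of
variables, the integral model `y ^ 2 = x (x + 1) (x + t)`. -/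
theorem exists_integralModel_eq_smul_legendreCurve (h2 : (2 : ResidueField R) ≠ 0) {t : R}
    (h0 : t ≠ 0) (h1 : t ≠ 1) (W : WeierstrassCurve K) [IsMinimal R W] {D : VariableChange K}
    (hD : W = D • legendreCurve (algebraMap R K t)) :
    ∃ E : VariableChange R, W.integralModel R = E • legendreCurve t := by
  have h2K : (2 : K) ≠ 0 := residue_two_ne_zero K h2
  have hinj := IsFractionRing.injective R K
  set v := (IsDiscreteValuationRing.maximalIdeal R).valuation K with hv
  have hle (x : R) : v (algebraMap R K x) ≤ 1 := valuation_le_one _ _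
  have hleg : legendreCurve (algebraMap R K t) = (legendreCurve t).baseChange K :=
    (map_legendreCurve _ t).symm
  have hint : IsIntegral R (legendreCurve (algebraMap R K t)) := ⟨_, hleg⟩
  have hu : (D.u : K) ≠ 0 := D.u.ne_zero
  have hvu : v (D.u : K) ≠ 0 := (Valuation.ne_zero_iff _).mpr hu
  have hΔ0 : (legendreCurve (algebraMap R K t)).Δ ≠ 0 := by
    rw [hleg, baseChange, map_Δ, legendreCurve_Δ]
    refine (map_ne_zero_iff _ hinj).mpr ?_
    have h2R : (2 : R) ≠ 0 := fun h ↦ h2 (by rw [← map_ofNat (residue R), h, map_zero])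
    have h16 : (16 : R) = 2 ^ 4 := by norm_num
    rw [h16]
    exact mul_ne_zero (pow_ne_zero _ h2R)
      (mul_ne_zero (pow_ne_zero _ h0) (pow_ne_zero _ (sub_ne_zero.mpr h1)))
  -- the scaling factor is a unit
  have hule : v (D.u : K) ≤ 1 := by
    have hinv : D⁻¹ • W = legendreCurve (algebraMap R K t) := by rw [hD, inv_smul_smul]
    have hint' : IsIntegral R (D⁻¹ • W) := hinv ▸ hint
    have h3 := (IsMinimal.val_Δ_maximal (R := R) (W := W))
    have h4 : valuation_Δ_aux R (D⁻¹ • W) ≤ valuation_Δ_aux R ((1 : VariableChange K) • W) := by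
      rcases le_total (valuation_Δ_aux R (D⁻¹ • W))
        (valuation_Δ_aux R ((1 : VariableChange K) • W)) with h | h
      · exact h
      · exact h3.2 hint' h
    rw [one_smul, ← Subtype.coe_le_coe, valuation_Δ_aux_eq_of_isIntegral,
      valuation_Δ_aux_eq_of_isIntegral, hinv] at h4
    have h5 : (legendreCurve (algebraMap R K t)).Δ = D.u ^ 12 * W.Δ := by
      rw [hD, variableChange_Δ]
      simp
    have h6 : v W.Δ ≠ 0 := by
      rw [Valuation.ne_zero_iff]
      rintro h
      rw [h, mul_zero] at h5
      exact hΔ0 h5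
    change v _ ≤ v _ at h4
    rw [h5, map_mul, map_pow] at h4
    have h7 : v (D.u : K) ^ 12 ≤ 1 := by
      refine le_of_mul_le_mul_right ?_ (zero_lt_iff.mpr h6)
      rwa [one_mul]
    exact (pow_le_one_iff_of_nonneg zero_le (by norm_num)).mp h7
  have huge : 1 ≤ v (D.u : K) := by
    have key (n : ℕ) (hn : n ≠ 0) (a b : R) (hb : residue R b ≠ 0)
        (hab : algebraMap R K b = D.u ^ n * algebraMap R K a) : 1 ≤ v (D.u : K) := by
      have h8 := congrArg v hab
      rw [(valuation_algebraMap_eq_one_iff b).mpr hb, map_mul, map_pow] at h8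
      by_contra hlt
      rw [not_le] at hlt
      have h9 : v (D.u : K) ^ n < 1 := pow_lt_one₀ zero_le hlt hn
      exact absurd h8.symm (mul_lt_one_of_lt_of_le h9 (hle a)).ne
    -- Either Δ or c₄ of the Legendre model is a unit, and it equals a power of the scaling factor
    -- times an integral quantity of W, so the scaling factor has valuation at least 1.
    by_cases hr : residue R (legendreCurve t).Δ = 0
    · refine key 4 (by norm_num) (W.integralModel R).c₄ (legendreCurve t).c₄ ?_ ?_
      · rw [← map_Δ, map_legendreCurve, legendreCurve_Δ] at hr
        rw [← map_c₄, map_legendreCurve, legendreCurve_c₄]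
        have h16 : (16 : ResidueField R) ≠ 0 := by
          have : (16 : ResidueField R) = 2 ^ 4 := by norm_num
          rw [this]
          exact pow_ne_zero _ h2
        refine mul_ne_zero h16 ?_
        have h10 : residue R t * (residue R t - 1) = 0 := by
          have := (mul_eq_zero.mp hr).resolve_left h16
          rw [← mul_pow] at this
          exact pow_eq_zero_iff (by norm_num) |>.mp this
        have : residue R t ^ 2 - residue R t + 1 = 1 := by linear_combination h10
        rw [this]
        exact one_ne_zero
      · rw [integralModel_c₄_eq, hD, variableChange_c₄, hleg, baseChange, map_c₄]
        simp
    · refine key 12 (by norm_num) (W.integralModel R).Δ (legendreCurve t).Δ hr ?_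
      rw [integralModel_Δ_eq, hD, variableChange_Δ, hleg, baseChange, map_Δ]
      simp
  have hu1 : v (D.u : K) = 1 := le_antisymm hule huge
  obtain ⟨w, hw⟩ := IsDiscreteValuationRing.exists_lift_of_le_one hule
  have hwu : IsUnit w := by
    rw [← residue_ne_zero_iff_isUnit, ← valuation_algebraMap_eq_one_iff (K := K), hw, ← hv, hu1]
  have h2u : IsUnit (2 : R) := by
    rw [← residue_ne_zero_iff_isUnit, map_ofNat]
    exact h2
  obtain ⟨i2, hi2⟩ := h2u.exists_left_inv
  have hi2' : algebraMap R K i2 * 2 = 1 := by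
    rw [← map_ofNat (algebraMap R K), ← map_mul, hi2, map_one]
  set I := W.integralModel R with hI
  have ha1 : algebraMap R K I.a₁ = (D.u : K)⁻¹ * (2 * D.s) := by
    rw [integralModel_a₁_eq, hD, variableChange_a₁]
    simp [legendreCurve]
  have ha3 : algebraMap R K I.a₃ = (D.u : K)⁻¹ ^ 3 * (2 * D.t) := by
    rw [integralModel_a₃_eq, hD, variableChange_a₃]
    simp [legendreCurve]
  have ha6 : algebraMap R K I.a₆ = (D.u : K)⁻¹ ^ 6 * (D.r * algebraMap R K t +
      D.r ^ 2 * (1 + algebraMap R K t) + D.r ^ 3 - D.t ^ 2) := by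
    rw [integralModel_a₆_eq, hD, variableChange_a₆]
    simp [legendreCurve]
  have hs : algebraMap R K (i2 * (w * I.a₁)) = D.s := by
    rw [map_mul, map_mul, hw, ha1, mul_inv_cancel_left₀ hu, ← mul_assoc, hi2', one_mul]
  have ht : algebraMap R K (i2 * (w ^ 3 * I.a₃)) = D.t := by
    rw [map_mul, map_mul, map_pow, hw, ha3, ← mul_assoc (_ ^ 3), ← mul_pow, mul_inv_cancel₀ hu,
      one_pow, one_mul, ← mul_assoc, hi2', one_mul]
  -- The formula for a₆ is a monic cubic equation for r over R, and R is integrally closed. The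
  -- other two parameters come from a₁ and a₃ on dividing by the unit 2.
  obtain ⟨r, hr⟩ : ∃ r : R, algebraMap R K r = D.r := by
    refine IsIntegrallyClosed.isIntegral_iff.mp ⟨X ^ 3 + C (1 + t) * X ^ 2 + C t * X +
      C (-(w ^ 6 * I.a₆ + (i2 * (w ^ 3 * I.a₃)) ^ 2)), ?_, ?_⟩
    · monicity!
    · simp only [eval₂_add, eval₂_mul, eval₂_pow, eval₂_X, eval₂_C]
      rw [map_neg, map_add, map_add, map_one, map_mul, map_pow _ _ 2, ht, map_pow, hw, ha6, ← mul_assoc (_ ^ 6), ← mul_pow,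
        mul_inv_cancel₀ hu]
      ring
  refine ⟨⟨hwu.unit, r, i2 * (w * I.a₁), i2 * (w ^ 3 * I.a₃)⟩, ?_⟩
  refine map_injective hinj ?_
  beta_reduce
  rw [← map_variableChange, map_legendreCurve]
  change I.baseChange K = _
  rw [baseChange_integralModel_eq]
  conv_lhs => rw [hD]
  congr 1
  ext
  · simp [VariableChange.map, hw]
  · simp [VariableChange.map, hr]
  · simp only [VariableChange.map, hs]
  · simp only [VariableChange.map, ht]

/-- The sum S handles all reduction types at once. For good reduction it is -a_v; at residue 0 it is
-1, matching a split node since -c₄c₆ is then a square; at residue 1 it is -χ(-1), since -c₄c₆ is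
then -1 times a nonzero square. -/
theorem aeval_localPolynomial_of_smul_eq_legendreCurve [Finite (ResidueField R)]
    (h2 : (2 : ResidueField R) ≠ 0) {t : R} (h0 : t ≠ 0) (h1 : t ≠ 1) {W : WeierstrassCurve K}
    {D : VariableChange K} (hD : D • W = legendreCurve (algebraMap R K t)) (T : ℂ) :
    aeval T (W.localPolynomial R) = 1 + legendreSum (ResidueField R) (residue R t) * T +
      legendreDet (ResidueField R) (residue R t) * T ^ 2 := by
  obtain ⟨B, hB⟩ : ∃ B : VariableChange K, W.minimal R = B • W := ⟨_, rfl⟩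
  obtain ⟨E, hE⟩ := exists_integralModel_eq_smul_legendreCurve h2 h0 h1 (W.minimal R)
    (D := B * D⁻¹) (by rw [hB, ← hD, mul_smul, inv_smul_smul])
  have hV : (W.minimal R).reduction R =
      E.map (residue R) • legendreCurve (residue R t) := by
    rw [reduction, hE, ← map_variableChange, map_legendreCurve]
  rw [localPolynomial_eq h2 W hV]
  set τ := residue R t
  set E' := E.map (residue R)
  have hu : ((E'.u⁻¹ : (ResidueField R)ˣ) : ResidueField R) ≠ 0 := Units.ne_zero _
  have h16 : (16 : ResidueField R) ≠ 0 := by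
    have : (16 : ResidueField R) = 2 ^ 4 := by norm_num
    rw [this]
    exact pow_ne_zero _ h2
  have hΔ : (E' • legendreCurve τ).Δ ≠ 0 ↔ τ ≠ 0 ∧ τ ≠ 1 := by
    rw [variableChange_Δ, legendreCurve_Δ]
    simp [h16, sub_eq_zero]
  by_cases hτ : τ ≠ 0 ∧ τ ≠ 1
  · rw [if_pos (hΔ.mpr hτ), natCard_point (hΔ.mpr hτ), natCard_equation_variableChange]
    have h3 := natCard_equation_legendreCurve h2 τ
    have h4 : legendreDet (ResidueField R) τ = Nat.card (ResidueField R) := by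
      rw [legendreDet, if_neg (by tauto)]
    rw [h4]
    simp only [map_add, map_sub, map_one, map_mul, map_pow, aeval_X, map_natCast,
      Nat.cast_add, Nat.cast_one, h3]
    ring
  · rw [if_neg (mt hΔ.mp hτ)]
    have hτ' : τ = 0 ∨ τ = 1 := by tauto
    have hc : (E' • legendreCurve τ).c₄ ≠ 0 := by
      rw [variableChange_c₄, legendreCurve_c₄]
      refine mul_ne_zero (pow_ne_zero _ hu) (mul_ne_zero h16 ?_)
      rcases hτ' with h | h <;> simp [h]
    have h4 : legendreDet (ResidueField R) τ = 0 := by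
      rw [legendreDet, if_pos hτ']
    have h5 : -((E' • legendreCurve τ).c₄ * (E' • legendreCurve τ).c₆) =
        ((E'.u⁻¹ : (ResidueField R)ˣ) ^ 5 : ResidueField R) ^ 2 *
          -((legendreCurve τ).c₄ * (legendreCurve τ).c₆) := by
      rw [variableChange_c₄, variableChange_c₆]
      ring
    rw [if_pos hc, h4, h5]
    rcases hτ' with h | h
    · rw [if_pos, h, legendreSum_zero h2]
      · simp
        ring
      · rw [legendreCurve_c₄, legendreCurve_c₆, h]
        exact ⟨(E'.u⁻¹ : (ResidueField R)ˣ) ^ 5 * 32, by ring⟩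
    · have h6 : IsSquare (((E'.u⁻¹ : (ResidueField R)ˣ) ^ 5 : ResidueField R) ^ 2 *
          -((legendreCurve τ).c₄ * (legendreCurve τ).c₆)) ↔ IsSquare (-1 : ResidueField R) := by
        have h7 : ((E'.u⁻¹ : (ResidueField R)ˣ) ^ 5 : ResidueField R) ^ 2 *
            -((legendreCurve τ).c₄ * (legendreCurve τ).c₆) =
              ((E'.u⁻¹ : (ResidueField R)ˣ) ^ 5 * (16 * 2) : ResidueField R) ^ 2 * (-1) := by
          rw [legendreCurve_c₄, legendreCurve_c₆, h]
          ring
        rw [h7]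
        refine ⟨fun ⟨y, hy⟩ ↦ ?_, fun ⟨y, hy⟩ ↦ ?_⟩
        · refine ⟨y / ((E'.u⁻¹ : (ResidueField R)ˣ) ^ 5 * (16 * 2) : ResidueField R), ?_⟩
          rw [div_mul_div_comm, ← hy, ← sq, mul_div_cancel_left₀]
          exact pow_ne_zero _ (mul_ne_zero (pow_ne_zero _ hu) (mul_ne_zero h16 h2))
        · rw [hy]
          exact ⟨(E'.u⁻¹ : (ResidueField R)ˣ) ^ 5 * (16 * 2) * y, by ring⟩
      by_cases h8 : IsSquare (-1 : ResidueField R)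
      · rw [if_pos (h6.mpr h8), h, legendreSum_one h2,
          quadChar_of_isSquare (neg_ne_zero.mpr one_ne_zero) h8]
        simp
        ring
      · rw [if_neg (mt h6.mp h8), h, legendreSum_one h2, quadChar_of_not_isSquare h8]
        simp

end LocalPolynomial

end WeierstrassCurve

/-! ### Places of a field generated by one element over its constants. -/

namespace FunctionFieldPlace

open IsLocalRing

variable {k K : Type*} [Field k] [Field K] [Algebra k K]

/-- The residue field at a place as an algebra over the field of constants. -/
noncomputable abbrev residueAlgebra (v : FunctionFieldPlace k K) :
    Algebra k (ResidueField v.ring) :=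
  v.residueMap.toAlgebra

attribute [local instance] residueAlgebra

theorem degree_eq_finrank (v : FunctionFieldPlace k K) :
    v.degree = Module.finrank k (ResidueField v.ring) :=
  rfl

theorem residueField_algebraMap_apply (v : FunctionFieldPlace k K) (c : k) :
    algebraMap k (ResidueField v.ring) c = residue v.ring ⟨algebraMap k K c, v.algebraMap_mem c⟩ :=
  rfl

variable {v w : FunctionFieldPlace k K}

theorem aeval_mem {x : K} (hx : x ∈ v.ring) (f : k[X]) : aeval x f ∈ v.ring := by
  rw [aeval_eq_sum_range]
  refine sum_mem fun i _ ↦ ?_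
  rw [Algebra.smul_def]
  exact mul_mem (v.algebraMap_mem _) (pow_mem hx i)

theorem aeval_residue {x : K} (hx : x ∈ v.ring) (f : k[X]) :
    aeval (residue v.ring ⟨x, hx⟩) f = residue v.ring ⟨aeval x f, aeval_mem hx f⟩ := by
  induction f using Polynomial.induction_on' with
  | add f g hf hg =>
    rw [map_add, hf, hg, ← map_add]
    congr 1
    ext
    simp
  | monomial n a =>
    rw [aeval_monomial, residueField_algebraMap_apply, ← map_pow, ← map_mul]
    congr 1
    ext
    simp [aeval_monomial]

theorem aeval_residue_eq_zero_iff {x : K} (hx : x ∈ v.ring) (f : k[X]) :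
    aeval (residue v.ring ⟨x, hx⟩) f = 0 ↔ v.ring.valuation (aeval x f) < 1 := by
  rw [aeval_residue, residue_eq_zero_iff, ValuationSubring.valuation_lt_one_iff]

/-- The fractions `f(x) / g(x)` exhaust `K`. -/
def IsGenerator (k : Type*) {K : Type*} [Field k] [Field K] [Algebra k K] (x : K) : Prop :=
  ∀ a : K, ∃ f g : k[X], aeval x g ≠ 0 ∧ a * aeval x g = aeval x f

theorem IsGenerator.exists_isCoprime {x : K} (h : IsGenerator k x) (a : K) :
    ∃ f g : k[X], IsCoprime f g ∧ a * aeval x g = aeval x f := by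
  classical
  obtain ⟨f, g, hg, hfg⟩ := h a
  obtain ⟨f', hf'⟩ := EuclideanDomain.gcd_dvd_left f g
  obtain ⟨g', hg'⟩ := EuclideanDomain.gcd_dvd_right f g
  have hd := EuclideanDomain.gcd_eq_gcd_ab f g
  set δ := EuclideanDomain.gcd f g
  have hδ : aeval x δ ≠ 0 := fun h ↦ hg (by rw [hg', map_mul, h, zero_mul])
  have hδ0 : δ ≠ 0 := fun h ↦ hδ (by rw [h, map_zero])
  refine ⟨f', g', ⟨EuclideanDomain.gcdA f g, EuclideanDomain.gcdB f g, ?_⟩, ?_⟩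
  · refine mul_left_cancel₀ hδ0 ?_
    rw [mul_one]
    conv_rhs => rw [hd]
    linear_combination (-EuclideanDomain.gcdA f g) * hf' - EuclideanDomain.gcdB f g * hg'
  · refine mul_left_cancel₀ hδ ?_
    rw [← map_mul, ← hf', ← hfg]
    conv_rhs => rw [hg', map_mul]
    ring

/-- Write a = f(x) / g(x) in lowest terms. If g vanished at the residue of x, then so would f,
contradicting the Bézout relation. -/
theorem exists_aeval_residue_ne_zero {x : K} (h : IsGenerator k x) (hx : x ∈ v.ring) {a : K}
    (ha : a ∈ v.ring) : ∃ f g : k[X], aeval (residue v.ring ⟨x, hx⟩) g ≠ 0 ∧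
      a * aeval x g = aeval x f := by
  obtain ⟨f, g, ⟨b, c, hbc⟩, hfg⟩ := h.exists_isCoprime a
  refine ⟨f, g, fun hg ↦ ?_, hfg⟩
  have hf : aeval (residue v.ring ⟨x, hx⟩) f = 0 := by
    have h1 : (⟨aeval x f, aeval_mem hx f⟩ : v.ring) = ⟨a, ha⟩ * ⟨aeval x g, aeval_mem hx g⟩ := by
      ext
      exact hfg.symm
    rw [aeval_residue hx f, h1, map_mul, ← aeval_residue hx g, hg, mul_zero]
  have h2 := congrArg (aeval (residue v.ring ⟨x, hx⟩)) hbc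
  rw [map_add, map_mul, map_mul, hf, hg] at h2
  simp at h2

theorem mem_of_aeval_residue_ne_zero {x : K} (hx : x ∈ v.ring) {a : K} {f g : k[X]}
    (hg : aeval (residue v.ring ⟨x, hx⟩) g ≠ 0) (hfg : a * aeval x g = aeval x f) :
    a ∈ v.ring := by
  rw [Ne, aeval_residue_eq_zero_iff, not_lt] at hg
  have h1 : v.ring.valuation (aeval x g) = 1 :=
    le_antisymm ((v.ring.valuation_le_one_iff _).mpr (aeval_mem hx g)) hg
  rw [← ValuationSubring.valuation_le_one_iff]
  have h2 := (v.ring.valuation_le_one_iff _).mpr (aeval_mem hx f)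
  rw [← hfg, map_mul, h1, mul_one] at h2
  exact h2

theorem ext_ring (h : v.ring = w.ring) : v = w := by
  cases v
  cases w
  congr

/-- A place at which a generator is integral is determined by the reduction of polynomials in this
generator. -/
theorem eq_of_aeval_residue_eq_zero_iff {x : K} (h : IsGenerator k x) (hv : x ∈ v.ring)
    (hw : x ∈ w.ring) (hvw : ∀ g : k[X], aeval (residue v.ring ⟨x, hv⟩) g = 0 ↔
      aeval (residue w.ring ⟨x, hw⟩) g = 0) : v = w := by
  refine ext_ring (SetLike.ext fun a ↦ ⟨fun ha ↦ ?_, fun ha ↦ ?_⟩)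
  · obtain ⟨f, g, hg, hfg⟩ := exists_aeval_residue_ne_zero h hv ha
    exact mem_of_aeval_residue_ne_zero hw (mt (hvw g).mpr hg) hfg
  · obtain ⟨f, g, hg, hfg⟩ := exists_aeval_residue_ne_zero h hw ha
    exact mem_of_aeval_residue_ne_zero hv (mt (hvw g).mp hg) hfg

/-- If the residue were transcendental, every nonzero polynomial in x would be a unit and the
valuation ring would be a field. -/
theorem isIntegral_residue {x : K} (h : IsGenerator k x) (hx : x ∈ v.ring) : IsIntegral k (residue v.ring ⟨x, hx⟩) := by
  rw [← isAlgebraic_iff_isIntegral]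
  by_contra hξ
  refine IsDiscreteValuationRing.not_isField v.ring ?_
  refine ⟨⟨0, 1, zero_ne_one⟩, mul_comm, fun {a} ha ↦ ?_⟩
  have ha' : (a : K) ≠ 0 := fun h ↦ ha (Subtype.ext h)
  obtain ⟨f, g, hg, hfg⟩ := h (a : K)⁻¹
  have hg0 : g ≠ 0 := fun h ↦ hg (by rw [h, map_zero])
  refine ⟨⟨(a : K)⁻¹, mem_of_aeval_residue_ne_zero hx (fun h0 ↦ hξ ⟨g, hg0, h0⟩) hfg⟩, ?_⟩
  ext
  exact mul_inv_cancel₀ ha'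

/-- The denominator is prime to the minimal polynomial of the residue, so it can be inverted by a
polynomial in that residue. -/
theorem aeval_residue_surjective {x : K} (h : IsGenerator k x) (hx : x ∈ v.ring) : Function.Surjective (aeval (R := k) (residue v.ring ⟨x, hx⟩)) := by
  intro y
  obtain ⟨⟨a, ha⟩, rfl⟩ := residue_surjective y
  obtain ⟨f, g, hg, hfg⟩ := exists_aeval_residue_ne_zero h hx ha
  have hint := isIntegral_residue h hx
  set ξ := residue v.ring ⟨x, hx⟩
  obtain ⟨b, hb⟩ : ∃ b : k[X], aeval ξ b * aeval ξ g = 1 := by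
    have h1 : IsCoprime (minpoly k ξ) g := by
      rw [(minpoly.irreducible hint).coprime_iff_not_dvd]
      rwa [Ne, minpoly.dvd_iff] at *
    obtain ⟨c, b, hcb⟩ := h1
    refine ⟨b, ?_⟩
    have := congrArg (aeval ξ) hcb
    simpa using this
  refine ⟨f * b, ?_⟩
  have h1 : (⟨aeval x f, aeval_mem hx f⟩ : v.ring) = ⟨a, ha⟩ * ⟨aeval x g, aeval_mem hx g⟩ := by
    ext
    exact hfg.symm
  rw [map_mul, aeval_residue hx f, h1, map_mul, ← aeval_residue hx g, mul_assoc, mul_comm _ (aeval ξ b),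
    hb, mul_one]

theorem degree_eq_natDegree_minpoly {x : K} (h : IsGenerator k x) (hx : x ∈ v.ring) : v.degree = (minpoly k (residue v.ring ⟨x, hx⟩)).natDegree := by
  have htop : IntermediateField.adjoin k {residue v.ring ⟨x, hx⟩} = ⊤ := by
    refine eq_top_iff.mpr fun y _ ↦ ?_
    obtain ⟨f, rfl⟩ := aeval_residue_surjective h hx y
    exact IntermediateField.algebra_adjoin_le_adjoin _ _ (aeval_mem_adjoin_singleton k _)
  rw [degree_eq_finrank, ← IntermediateField.adjoin.finrank (isIntegral_residue h hx), htop,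
    IntermediateField.finrank_top']

theorem minpoly_residue_injective {x : K} (h : IsGenerator k x) (hv : x ∈ v.ring)
    (hw : x ∈ w.ring)
    (hvw : minpoly k (residue v.ring ⟨x, hv⟩) = minpoly k (residue w.ring ⟨x, hw⟩)) : v = w :=
  eq_of_aeval_residue_eq_zero_iff h hv hw fun g ↦ by
    rw [← minpoly.dvd_iff, ← minpoly.dvd_iff, hvw]

/-! ### The places of F(u): monic irreducible polynomials and infinity. -/

section RatFunc

variable (F : Type*) [Field F]

theorem aeval_ratFunc_X (f : F[X]) :
    aeval (RatFunc.X : RatFunc F) f = algebraMap F[X] (RatFunc F) f := by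
  rw [← RatFunc.algebraMap_X, aeval_algebraMap_apply, aeval_X_left_apply]

theorem isGenerator_X : IsGenerator F (RatFunc.X : RatFunc F) := fun a ↦ by
  refine ⟨a.num, a.denom, ?_, ?_⟩
  · rw [aeval_ratFunc_X]
    exact RatFunc.algebraMap_ne_zero a.denom_ne_zero
  · rw [aeval_ratFunc_X, aeval_ratFunc_X]
    nth_rewrite 1 [← RatFunc.num_div_denom a]
    exact div_mul_cancel₀ _ (RatFunc.algebraMap_ne_zero a.denom_ne_zero)

/-- Reversing the coefficients rewrites a fraction in X as one in X⁻¹. The general results then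
apply to the place at infinity with X⁻¹ as generator. -/
theorem isGenerator_X_inv : IsGenerator F (RatFunc.X : RatFunc F)⁻¹ := fun a ↦ by
  have hX : (RatFunc.X : RatFunc F) ≠ 0 := RatFunc.X_ne_zero
  have : Invertible (RatFunc.X : RatFunc F) := invertibleOfNonzero hX
  have key (f : F[X]) : aeval (RatFunc.X : RatFunc F) f =
      aeval (RatFunc.X : RatFunc F)⁻¹ f.reverse * RatFunc.X ^ f.natDegree := by
    rw [aeval_def, aeval_def, ← eval₂_reverse_mul_pow _ (RatFunc.X : RatFunc F) f,
      invOf_eq_inv]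
  obtain ⟨f, g, hg, hfg⟩ := isGenerator_X F a
  rw [key] at hg
  rw [key, key] at hfg
  refine ⟨f.reverse * X ^ g.natDegree, g.reverse * X ^ f.natDegree, ?_, ?_⟩
  · rw [map_mul, map_pow, aeval_X]
    exact mul_ne_zero (left_ne_zero_of_mul hg) (pow_ne_zero _ (inv_ne_zero hX))
  · rw [map_mul, map_mul, map_pow, map_pow, aeval_X]
    rw [inv_pow, inv_pow, ← div_eq_mul_inv, ← div_eq_mul_inv, mul_div_assoc',
      div_eq_div_iff (pow_ne_zero _ hX) (pow_ne_zero _ hX), ← hfg, mul_assoc]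

variable {F}

theorem valuation_valuationSubring_lt_one_iff {K Γ : Type*} [Field K]
    [LinearOrderedCommGroupWithZero Γ] (v : Valuation K Γ) (x : K) :
    v.valuationSubring.valuation x < 1 ↔ v x < 1 :=
  ((Valuation.isEquiv_iff_val_lt_one).mp (Valuation.isEquiv_valuation_valuationSubring v)).symm

/-- The place of `F(u)` at a monic irreducible polynomial. -/
noncomputable def ofIrreducible (P : F[X]) (hP : Irreducible P) :
    FunctionFieldPlace F (RatFunc F) where
  ring := ((IsDedekindDomain.HeightOneSpectrum.mk (Ideal.span {P})
    ((Ideal.span_singleton_prime hP.ne_zero).mpr hP.prime)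
    (by simpa using hP.ne_zero)).valuation (RatFunc F)).valuationSubring
  algebraMap_mem c := by
    rw [Valuation.mem_valuationSubring_iff, RatFunc.algebraMap_eq_C, ← RatFunc.algebraMap_C]
    exact IsDedekindDomain.HeightOneSpectrum.valuation_le_one _ _
  isDVR := inferInstance

theorem X_mem_ofIrreducible {P : F[X]} (hP : Irreducible P) :
    RatFunc.X ∈ (ofIrreducible P hP).ring := by
  rw [← RatFunc.algebraMap_X]
  exact (Valuation.mem_valuationSubring_iff _ _).mpr
    (IsDedekindDomain.HeightOneSpectrum.valuation_le_one _ _)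

theorem minpoly_ofIrreducible {P : F[X]} (hP : Irreducible P) (hm : P.Monic) :
    minpoly F (residue (ofIrreducible P hP).ring ⟨RatFunc.X, X_mem_ofIrreducible hP⟩) = P := by
  refine (minpoly.eq_of_irreducible_of_monic hP ?_ hm).symm
  rw [aeval_residue_eq_zero_iff, aeval_ratFunc_X]
  refine (valuation_valuationSubring_lt_one_iff _ _).mpr ?_
  rw [IsDedekindDomain.HeightOneSpectrum.valuation_lt_one_iff_mem]
  exact Ideal.mem_span_singleton_self P

open scoped Classical in
/-- The place of `F(u)` at infinity. -/
noncomputable def infinity (F : Type*) [Field F] : FunctionFieldPlace F (RatFunc F) where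
  ring := (RatFunc.inftyValuation F).valuationSubring
  algebraMap_mem c := by
    rw [Valuation.mem_valuationSubring_iff, RatFunc.algebraMap_eq_C]
    rcases eq_or_ne c 0 with rfl | hc
    · simp
    · rw [RatFunc.inftyValuation.C F hc]
  isDVR := inferInstance

theorem X_notMem_infinity : RatFunc.X ∉ (infinity F).ring := by
  classical
  intro h
  have h1 := (Valuation.mem_valuationSubring_iff _ _).mp h
  rw [RatFunc.inftyValuation.X, ← WithZero.exp_zero, WithZero.exp_le_exp] at h1
  omega

theorem X_inv_mem {v : FunctionFieldPlace F (RatFunc F)} (hv : RatFunc.X ∉ v.ring) :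
    (RatFunc.X : RatFunc F)⁻¹ ∈ v.ring :=
  (v.ring.mem_or_inv_mem RatFunc.X).resolve_left hv

theorem residue_X_inv {v : FunctionFieldPlace F (RatFunc F)} (hv : RatFunc.X ∉ v.ring) :
    residue v.ring ⟨RatFunc.X⁻¹, X_inv_mem hv⟩ = 0 := by
  rw [residue_eq_zero_iff, ValuationSubring.valuation_lt_one_iff]
  rw [← ValuationSubring.valuation_le_one_iff, not_le] at hv
  change v.ring.valuation (RatFunc.X⁻¹) < 1
  rw [map_inv₀]
  exact inv_lt_one_of_one_lt₀ hv

/-- At a place where X is not integral X⁻¹ has residue 0, and this residue determines the place. -/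
theorem eq_infinity {v : FunctionFieldPlace F (RatFunc F)} (hv : RatFunc.X ∉ v.ring) :
    v = infinity F := by
  refine minpoly_residue_injective (isGenerator_X_inv F) (X_inv_mem hv)
    (X_inv_mem X_notMem_infinity) ?_
  rw [residue_X_inv hv, residue_X_inv X_notMem_infinity, minpoly.zero, minpoly.zero]

theorem degree_infinity : (infinity F).degree = 1 := by
  rw [degree_eq_natDegree_minpoly (isGenerator_X_inv F) (X_inv_mem X_notMem_infinity),
    residue_X_inv X_notMem_infinity, minpoly.zero, natDegree_X]

theorem degree_ofIrreducible {P : F[X]} (hP : Irreducible P) (hm : P.Monic) :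
    (ofIrreducible P hP).degree = P.natDegree := by
  rw [degree_eq_natDegree_minpoly (isGenerator_X F) (X_mem_ofIrreducible hP),
    minpoly_ofIrreducible hP hm]

/-- The places of `F(u)` are the place at infinity and those at the monic irreducible
polynomials. -/
noncomputable def optionEquiv (F : Type*) [Field F] :
    Option {P : F[X] // P.Monic ∧ Irreducible P} ≃ FunctionFieldPlace F (RatFunc F) :=
  Equiv.ofBijective (fun v ↦ v.elim (infinity F) fun P ↦ ofIrreducible P.1 P.2.2) <| by
    constructor
    · rintro (_ | P) (_ | Q) h
      · rfl
      · have h' : infinity F = ofIrreducible Q.1 Q.2.2 := h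
        exact (X_notMem_infinity (h'.symm ▸ X_mem_ofIrreducible Q.2.2)).elim
      · have h' : ofIrreducible P.1 P.2.2 = infinity F := h
        exact (X_notMem_infinity (h' ▸ X_mem_ofIrreducible P.2.2)).elim
      · have hPQ : ofIrreducible P.1 P.2.2 = ofIrreducible Q.1 Q.2.2 := h
        have h1 := minpoly_ofIrreducible P.2.2 P.2.1
        have h2 := minpoly_ofIrreducible Q.2.2 Q.2.1
        have h3 : ∀ v w : FunctionFieldPlace F (RatFunc F), v = w → ∀ (hv : RatFunc.X ∈ v.ring)
            (hw : RatFunc.X ∈ w.ring), minpoly F (residue v.ring ⟨RatFunc.X, hv⟩) =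
              minpoly F (residue w.ring ⟨RatFunc.X, hw⟩) := by
          rintro v _ rfl hv hw
          rfl
        rw [h3 _ _ hPQ _ (X_mem_ofIrreducible Q.2.2), h2] at h1
        exact congrArg some (Subtype.ext h1.symm)
    · intro v
      by_cases hv : RatFunc.X ∈ v.ring
      · have hint := isIntegral_residue (isGenerator_X F) hv
        refine ⟨some ⟨minpoly F (residue v.ring ⟨RatFunc.X, hv⟩), minpoly.monic hint,
          minpoly.irreducible hint⟩, ?_⟩
        exact minpoly_residue_injective (isGenerator_X F) (X_mem_ofIrreducible (minpoly.irreducible hint)) hv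
          (minpoly_ofIrreducible (minpoly.irreducible hint) (minpoly.monic hint))
      · exact ⟨none, (eq_infinity hv).symm⟩

theorem finite_residueField [Finite F] (v : FunctionFieldPlace F (RatFunc F)) :
    Finite (ResidueField v.ring) := by
  have h1 : 0 < v.degree := by
    obtain ⟨(_ | P), rfl⟩ := (optionEquiv F).surjective v
    · exact (degree_infinity (F := F)).symm ▸ one_pos
    · exact (degree_ofIrreducible P.2.2 P.2.1).symm ▸ P.2.2.natDegree_pos
  have := Module.finite_of_finrank_pos (h1.trans_eq (degree_eq_finrank v))
  exact Module.finite_of_finite F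

end RatFunc

end FunctionFieldPlace

namespace WeierstrassCurve

open IsLocalRing

/-! ### The case of a parameter with a pole. -/

section AdditiveReduction

variable {R : Type*} [CommRing R] [IsDomain R] [IsDiscreteValuationRing R] {K : Type*}
  [Field K] [Algebra R K] [IsFractionRing R K]

/-- A Legendre curve whose parameter has a pole of odd order has additive reduction. -/
theorem localPolynomial_legendreCurve_of_one_lt_valuation (h2 : (2 : ResidueField R) ≠ 0) {x : K}
    (hx : 1 < (IsDiscreteValuationRing.maximalIdeal R).valuation K x)
    (hodd : ∀ y : K, (IsDiscreteValuationRing.maximalIdeal R).valuation K y ^ 2 ≠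
      (IsDiscreteValuationRing.maximalIdeal R).valuation K x) :
    (legendreCurve x).localPolynomial R = 1 := by
  classical
  set v := (IsDiscreteValuationRing.maximalIdeal R).valuation K with hv
  obtain ⟨D, hD⟩ : ∃ D : VariableChange K, (legendreCurve x).minimal R = D • legendreCurve x :=
    ⟨_, rfl⟩
  rw [localPolynomial_eq h2 _ rfl]
  have h16 : v 16 = 1 := by
    have h3 : (16 : K) = algebraMap R K 16 := (map_ofNat _ _).symm
    rw [h3, hv, valuation_algebraMap_eq_one_iff, map_ofNat]
    have h4 : (16 : ResidueField R) = 2 ^ 4 := by norm_num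
    rw [h4]
    exact pow_ne_zero _ h2
  have hu : (D.u : K) ≠ 0 := D.u.ne_zero
  have hx0 : v x ≠ 0 := (zero_lt_one.trans hx).ne'
  have h1 : v (x - 1) = v x := by
    rw [Valuation.map_sub_eq_of_lt_left]
    rwa [map_one]
  have hc : v (legendreCurve x).c₄ = v x ^ 2 := by
    have h3 : x ^ 2 - x + 1 = x * (x - 1) + 1 := by ring
    have h4 : v (x * (x - 1)) = v x ^ 2 := by rw [map_mul, h1, sq]
    rw [legendreCurve_c₄, map_mul, h16, one_mul, h3, Valuation.map_add_eq_of_lt_left, h4]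
    rw [map_one, h4]
    exact one_lt_pow₀ hx two_ne_zero
  have hΔ : v (legendreCurve x).Δ = v x ^ 4 := by
    rw [legendreCurve_Δ, map_mul, map_mul, map_pow, map_pow, h1, h16, one_mul, ← pow_add]
  have hc' : v (D.u : K) ^ 4 * v ((legendreCurve x).minimal R).c₄ = v x ^ 2 := by
    rw [hD, variableChange_c₄, ← hc, ← map_pow, ← map_mul]
    simp
  have hΔ' : v (D.u : K) ^ 12 * v ((legendreCurve x).minimal R).Δ = v x ^ 4 := by
    rw [hD, variableChange_Δ, ← hΔ, ← map_pow, ← map_mul]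
    simp
  -- A unit c₄ would give v(u)⁴ = v(x)², hence v(u)² = v(x), contrary to the parity assumption. A
  -- unit Δ would give v(c₄)³ = v(x)² > 1, contrary to integrality of c₄.
  rw [if_neg, if_neg]
  · intro h
    rw [reduction, map_c₄, ← valuation_algebraMap_eq_one_iff (K := K), integralModel_c₄_eq] at h
    rw [← hv] at h
    rw [h, mul_one] at hc'
    refine hodd D.u ?_
    refine (pow_left_inj₀ zero_le zero_le two_ne_zero).mp ?_
    rw [← hc', ← pow_mul]
  · intro h
    rw [reduction, map_Δ, ← valuation_algebraMap_eq_one_iff (K := K), integralModel_Δ_eq] at h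
    rw [← hv] at h
    rw [h, mul_one] at hΔ'
    have h3 : v ((legendreCurve x).minimal R).c₄ ≤ 1 := by
      rw [← integralModel_c₄_eq R]
      exact IsDedekindDomain.HeightOneSpectrum.valuation_le_one _ _
    have h4 : v ((legendreCurve x).minimal R).c₄ ^ 3 = v x ^ 2 := by
      refine mul_left_cancel₀ (pow_ne_zero 4 hx0) ?_
      rw [← pow_add, ← hΔ']
      calc _ = (v (D.u : K) ^ 4 * v ((legendreCurve x).minimal R).c₄) ^ 3 := by
            rw [mul_pow, ← pow_mul]
        _ = _ := by rw [hc', ← pow_mul]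
    have h5 := pow_le_one₀ zero_le h3 (n := 3)
    rw [h4] at h5
    exact absurd (one_lt_pow₀ hx two_ne_zero) h5.not_gt

end AdditiveReduction

/-- Passing from t to 1/t is in general a quadratic twist by t; it is an isomorphism when t is a
square. This handles infinity for even d. -/
theorem smul_legendreCurve_sq {K : Type*} [Field K] (u : Kˣ) :
    (⟨u, 0, 0, 0⟩ : VariableChange K) • legendreCurve ((u : K) ^ 2) =
      legendreCurve (((u : K)⁻¹) ^ 2) := by
  have hu : (u : K) ≠ 0 := u.ne_zero
  ext <;> simp [variableChange_def, legendreCurve] <;> field_simp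
  · ring

end WeierstrassCurve

/-! ### Local factors of the Legendre curve at the places of F(u). -/

namespace FunctionFieldPlace

open IsLocalRing WeierstrassCurve

attribute [local instance] residueAlgebra

variable {F : Type*} [Field F]

theorem valuation_maximalIdeal_le_one_iff (v : FunctionFieldPlace F (RatFunc F)) (x : RatFunc F) :
    (IsDiscreteValuationRing.maximalIdeal v.ring).valuation (RatFunc F) x ≤ 1 ↔ x ∈ v.ring := by
  refine ⟨fun h ↦ ?_, fun h ↦
    IsDedekindDomain.HeightOneSpectrum.valuation_le_one _ (⟨x, h⟩ : v.ring)⟩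
  obtain ⟨y, rfl⟩ := IsDiscreteValuationRing.exists_lift_of_le_one h
  exact y.2

/-- The adic valuation of the ring at infinity and `RatFunc.inftyValuation` have the same valuation
ring, and for the latter the exponent of a square is even while that of X ^ d is d. -/
theorem valuation_sq_ne_valuation_X_pow {d : ℕ} (hd : ¬ Even d) (y : RatFunc F) :
    (IsDiscreteValuationRing.maximalIdeal (infinity F).ring).valuation (RatFunc F) y ^ 2 ≠
      (IsDiscreteValuationRing.maximalIdeal (infinity F).ring).valuation (RatFunc F)
        (RatFunc.X ^ d) := by
  classical
  intro h
  set v := (IsDiscreteValuationRing.maximalIdeal (infinity F).ring).valuation (RatFunc F)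
  have hX : (RatFunc.X : RatFunc F) ^ d ≠ 0 := pow_ne_zero _ RatFunc.X_ne_zero
  have hy : y ≠ 0 := by
    rintro rfl
    rw [map_zero, zero_pow two_ne_zero, eq_comm, Valuation.zero_iff] at h
    exact hX h
  have hvX : v (RatFunc.X ^ d) ≠ 0 := (Valuation.ne_zero_iff _).mpr hX
  have h1 : y ^ 2 / RatFunc.X ^ d ∈ (infinity F).ring := by
    rw [← valuation_maximalIdeal_le_one_iff]
    change v _ ≤ 1
    rw [map_div₀, map_pow, h, div_self hvX]
  have h3 : RatFunc.X ^ d / y ^ 2 ∈ (infinity F).ring := by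
    rw [← valuation_maximalIdeal_le_one_iff]
    change v _ ≤ 1
    rw [map_div₀, map_pow _ y, h, div_self hvX]
  have h1' : RatFunc.inftyValuation F (y ^ 2 / RatFunc.X ^ d) ≤ 1 := by
    convert (Valuation.mem_valuationSubring_iff _ _).mp h1
  have h3' : RatFunc.inftyValuation F (RatFunc.X ^ d / y ^ 2) ≤ 1 := by
    convert (Valuation.mem_valuationSubring_iff _ _).mp h3
  have h4 : RatFunc.inftyValuation F (y ^ 2) = RatFunc.inftyValuation F (RatFunc.X ^ d) := by
    refine le_antisymm ?_ ?_
    · rw [map_div₀] at h1'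
      exact (div_le_one₀ (zero_lt_iff.mpr ((Valuation.ne_zero_iff _).mpr hX))).mp h1'
    · rw [map_div₀] at h3'
      exact (div_le_one₀ (zero_lt_iff.mpr
        ((Valuation.ne_zero_iff _).mpr (pow_ne_zero _ hy)))).mp h3'
  rw [map_pow, map_pow, RatFunc.inftyValuation.X, RatFunc.inftyValuation_apply,
    RatFunc.inftyValuation_of_nonzero F hy, ← WithZero.exp_nsmul, ← WithZero.exp_nsmul,
    WithZero.exp_inj] at h4
  refine hd ?_
  rw [← Int.even_coe_nat]
  exact ⟨y.intDegree, by simpa [two_mul] using h4.symm⟩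

variable (h2 : (2 : F) ≠ 0)

include h2 in
theorem residueField_two_ne_zero (v : FunctionFieldPlace F (RatFunc F)) :
    (2 : ResidueField v.ring) ≠ 0 := by
  rw [← map_ofNat (algebraMap F (ResidueField v.ring))]
  exact (_root_.map_ne_zero _).mpr h2

variable [Finite F] {d : ℕ} (hd : d ≠ 0)

include h2 hd in
theorem aeval_localPolynomial_ofIrreducible {P : F[X]} (hP : Irreducible P) (T : ℂ) :
    have := finite_residueField (ofIrreducible P hP)
    aeval T ((legendreCurveOver F d).localPolynomial (ofIrreducible P hP).ring) =
      1 + legendreSum (ResidueField (ofIrreducible P hP).ring)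
          (residue _ ⟨RatFunc.X, X_mem_ofIrreducible hP⟩ ^ d) * T +
        legendreDet (ResidueField (ofIrreducible P hP).ring)
          (residue _ ⟨RatFunc.X, X_mem_ofIrreducible hP⟩ ^ d) * T ^ 2 := by
  intro _
  set v := ofIrreducible P hP
  set x : v.ring := ⟨RatFunc.X, X_mem_ofIrreducible hP⟩
  have hX : (x : RatFunc F) = RatFunc.X := rfl
  rw [← map_pow]
  refine aeval_localPolynomial_of_smul_eq_legendreCurve (residueField_two_ne_zero h2 v)
    (D := 1) ?_ ?_ ?_ T
  · exact pow_ne_zero _ fun h ↦ RatFunc.X_ne_zero (congrArg Subtype.val h)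
  · intro h
    have h1 : (RatFunc.X : RatFunc F) ^ d = 1 := congrArg Subtype.val h
    rw [← RatFunc.algebraMap_X, ← map_pow, ← map_one (algebraMap F[X] (RatFunc F))] at h1
    have h3 := congrArg natDegree (RatFunc.algebraMap_injective F h1)
    simp [hd] at h3
  · rw [one_smul]
    rfl

include h2 hd in
-- For even d the curve is isomorphic to the Legendre curve with parameter u^(-d), which reduces to
-- 0: split multiplicative reduction. For odd d the reduction is additive.
theorem aeval_localPolynomial_infinity (T : ℂ) :
    aeval T ((legendreCurveOver F d).localPolynomial (infinity F).ring) =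
      if Even d then 1 - T else 1 := by
  have := finite_residueField (infinity F)
  set v := infinity F
  have h2v := residueField_two_ne_zero h2 v
  have hX0 : (RatFunc.X : RatFunc F) ≠ 0 := RatFunc.X_ne_zero
  set y : v.ring := ⟨RatFunc.X⁻¹, X_inv_mem X_notMem_infinity⟩ with hy
  have hyr : residue v.ring y = 0 := residue_X_inv X_notMem_infinity
  split_ifs with heven
  · obtain ⟨m, hm⟩ := heven
    have h := aeval_localPolynomial_of_smul_eq_legendreCurve h2v (t := y ^ d)
      (W := legendreCurveOver F d) (D := ⟨Units.mk0 (RatFunc.X ^ m) (pow_ne_zero _ hX0), 0, 0, 0⟩)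
      ?_ ?_ ?_ T
    · rw [h, map_pow, hyr, zero_pow hd, legendreSum_zero h2v, legendreDet, if_pos (Or.inl rfl)]
      ring
    · exact pow_ne_zero _ fun h ↦ inv_ne_zero hX0 (congrArg Subtype.val h)
    · intro h
      have h1 := congrArg (residue v.ring) h
      rw [map_pow, hyr, zero_pow hd, map_one] at h1
      exact zero_ne_one h1
    · have h1 := smul_legendreCurve_sq (Units.mk0 ((RatFunc.X : RatFunc F) ^ m) (pow_ne_zero _ hX0))
      rw [legendreCurveOver, hm, ← two_mul, mul_comm 2 m, pow_mul, pow_mul]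
      refine h1.trans ?_
      congr 1
      simp [hy]
  · rw [legendreCurveOver, localPolynomial_legendreCurve_of_one_lt_valuation h2v, map_one]
    · rw [map_pow]
      refine one_lt_pow₀ ?_ hd
      rw [← not_le]
      exact fun h ↦ X_notMem_infinity ((valuation_maximalIdeal_le_one_iff _ _).mp h)
    · exact valuation_sq_ne_valuation_X_pow heven

end FunctionFieldPlace

/-! ### A crude bound for the roots of a quadratic polynomial. -/

section QuadraticRoots

/-- The reciprocal roots of `1 + a T + b T ^ 2`. -/
theorem exists_add_eq_mul_eq_norm_le {a b : ℂ} {Q : ℝ} (hQ : 1 ≤ Q) (ha : ‖a‖ ≤ Q) (hb : ‖b‖ ≤ Q) :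
    ∃ α β : ℂ, α + β = -a ∧ α * β = b ∧ ‖α‖ ≤ 2 * Q ∧ ‖β‖ ≤ 2 * Q := by
  have hbound (x : ℂ) (hx : x * x = -a * x - b) : ‖x‖ ≤ 2 * Q := by
    by_contra! h
    have h1 : ‖x‖ * ‖x‖ ≤ Q * ‖x‖ + Q := by
      rw [← norm_mul, hx]
      refine (norm_sub_le _ _).trans (add_le_add ?_ hb)
      rw [norm_mul, norm_neg]
      gcongr
    nlinarith
  obtain ⟨r, hr⟩ := IsAlgClosed.exists_pow_nat_eq (a ^ 2 - 4 * b) (n := 2) two_pos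
  refine ⟨(-a + r) / 2, (-a - r) / 2, by ring, ?_, hbound _ ?_, hbound _ ?_⟩
  · linear_combination -hr / 4
  · linear_combination hr / 4
  · linear_combination hr / 4

end QuadraticRoots

/-! ### A bound for the number of irreducible polynomials. -/

section CountIrreducible

variable {F : Type*} [Field F] [Finite F]

theorem card_irredOfDegree_le (n : ℕ) (hn : n ≠ 0) :
    (irredOfDegree F n).card ≤ Nat.card F ^ n := by
  have := Fintype.ofFinite (finiteSubfield F n)
  have h := sum_minpoly (k := F) (L := finiteSubfield F n) (fun _ ↦ 1)
  rw [finrank_finiteSubfield hn, Finset.sum_const, Finset.card_univ, ← Nat.card_eq_fintype_card,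
    natCard_finiteSubfield hn, smul_eq_mul, mul_one] at h
  rw [h]
  calc (irredOfDegree F n).card ≤ ∑ P ∈ irredOfDegree F n, n • 1 := by
        rw [Finset.sum_const, smul_eq_mul, smul_eq_mul, mul_one]
        exact Nat.le_mul_of_pos_right _ (Nat.pos_of_ne_zero hn)
    _ ≤ _ := Finset.single_le_sum (f := fun d ↦ ∑ P ∈ irredOfDegree F d, d • 1)
        (fun _ _ ↦ Nat.zero_le _) (Nat.mem_divisors_self n hn)

end CountIrreducible

/-! ### Reciprocal roots of the finite local factors. -/

namespace FunctionFieldPlace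

open IsLocalRing

attribute [local instance] residueAlgebra

variable {F : Type*} [Field F] [Finite F] (h2 : (2 : F) ≠ 0) {d : ℕ}

theorem natCard_residueField (v : FunctionFieldPlace F (RatFunc F)) :
    Nat.card (ResidueField v.ring) = Nat.card F ^ v.degree := by
  have := finite_residueField v
  have : Module.Finite F (ResidueField v.ring) := .of_finite
  exact Module.natCard_eq_pow_finrank

include h2 in
/-- The local factors at the places away from infinity compute the character sums over extensions
of the field of constants. -/
theorem exists_reciprocal_roots (hd : d ≠ 0) {P : F[X]} (hP : Irreducible P) (hm : P.Monic) :
    ∃ α β : ℂ, ‖α‖ ≤ 2 * (Nat.card F : ℝ) ^ P.natDegree ∧ ‖β‖ ≤ 2 * (Nat.card F : ℝ) ^ P.natDegree ∧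
      (∀ T : ℂ, aeval T ((legendreCurveOver F d).localPolynomial (ofIrreducible P hP).ring) =
        (1 - α * T) * (1 - β * T)) ∧
      ∀ (L : Type _) [Field L] [Finite L] [Algebra F L] (x : L), minpoly F x = P →
        α ^ (Module.finrank F L / P.natDegree) + β ^ (Module.finrank F L / P.natDegree) =
          -legendreSum L (x ^ d) := by
  set v := ofIrreducible P hP with hv
  have := finite_residueField v
  set ξ := residue v.ring ⟨RatFunc.X, X_mem_ofIrreducible hP⟩ with hξ
  have hcard : Nat.card (ResidueField v.ring) = Nat.card F ^ P.natDegree := by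
    rw [natCard_residueField, degree_ofIrreducible hP hm]
  have hQ : (1 : ℝ) ≤ Nat.card (ResidueField v.ring) := by
    exact_mod_cast Nat.card_pos
  obtain ⟨α, β, hα, hβ, hαn, hβn⟩ := exists_add_eq_mul_eq_norm_le hQ
    (norm_legendreSum_le (ξ ^ d))
    (b := legendreDet (ResidueField v.ring) (ξ ^ d)) (by
      rw [legendreDet]
      split_ifs
      · simp
      · simp)
  rw [hcard, Nat.cast_pow] at hαn hβn
  refine ⟨α, β, hαn, hβn, fun T ↦ ?_, fun L _ _ _ x hx ↦ ?_⟩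
  · refine (aeval_localPolynomial_ofIrreducible h2 hd hP T).trans ?_
    change 1 + legendreSum (ResidueField v.ring) (ξ ^ d) * T +
      legendreDet (ResidueField v.ring) (ξ ^ d) * T ^ 2 = _
    rw [← hβ]
    linear_combination T * hα
  -- Since ξ and x share the minimal polynomial P, sending ξ to x embeds the residue field in L;
  -- `legendreSum_extension` then applies to this extension.
  · have hker : RingHom.ker (aeval (R := F) ξ).toRingHom ≤ RingHom.ker (aeval (R := F) x).toRingHom := by
      intro g hg
      have hg' : aeval ξ g = 0 := hg
      rw [← minpoly.dvd_iff, hξ, minpoly_ofIrreducible hP hm, ← hx, minpoly.dvd_iff] at hg'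
      exact hg'
    have hsurj := aeval_residue_surjective (isGenerator_X F) (X_mem_ofIrreducible hP)
    let φ : ResidueField v.ring →ₐ[F] L :=
      AlgHom.liftOfSurjective (aeval (R := F) ξ) hsurj (aeval (R := F) x) hker
    have hφ : φ ξ = x := by
      have h1 := AlgHom.liftOfSurjective_apply (aeval (R := F) ξ) hsurj (aeval (R := F) x) hker X
      rwa [aeval_X, aeval_X] at h1
    let : Algebra (ResidueField v.ring) L := φ.toRingHom.toAlgebra
    have : IsScalarTower F (ResidueField v.ring) L :=
      IsScalarTower.of_algebraMap_eq fun c ↦ (φ.commutes c).symm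
    have hfin : Module.Finite F (ResidueField v.ring) := .of_finite
    have h3 := Module.finrank_mul_finrank F (ResidueField v.ring) L
    rw [← degree_eq_finrank, degree_ofIrreducible hP hm] at h3
    have h4 := legendreSum_extension (L := L) (residueField_two_ne_zero h2 v) (ξ ^ d) hα hβ
    have h5 : algebraMap (ResidueField v.ring) L (ξ ^ d) = x ^ d := by
      rw [map_pow]
      exact congrArg (· ^ d) hφ
    rw [h5] at h4
    rw [h4, neg_neg, ← h3, Nat.mul_div_cancel_left _ hP.natDegree_pos]

end FunctionFieldPlace

/-! ### The L-function as a product over Frobenius orbits. -/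

section LFunction

variable {F : Type*} [Field F] [Finite F] {d : ℕ} [NeZero d]
  (ℓ : rootsOfUnity d (AlgebraicClosure F) ≃* Multiplicative (ZMod d))

theorem frobeniusPeriod_frobenius (hd : (d : F) ≠ 0) (c : ZMod d) :
    frobeniusPeriod F (((Nat.card F : ℕ) : ZMod d) * c) = frobeniusPeriod F c := by
  rw [frobeniusPeriod, frobeniusPeriod, ZMod.addOrderOf_natCast_mul (card_coprime hd)]

open scoped Classical in
/-- The indices of the places of `F(u)` of a given degree. -/
noncomputable def placesOfDegree (F : Type*) [Field F] [Finite F] (e : ℕ) :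
    Finset (Option {P : F[X] // P.Monic ∧ Irreducible P}) :=
  (if e = 1 then {none} else ∅) ∪
    ((irredOfDegree F e).subtype fun P ↦ P.Monic ∧ Irreducible P).map Function.Embedding.some

theorem mem_placesOfDegree (e : ℕ) (v : Option {P : F[X] // P.Monic ∧ Irreducible P}) :
    v ∈ placesOfDegree F e ↔ v.elim 1 (fun P ↦ P.1.natDegree) = e := by
  classical
  rcases v with _ | ⟨P, hP⟩
  · rw [placesOfDegree]
    split_ifs with h <;> simp [h, eq_comm]
  · rw [placesOfDegree]
    split_ifs with h <;> simp [hP]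

theorem sum_placesOfDegree {M : Type*} [AddCommMonoid M] (e : ℕ)
    (f : Option {P : F[X] // P.Monic ∧ Irreducible P} → M) (g : F[X] → M)
    (hfg : ∀ P, f (some P) = g P.1) :
    ∑ v ∈ placesOfDegree F e, f v =
      (if e = 1 then f none else 0) + ∑ P ∈ irredOfDegree F e, g P := by
  classical
  rw [placesOfDegree, Finset.sum_union]
  · congr 1
    · split_ifs <;> simp
    · rw [Finset.sum_map]
      simp only [Function.Embedding.some_apply, hfg]
      rw [Finset.sum_subtype_of_mem g fun P hP ↦ ?_]
      rw [mem_irredOfDegree] at hP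
      exact ⟨hP.1.1, hP.2⟩
  · rw [Finset.disjoint_left]
    intro v hv hv'
    obtain ⟨P, -, rfl⟩ := Finset.mem_map.mp hv'
    split_ifs at hv <;> simp at hv

theorem card_placesOfDegree_le (e : ℕ) :
    ((placesOfDegree F e).card : ℝ) ≤ (2 * Nat.card F : ℝ) ^ e := by
  have h : (placesOfDegree F e).card = (if e = 1 then 1 else 0) + (irredOfDegree F e).card := by
    rw [Finset.card_eq_sum_ones, sum_placesOfDegree e _ (fun _ ↦ 1) fun _ ↦ rfl,
      Finset.card_eq_sum_ones]
  have hq : 1 ≤ Nat.card F := Nat.card_pos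
  have h' : (placesOfDegree F e).card ≤ (2 * Nat.card F) ^ e := by
    rw [h]
    rcases Nat.eq_zero_or_pos e with rfl | he
    · have : irredOfDegree F 0 = ∅ := by
        refine Finset.eq_empty_of_forall_notMem fun P hP ↦ ?_
        rw [mem_irredOfDegree] at hP
        exact hP.2.natDegree_pos.ne' hP.1.2
      simp [this]
    · calc _ ≤ Nat.card F ^ e + Nat.card F ^ e := by
            refine add_le_add ?_ (card_irredOfDegree_le e he.ne')
            split_ifs
            · exact Nat.one_le_pow _ _ hq
            · exact Nat.zero_le _
        _ = 2 * Nat.card F ^ e := (two_mul _).symm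
        _ ≤ 2 ^ e * Nat.card F ^ e := Nat.mul_le_mul_right _ (Nat.le_self_pow he.ne' 2)
        _ = _ := (mul_pow _ _ _).symm
  exact_mod_cast h'

open FunctionFieldPlace in
/-- The Euler product of the Legendre curve over `F(u)` is a product over Frobenius orbits of
characters. -/
theorem hasProd_localPolynomial_legendreCurveOver (h2 : (2 : F) ≠ 0) (hd : (d : F) ≠ 0)
    {R : Finset (ZMod d)}
    (hR : ∀ g : ZMod d → ℂ, (∀ c, g (((Nat.card F : ℕ) : ZMod d) * c) = g c) →
      ∑ c with 2 < addOrderOf c, g c = ∑ c ∈ R, frobeniusPeriod F c * g c) :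
    ∃ ε > 0, ∀ T : ℂ, ‖T‖ < ε → HasProd (fun v : FunctionFieldPlace F (RatFunc F) ↦
      (aeval (T ^ v.degree) ((legendreCurveOver F d).localPolynomial v.ring))⁻¹)
      (∏ c ∈ R, (1 - jacobiRoot ℓ c * T ^ frobeniusPeriod F c)) := by
  classical
  have hd0 : d ≠ 0 := NeZero.ne d
  choose α β hα hβ hT hL using fun P : {P : F[X] // P.Monic ∧ Irreducible P} ↦
    exists_reciprocal_roots h2 hd0 P.2.2 P.2.1
  set deg : Option {P : F[X] // P.Monic ∧ Irreducible P} → ℕ :=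
    fun v ↦ v.elim 1 fun P ↦ P.1.natDegree with hdeg
  set A : Option {P : F[X] // P.Monic ∧ Irreducible P} → ℂ :=
    fun v ↦ v.elim (if Even d then 1 else 0) α with hA
  set B : Option {P : F[X] // P.Monic ∧ Irreducible P} → ℂ := fun v ↦ v.elim 0 β with hB
  have hq : (1 : ℝ) ≤ Nat.card F := by exact_mod_cast Nat.card_pos
  have hdeg0 : ∀ v, deg v ≠ 0 := by
    rintro (_ | P)
    · exact one_ne_zero
    · exact P.2.2.natDegree_pos.ne'
  have hpow (P : {P : F[X] // P.Monic ∧ Irreducible P}) :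
      2 * (Nat.card F : ℝ) ^ P.1.natDegree ≤ (2 * Nat.card F : ℝ) ^ P.1.natDegree := by
    rw [mul_pow]
    gcongr
    exact le_self_pow₀ one_le_two P.2.2.natDegree_pos.ne'
  have hAn : ∀ v, ‖A v‖ ≤ (2 * Nat.card F : ℝ) ^ deg v := by
    rintro (_ | P)
    · simp only [hA, hdeg, Option.elim_none, pow_one]
      split_ifs
      · rw [norm_one]
        linarith
      · rw [norm_zero]
        positivity
    · exact (hα P).trans (hpow P)
  have hBn : ∀ v, ‖B v‖ ≤ (2 * Nat.card F : ℝ) ^ deg v := by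
    rintro (_ | P)
    · simp only [hB, hdeg, Option.elim_none, norm_zero]
      positivity
    · exact (hβ P).trans (hpow P)
  obtain ⟨ε, hε, hprod⟩ := hasProd_inv_of_coefficients (D := placesOfDegree F)
    mem_placesOfDegree hdeg0 (by linarith : (1 : ℝ) ≤ 2 * Nat.card F) (by positivity)
    card_placesOfDegree_le hAn hBn R (fun c ↦ (frobeniusPeriod_pos hd c).ne') (jacobiRoot ℓ) (by
      intro n hn
      -- The finite places of degree dividing n are regrouped as the elements of the degree n
      -- extension, through minimal polynomials. The place at infinity contributes 1 for even d and
      -- 0 for odd d.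
      have key : ∑ e ∈ n.divisors, ∑ v ∈ placesOfDegree F e, (e : ℂ) * (A v ^ (n / e) + B v ^ (n / e)) =
          (if Even d then 1 else 0) -
            ∑ u : finiteSubfield F n, legendreSum (finiteSubfield F n) (u ^ d) := by
        let g : F[X] → ℂ := fun P ↦ if hP : P.Monic ∧ Irreducible P then
          α ⟨P, hP⟩ ^ (n / P.natDegree) + β ⟨P, hP⟩ ^ (n / P.natDegree) else 0
        have h1 : ∀ e ∈ n.divisors, ∑ v ∈ placesOfDegree F e,
            (e : ℂ) * (A v ^ (n / e) + B v ^ (n / e)) =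
              (if e = 1 then (if Even d then 1 else 0) else 0) +
                ∑ P ∈ irredOfDegree F e, e • g P := by
          intro e he
          have h3 : ∀ v ∈ placesOfDegree F e, (e : ℂ) * (A v ^ (n / e) + B v ^ (n / e)) =
              deg v * (A v ^ (n / deg v) + B v ^ (n / deg v)) := fun v hv ↦ by
            have hv' : deg v = e := (mem_placesOfDegree e v).mp hv
            rw [hv']
          rw [Finset.sum_congr rfl h3, sum_placesOfDegree e _ (fun P ↦ P.natDegree • g P)]
          · congr 1
            · split_ifs <;> simp [A, B, deg, *]
            · refine Finset.sum_congr rfl fun P hP ↦ ?_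
              rw [(mem_irredOfDegree.mp hP).1.2]
          · rintro ⟨P, hP⟩
            simp only [g, dif_pos hP, nsmul_eq_mul]
            rfl
        rw [Finset.sum_congr rfl h1, Finset.sum_add_distrib, Finset.sum_ite_eq',
          if_pos (Nat.one_mem_divisors.mpr hn), sub_eq_add_neg, ← Finset.sum_neg_distrib]
        congr 1
        have h4 := sum_minpoly (k := F) (L := finiteSubfield F n) g
        rw [finrank_finiteSubfield hn] at h4
        rw [← h4]
        refine Finset.sum_congr rfl fun x _ ↦ ?_
        have hx : IsIntegral F x := .of_finite F x
        have h5 := hL ⟨minpoly F x, minpoly.monic hx, minpoly.irreducible hx⟩ (finiteSubfield F n) x rfl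
        rw [finrank_finiteSubfield hn] at h5
        rw [← h5]
        simp only [g]
        rw [dif_pos ⟨minpoly.monic hx, minpoly.irreducible hx⟩]
      -- The contribution of infinity cancels the leftover term of the trace formula, and the
      -- summand is constant on the orbits of multiplication by q, so it suffices to sum over
      -- representatives.
      rw [key, sum_legendreSum_pow_finiteSubfield ℓ h2 hd hn, sub_add_cancel_left, neg_inj,
        ← Finset.filter_filter, Finset.sum_filter,
        hR fun c ↦ if frobeniusPeriod F c ∣ n then jacobiRoot ℓ c ^ (n / frobeniusPeriod F c) else 0]
      · rw [Finset.sum_filter]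
        simp only [mul_ite, mul_zero]
      · intro c
        simp only [frobeniusPeriod_frobenius hd, jacobiRoot_frobenius ℓ h2 hd])
  refine ⟨ε, hε, fun T hTε ↦ ?_⟩
  rw [← (optionEquiv F).hasProd_iff]
  convert hprod T hTε using 1
  funext v
  rcases v with _ | P
  · change (aeval (T ^ (infinity F).degree)
      ((legendreCurveOver F d).localPolynomial (infinity F).ring))⁻¹ =
        ((1 - A none * T ^ 1) * (1 - B none * T ^ 1))⁻¹
    rw [degree_infinity, aeval_localPolynomial_infinity h2 hd0, pow_one]
    simp only [hA, hB, Option.elim_none]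
    split_ifs <;> simp
  · change (aeval (T ^ (ofIrreducible P.1 P.2.2).degree)
      ((legendreCurveOver F d).localPolynomial (ofIrreducible P.1 P.2.2).ring))⁻¹ =
        ((1 - α P * T ^ P.1.natDegree) * (1 - β P * T ^ P.1.natDegree))⁻¹
    rw [degree_ofIrreducible P.2.2 P.2.1, hT]

end LFunction

end Auxiliary

theorem corollary4p2 (p : ℕ) (hp : p.Prime) (hp2 : p ≠ 2) (F : Type*) [Field F] [Finite F]
    [CharP F p] (d : ℕ) (hd : 0 < d) (hpd : ¬ p ∣ d) :
    (∃ f : ℂ → ℂ, IsHasseWeilLFunction F (legendreCurveOver F d) f) ∧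
    ∀ f : ℂ → ℂ, IsHasseWeilLFunction F (legendreCurveOver F d) f →
      analyticOrderAt f 1 =
        ((∑ e ∈ d.divisors with 2 < e,
          if IsBalancedMod p e then e.totient / orderOf ((Nat.card F : ℕ) : ZMod e) else 0 : ℕ) :
          ℕ∞) := by
  have : NeZero d := ⟨hd.ne'⟩
  have h2 : (2 : F) ≠ 0 := by
    rw [← Nat.cast_ofNat, Ne, CharP.cast_eq_zero_iff F p, Nat.prime_dvd_prime_iff_eq hp Nat.prime_two]
    exact hp2
  have hdF : (d : F) ≠ 0 := by rwa [Ne, CharP.cast_eq_zero_iff F p]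
  have hq : 1 < Nat.card F := Finite.one_lt_card
  obtain ⟨ℓ⟩ := nonempty_rootsOfUnity_equiv F d hdF
  obtain ⟨R, hR2, hR, hcount⟩ := exists_frobenius_representatives (F := F) hdF
  obtain ⟨ε, hε, hprod⟩ := hasProd_localPolynomial_legendreCurveOver ℓ h2 hdF hR
  obtain ⟨σ, hσ⟩ := exists_forall_norm_cpow_lt hq hε
  set f₀ : ℂ → ℂ := fun s ↦
    ∏ c ∈ R, (1 - jacobiRoot ℓ c * ((Nat.card F : ℂ) ^ (-s)) ^ frobeniusPeriod F c) with hf₀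
  have hdiff : Differentiable ℂ f₀ := Differentiable.fun_finsetProd fun c _ ↦
    differentiable_one_sub_mul_cpow hq _ _
  refine ⟨⟨f₀, hdiff, σ, fun s hs ↦ hprod _ (hσ s hs)⟩, ?_⟩
  rintro f ⟨hf, τ, hτ⟩
  -- Both functions equal the Euler product on a common half-plane, so every continuation is the
  -- explicit product.
  have hff₀ : f = f₀ := hf.eq_of_eqOn_re hdiff (σ := max σ τ) fun s hs ↦
    (hτ s ((le_max_right _ _).trans_lt hs)).unique (hprod _ (hσ s ((le_max_left _ _).trans_lt hs)))
  rw [hff₀, hf₀, analyticOrderAt_prod_one_sub_mul_cpow hq R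
    (fun c ↦ (frobeniusPeriod_pos hdF c).ne') (jacobiRoot ℓ),
    ← hcount (fun e ↦ IsBalancedMod p e) inferInstance]
  congr 1
  refine Finset.sum_congr rfl fun c hc ↦ ?_
  simp only [jacobiRoot_eq_card_iff ℓ hp hp2 hdF (hR2 c hc)]
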